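/- **Comprehension categories.** A *comprehension category* is a fibration $p\colon\mathcal E\to\mathcal B$ with a functor $\chi\colon\mathcal E\to\mathcal B^{\mathbf 2}$ such that $\mathrm{cod}\circ\chi=p$ and $\chi$ maps $p$-cartesian arrows to pullback squares. A *lax morphism* $(p,\chi)\to(p',\chi')$ is a triple $(B,H,\zeta)$ of functors $B\colon\mathcal B\to\mathcal B'$, $H\colon\mathcal E\to\mathcal E'$ with $p'H=Bp$ and $H$ preserving cartesian arrows, and a natural transformation $\zeta\colon B^{\mathbf 2}\chi\Rightarrow\chi'H$ whose codomain part is the identity. It is *pseudo* if $\zeta$ is invertible. A *2-cell* $(B_1,H_1,\zeta_1)\Rightarrow(B_2,H_2,\zeta_2)$ is a pair of natural transformations $\psi\colon B_1\Rightarrow B_2$, $\phi\colon H_1\Rightarrow H_2$ with $p'\phi=\psi p$ and $\chi'\phi\circ\zeta_1=\zeta_2\circ\psi^{\mathbf 2}\chi$. With the composition $(B_2,H_2,\zeta_2)(B_1,H_1,\zeta_1)=(B_2B_1,H_2H_1,\zeta_2H_1\circ B_2^{\mathbf 2}\zeta_1)$ these form the 2-category $\mathbf{CompCat}$. **Generalised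 categories with families.** A *gcwf* consists of two fibrations $u\colon\mathcal U\to\mathcal B$ and $\dot u\colon\dot{\mathcal U}\to\mathcal B$ over the same base and an adjunction $\Sigma\dashv\Delta$, $\Sigma\colon\dot{\mathcal U}\to\mathcal U$, where $u\Sigma=\dot u$, $\Sigma$ preserves cartesian arrows, and the components of the unit are $\dot u$-cartesian and those of the counit $u$-cartesian. A *loose morphism* is a quadruple $(C,H,\dot H,\zeta)$ where $C$ is a functor between the bases, $(C,H)\colon u\to u'$ and $(C,\dot H)\colon\dot u\to\dot u'$ commute strictly with the fibrations and preserve cartesian arrows, and $\zeta\colon\Sigma'\dot H\cong H\Sigma$ is a natural isomorphism that is vertical, i.e. with $u'\zeta=\mathrm{id}$. It is *pseudo* if the mate $\zeta^\#\colon\dot H\Delta\Rightarrow\Delta'H$ of $\zeta$ is invertible. A *2-cell* $(C_1,H_1,\dot H_1,\zeta_1)\Rightarrow(C_2,H_2,\dot H_2,\zeta_2)$ is a triple of natural transformations $\psi\colon C_1\Rightarrow C_2$, $\phi\colon H_1\Rightarrow H_2$, $\dot\phi\colon\dot H_1\Rightarrow\dot H_2$ with $u'\phi=\psi u$, $\dot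 u'\dot\phi=\psi\dot u$ and $\phi\Sigma\circ\zeta_1=\zeta_2\circ\Sigma'\dot\phi$. With the composition $(C_2C_1,H_2H_1,\dot H_2\dot H_1,H_2\zeta_1\circ\zeta_2\dot H_1)$ these form the 2-category $\mathbf{gCwF}$. **Adjoint biequivalences.** An *adjoint biequivalence* between 2-categories consists of 2-functors $G\colon\mathbf A\to\mathbf B$ and $E\colon\mathbf B\to\mathbf A$, pseudonatural transformations $\eta\colon\mathrm{Id}\Rightarrow EG$ and $\varepsilon\colon GE\Rightarrow\mathrm{Id}$ all of whose components are equivalences, and invertible modifications $\varepsilon G\circ G\eta\cong\mathrm{id}_G$ and $E\varepsilon\circ\eta E\cong\mathrm{id}_E$ that satisfy the two swallowtail equations. **Theorem.** There is an adjoint biequivalence, with left biadjoint $G\colon\mathbf{gCwF}\to\mathbf{CompCat}$ and right biadjoint $E\colon\mathbf{CompCat}\to\mathbf{gCwF}$, between the 2-category of gcwfs with loose morphisms and the 2-category of comprehension categories with lax morphisms, such that $G\circ E=\mathrm{Id}_{\mathbf{CompCat}}$. It restricts to the wide 2-full sub-2-categories on the pseudo morphisms: $G$ and $E$ preserve pseudo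 morphisms, the components of $\eta$ and $\varepsilon$ are pseudo and are equivalences in these sub-2-categories, so that the same data form an adjoint biequivalence between them, with composite $G\circ E$ again the identity. -/

import Mathlib

open CategoryTheory

universe v u

/-- An arrow of the total category of a functor `p` is cartesian. -/
abbrev IsCart {E : Type*} {B : Type*} [Category* E] [Category* B] (p : E ⥤ B)
    {x y : E} (f : x ⟶ y) : Prop :=
  p.IsStronglyCartesian (p.map f) f

/-- `(B, H)` is a morphism of fibrations from `p` to `p'`: the square of functors commutes strictly
and `H` maps cartesian arrows to cartesian arrows. -/
structure IsFibMor {E B E' B' : Type*} [Category* E] [Category* B] [Category* E'] [Category* B']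
    (p : E ⥤ B) (p' : E' ⥤ B') (F : B ⥤ B') (H : E ⥤ E') : Prop where
  comm : H ⋙ p' = p ⋙ F
  cart : ∀ {x y : E} (f : x ⟶ y), IsCart p f → IsCart p' (H.map f)

/-- `(ψ, φ)` is a 2-cell between morphisms of fibrations, that is `p' φ = ψ p`. -/
def IsFibCell {E B E' B' : Type*} [Category* E] [Category* B] [Category* E'] [Category* B']
    (p : E ⥤ B) (p' : E' ⥤ B') {F G : B ⥤ B'} {H K : E ⥤ E'} (ψ : F ⟶ G) (φ : H ⟶ K) : Prop :=
  ∀ e : E, p'.IsHomLift (ψ.app (p.obj e)) (φ.app e)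

namespace IsFibMor

variable {E B E' B' E'' B'' : Type*} [Category* E] [Category* B] [Category* E'] [Category* B']
  [Category* E''] [Category* B''] {p : E ⥤ B} {p' : E' ⥤ B'} {p'' : E'' ⥤ B''}

theorem id : IsFibMor p p (𝟭 B) (𝟭 E) := ⟨rfl, fun _ h => h⟩

theorem comp {F : B ⥤ B'} {H : E ⥤ E'} {F' : B' ⥤ B''} {H' : E' ⥤ E''}
    (h : IsFibMor p p' F H) (h' : IsFibMor p' p'' F' H') :
    IsFibMor p p'' (F ⋙ F') (H ⋙ H') where
  comm := by
    rw [Functor.assoc, h'.comm, ← Functor.assoc, h.comm, Functor.assoc]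
  cart f hf := h'.cart _ (h.cart f hf)

theorem obj_eq {F : B ⥤ B'} {H : E ⥤ E'} (h : IsFibMor p p' F H) (e : E) :
    p'.obj (H.obj e) = F.obj (p.obj e) := Functor.congr_obj h.comm e

/-- If `f` lies over `g` then `H f` lies over `F g`. -/
theorem isHomLift {F : B ⥤ B'} {H : E ⥤ E'} (h : IsFibMor p p' F H) {a b : E} {R S : B}
    {g : R ⟶ S} {f : a ⟶ b} (hf : p.IsHomLift g f) : p'.IsHomLift (F.map g) (H.map f) := by
  obtain ⟨⟩ := hf
  exact IsHomLift.of_fac' _ _ _ (h.obj_eq _) (h.obj_eq _) (Functor.congr_hom h.comm _)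

end IsFibMor

namespace IsFibCell

variable {E B E' B' E'' B'' : Type*} [Category* E] [Category* B] [Category* E'] [Category* B']
  [Category* E''] [Category* B''] {p : E ⥤ B} {p' : E' ⥤ B'} {p'' : E'' ⥤ B''}

theorem id {F : B ⥤ B'} {H : E ⥤ E'} (h : IsFibMor p p' F H) :
    IsFibCell p p' (𝟙 F) (𝟙 H) := fun e => IsHomLift.id (h.obj_eq e)

theorem comp {F G K : B ⥤ B'} {F' G' K' : E ⥤ E'} {ψ : F ⟶ G} {φ : F' ⟶ G'} {ψ' : G ⟶ K}
    {φ' : G' ⟶ K'} (h : IsFibCell p p' ψ φ) (h' : IsFibCell p p' ψ' φ') :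
    IsFibCell p p' (ψ ≫ ψ') (φ ≫ φ') := fun e => by
  have := h e
  have := h' e
  exact IsHomLift.comp _ _ _ _ _

theorem whiskerLeft {F : B ⥤ B'} {H : E ⥤ E'} (h : IsFibMor p p' F H) {G K : B' ⥤ B''}
    {G' K' : E' ⥤ E''} {ψ : G ⟶ K} {φ : G' ⟶ K'} (h' : IsFibCell p' p'' ψ φ) :
    IsFibCell p p'' (F.whiskerLeft ψ) (H.whiskerLeft φ) := fun e => by
  have := h' (H.obj e)
  rw [h.obj_eq e] at this
  exact this

theorem whiskerRight {F G : B ⥤ B'} {F' G' : E ⥤ E'} {ψ : F ⟶ G} {φ : F' ⟶ G'}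
    (h : IsFibCell p p' ψ φ) {K : B' ⥤ B''} {K' : E' ⥤ E''} (h' : IsFibMor p' p'' K K') :
    IsFibCell p p'' (Functor.whiskerRight ψ K) (Functor.whiskerRight φ K') :=
  fun e => h'.isHomLift (h e)

end IsFibCell

/-- The natural transformation `ψ² : F² ⟶ G²` between functors on arrow categories. -/
def mapArrowNat {C D : Type*} [Category* C] [Category* D] {F G : C ⥤ D} (ψ : F ⟶ G) :
    F.mapArrow ⟶ G.mapArrow :=
  (Functor.mapArrowFunctor C D).map ψ

theorem isHomLift_mapArrow {C D : Type*} [Category* C] [Category* D] (F : C ⥤ D) {R : C}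
    {x y : Arrow C} {f : x ⟶ y} (h : Arrow.rightFunc.IsHomLift (𝟙 R) f) :
    Arrow.rightFunc.IsHomLift (𝟙 (F.obj R)) (F.mapArrow.map f) := by
  have h0 : x.right = R := IsHomLift.domain_eq Arrow.rightFunc (𝟙 R) f
  have h1 : y.right = R := IsHomLift.codomain_eq Arrow.rightFunc (𝟙 R) f
  have h2 : f.right = eqToHom h0 ≫ 𝟙 R ≫ eqToHom h1.symm := IsHomLift.fac' Arrow.rightFunc (𝟙 R) f
  refine IsHomLift.of_fac' _ _ _ (congrArg F.obj h0) (congrArg F.obj h1) ?_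
  change F.map f.right = _
  rw [h2, Category.id_comp, eqToHom_trans, eqToHom_map, Category.id_comp]
  exact (eqToHom_trans (congrArg F.obj h0) (congrArg F.obj h1).symm).symm

/-- A comprehension category: a fibration `p` with a functor `χ` to the arrow category of the base
that lies over `p` along the codomain functor and maps cartesian arrows to pullback squares. -/
structure CompCat : Type (max (u + 1) (v + 1)) where
  /-- the base category -/
  Base : Type u
  [catBase : Category.{v} Base]
  /-- the total category -/
  Total : Type u
  [catTotal : Category.{v} Total]
  /-- the fibration -/
  p : Total ⥤ Base
  fibered : p.IsFibered
  /-- the comprehension functor, into the category of arrows of the base -/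
  χ : Total ⥤ Arrow Base
  χ_cod : χ ⋙ Arrow.rightFunc = p
  χ_cart : ∀ {x y : Total} (f : x ⟶ y), IsCart p f →
    IsPullback (χ.map f).left (χ.obj x).hom (χ.obj y).hom (χ.map f).right

namespace CompCat

attribute [instance] catBase catTotal

theorem cod_obj (X : CompCat.{v, u}) (e : X.Total) : (X.χ.obj e).right = X.p.obj e :=
  Functor.congr_obj X.χ_cod e

/-- A lax morphism of comprehension categories `(B, H, ζ)`, where `ζ : B² χ ⟶ χ' H`. -/
structure Hom (X Y : CompCat.{v, u}) where
  base : X.Base ⥤ Y.Base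
  total : X.Total ⥤ Y.Total
  isFibMor : IsFibMor X.p Y.p base total
  ζ : X.χ ⋙ base.mapArrow ⟶ total ⋙ Y.χ
  /-- the codomain part of `ζ` is the identity -/
  cod_ζ : ∀ e : X.Total,
    Arrow.rightFunc.IsHomLift (𝟙 (base.obj (X.p.obj e))) (ζ.app e)

theorem Hom.ext' {X Y : CompCat.{v, u}} {f g : Hom X Y} (h : f.base = g.base)
    (h' : f.total = g.total) (h'' : HEq f.ζ g.ζ) : f = g := by
  cases f; cases g; cases h; cases h'; cases h''; rfl

/-- A 2-cell `(ψ, φ)` between lax morphisms of comprehension categories. -/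
structure Hom₂ {X Y : CompCat.{v, u}} (f g : Hom X Y) where
  base : f.base ⟶ g.base
  total : f.total ⟶ g.total
  isFibCell : IsFibCell X.p Y.p base total
  comm : f.ζ ≫ Functor.whiskerRight total Y.χ = X.χ.whiskerLeft (mapArrowNat base) ≫ g.ζ

theorem Hom₂.ext' {X Y : CompCat.{v, u}} {f g : Hom X Y} {η θ : Hom₂ f g}
    (h : η.base = θ.base) (h' : η.total = θ.total) : η = θ := by
  cases η; cases θ; cases h; cases h'; rfl

/-- The domain part of a component of `ζ`. -/
def Hom.dom {X Y : CompCat.{v, u}} (f : Hom X Y) (e : X.Total) :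
    f.base.obj (X.χ.obj e).left ⟶ (Y.χ.obj (f.total.obj e)).left := (f.ζ.app e).left

/-- The codomain part of a component of `ζ`. -/
def Hom.cod {X Y : CompCat.{v, u}} (f : Hom X Y) (e : X.Total) :
    f.base.obj (X.χ.obj e).right ⟶ (Y.χ.obj (f.total.obj e)).right := (f.ζ.app e).right

theorem comm_iff {X Y : CompCat.{v, u}} {f g : Hom X Y} {base : f.base ⟶ g.base}
    {total : f.total ⟶ g.total} :
    f.ζ ≫ Functor.whiskerRight total Y.χ = X.χ.whiskerLeft (mapArrowNat base) ≫ g.ζ ↔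
    (∀ e, f.dom e ≫ (Y.χ.map (total.app e)).left = base.app (X.χ.obj e).left ≫ g.dom e) ∧
    (∀ e, f.cod e ≫ (Y.χ.map (total.app e)).right = base.app (X.χ.obj e).right ≫ g.cod e) :=
  ⟨fun h => ⟨fun e => congrArg CommaMorphism.left (NatTrans.congr_app h e),
    fun e => congrArg CommaMorphism.right (NatTrans.congr_app h e)⟩,
    fun h => NatTrans.ext (funext fun e => Arrow.hom_ext _ _ (h.1 e) (h.2 e))⟩

instance (X Y : CompCat.{v, u}) : Category (Hom X Y) where
  Hom := Hom₂
  id f := ⟨𝟙 _, 𝟙 _, .id f.isFibMor, comm_iff.2 ⟨by simp, by simp⟩⟩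
  comp {f g h} η θ := ⟨η.base ≫ θ.base, η.total ≫ θ.total, η.isFibCell.comp θ.isFibCell, by
    have h1 := comm_iff.1 η.comm
    have h2 := comm_iff.1 θ.comm
    refine comm_iff.2 ⟨fun e => ?_, fun e => ?_⟩
    · simp [reassoc_of% h1.1 e, h2.1 e]
    · simp [reassoc_of% h1.2 e, h2.2 e]⟩
  id_comp η := Hom₂.ext' (Category.id_comp _) (Category.id_comp _)
  comp_id η := Hom₂.ext' (Category.comp_id _) (Category.comp_id _)
  assoc η θ ι := Hom₂.ext' (Category.assoc _ _ _) (Category.assoc _ _ _)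

/-- The identity morphism. -/
def Hom.id (X : CompCat.{v, u}) : Hom X X where
  base := 𝟭 _
  total := 𝟭 _
  isFibMor := .id
  ζ :=
    { app := fun e => 𝟙 (X.χ.obj e)
      naturality := fun _ _ _ => (Category.comp_id _).trans (Category.id_comp _).symm }
  cod_ζ e := IsHomLift.id (X.cod_obj e)

/-- The composite `(B₂ B₁, H₂ H₁, (ζ₂ H₁) (B₂² ζ₁))`. -/
def Hom.comp {X Y Z : CompCat.{v, u}} (f : Hom X Y) (g : Hom Y Z) : Hom X Z where
  base := f.base ⋙ g.base
  total := f.total ⋙ g.total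
  isFibMor := f.isFibMor.comp g.isFibMor
  ζ :=
    { app := fun e => g.base.mapArrow.map (f.ζ.app e) ≫ g.ζ.app (f.total.obj e)
      naturality := fun e e' h => by
        have h1 := f.ζ.naturality h
        have h2 := g.ζ.naturality (f.total.map h)
        have h3 := congrArg g.base.mapArrow.map h1
        rw [Functor.map_comp, Functor.map_comp] at h3
        refine ((Category.assoc _ _ _).symm.trans (congrArg (· ≫ g.ζ.app (f.total.obj e')) h3)).trans
          ((Category.assoc _ _ _).trans ?_)
        exact (congrArg (g.base.mapArrow.map (f.ζ.app e) ≫ ·) h2).trans (Category.assoc _ _ _).symm }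
  cod_ζ e := by
    have h1 := f.cod_ζ e
    have h2 := g.cod_ζ (f.total.obj e)
    rw [f.isFibMor.obj_eq] at h2
    have h3 : Arrow.rightFunc.IsHomLift (𝟙 (g.base.obj (f.base.obj (X.p.obj e))))
        (g.base.mapArrow.map (f.ζ.app e)) :=
      isHomLift_mapArrow g.base h1
    exact @IsHomLift.comp_of_lift_id _ _ _ _ _ _ _ _ _ _ _ h3 h2

theorem Hom.comp_dom {X Y Z : CompCat.{v, u}} (f : Hom X Y) (g : Hom Y Z) (e : X.Total) :
    (f.comp g).dom e = g.base.map (f.dom e) ≫ g.dom (f.total.obj e) := rfl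

theorem Hom.comp_cod {X Y Z : CompCat.{v, u}} (f : Hom X Y) (g : Hom Y Z) (e : X.Total) :
    (f.comp g).cod e = g.base.map (f.cod e) ≫ g.cod (f.total.obj e) := rfl

/-- Left whiskering. -/
def Hom₂.whiskerLeft {X Y Z : CompCat.{v, u}} (f : Hom X Y) {g h : Hom Y Z} (η : g ⟶ h) :
    f.comp g ⟶ f.comp h where
  base := f.base.whiskerLeft η.base
  total := f.total.whiskerLeft η.total
  isFibCell := η.isFibCell.whiskerLeft f.isFibMor
  comm := by
    have h1 := comm_iff.1 η.comm
    refine (comm_iff (f := f.comp g) (g := f.comp h)).2 ⟨fun e => ?_, fun e => ?_⟩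
    · change (g.base.map (f.dom e) ≫ g.dom (f.total.obj e)) ≫
          (Z.χ.map (η.total.app (f.total.obj e))).left =
        η.base.app (f.base.obj (X.χ.obj e).left) ≫ h.base.map (f.dom e) ≫ h.dom (f.total.obj e)
      rw [Category.assoc, h1.1 (f.total.obj e), η.base.naturality_assoc]
    · change (g.base.map (f.cod e) ≫ g.cod (f.total.obj e)) ≫
          (Z.χ.map (η.total.app (f.total.obj e))).right =
        η.base.app (f.base.obj (X.χ.obj e).right) ≫ h.base.map (f.cod e) ≫ h.cod (f.total.obj e)
      rw [Category.assoc, h1.2 (f.total.obj e), η.base.naturality_assoc]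

/-- Right whiskering. -/
def Hom₂.whiskerRight {X Y Z : CompCat.{v, u}} {f g : Hom X Y} (η : f ⟶ g) (h : Hom Y Z) :
    f.comp h ⟶ g.comp h where
  base := Functor.whiskerRight η.base h.base
  total := Functor.whiskerRight η.total h.total
  isFibCell := η.isFibCell.whiskerRight h.isFibMor
  comm := by
    have h1 := comm_iff.1 η.comm
    refine (comm_iff (f := f.comp h) (g := g.comp h)).2 ⟨fun e => ?_, fun e => ?_⟩
    · have h2 : h.dom (f.total.obj e) ≫ (Z.χ.map (h.total.map (η.total.app e))).left =
          h.base.map (Y.χ.map (η.total.app e)).left ≫ h.dom (g.total.obj e) :=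
        (congrArg CommaMorphism.left (h.ζ.naturality (η.total.app e))).symm
      change (h.base.map (f.dom e) ≫ h.dom (f.total.obj e)) ≫
          (Z.χ.map (h.total.map (η.total.app e))).left =
        h.base.map (η.base.app (X.χ.obj e).left) ≫ h.base.map (g.dom e) ≫ h.dom (g.total.obj e)
      rw [Category.assoc, h2, ← Functor.map_comp_assoc, ← Functor.map_comp_assoc, h1.1 e]
    · have h2 : h.cod (f.total.obj e) ≫ (Z.χ.map (h.total.map (η.total.app e))).right =
          h.base.map (Y.χ.map (η.total.app e)).right ≫ h.cod (g.total.obj e) :=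
        (congrArg CommaMorphism.right (h.ζ.naturality (η.total.app e))).symm
      change (h.base.map (f.cod e) ≫ h.cod (f.total.obj e)) ≫
          (Z.χ.map (h.total.map (η.total.app e))).right =
        h.base.map (η.base.app (X.χ.obj e).right) ≫ h.base.map (g.cod e) ≫ h.cod (g.total.obj e)
      rw [Category.assoc, h2, ← Functor.map_comp_assoc, ← Functor.map_comp_assoc, h1.2 e]

theorem Hom.assoc_ζ {W X Y Z : CompCat.{v, u}} (f : Hom W X) (g : Hom X Y) (h : Hom Y Z) :
    ((f.comp g).comp h).ζ = (f.comp (g.comp h)).ζ := by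
  refine NatTrans.ext (funext fun e => Arrow.hom_ext _ _ ?_ ?_)
  · change ((f.comp g).comp h).dom e = (f.comp (g.comp h)).dom e
    simp only [Hom.comp_dom]
    exact (congrArg (· ≫ _) (h.base.map_comp _ _)).trans (Category.assoc _ _ _)
  · change ((f.comp g).comp h).cod e = (f.comp (g.comp h)).cod e
    simp only [Hom.comp_cod]
    exact (congrArg (· ≫ _) (h.base.map_comp _ _)).trans (Category.assoc _ _ _)

theorem Hom.id_comp_ζ {X Y : CompCat.{v, u}} (f : Hom X Y) : ((Hom.id X).comp f).ζ = f.ζ :=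
  NatTrans.ext (funext fun _ =>
    (congrArg (· ≫ _) (f.base.mapArrow.map_id _)).trans (Category.id_comp _))

theorem Hom.comp_id_ζ {X Y : CompCat.{v, u}} (f : Hom X Y) : (f.comp (Hom.id Y)).ζ = f.ζ :=
  NatTrans.ext (funext fun _ => Category.comp_id _)

theorem Hom.assoc' {W X Y Z : CompCat.{v, u}} (f : Hom W X) (g : Hom X Y) (h : Hom Y Z) :
    (f.comp g).comp h = f.comp (g.comp h) :=
  Hom.ext' rfl rfl (heq_of_eq (Hom.assoc_ζ f g h))

theorem Hom.id_comp' {X Y : CompCat.{v, u}} (f : Hom X Y) : (Hom.id X).comp f = f :=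
  Hom.ext' rfl rfl (heq_of_eq (Hom.id_comp_ζ f))

theorem Hom.comp_id' {X Y : CompCat.{v, u}} (f : Hom X Y) : f.comp (Hom.id Y) = f :=
  Hom.ext' rfl rfl (heq_of_eq (Hom.comp_id_ζ f))

/-- The invertible 2-cell with identity components between two morphisms with the same data. -/
def isoOfEq {X Y : CompCat.{v, u}} (f : Hom X Y) {h' : IsFibMor X.p Y.p f.base f.total}
    {ζ' : X.χ ⋙ f.base.mapArrow ⟶ f.total ⋙ Y.χ} {c'} (e : f.ζ = ζ') :
    f ≅ ⟨f.base, f.total, h', ζ', c'⟩ where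
  hom := ⟨𝟙 f.base, 𝟙 f.total, .id f.isFibMor, by subst e; exact Hom₂.comm (𝟙 f)⟩
  inv := ⟨𝟙 f.base, 𝟙 f.total, .id f.isFibMor, by subst e; exact Hom₂.comm (𝟙 f)⟩
  hom_inv_id := Hom₂.ext' (Category.id_comp _) (Category.id_comp _)
  inv_hom_id := Hom₂.ext' (Category.id_comp _) (Category.id_comp _)

theorem isoOfEq_eq {X Y : CompCat.{v, u}} (f : Hom X Y) {h' : IsFibMor X.p Y.p f.base f.total}
    {ζ' : X.χ ⋙ f.base.mapArrow ⟶ f.total ⋙ Y.χ} {c'} (e : f.ζ = ζ')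
    (e' : f = ⟨f.base, f.total, h', ζ', c'⟩) :
    isoOfEq f (h' := h') (c' := c') e = eqToIso e' := by
  subst e; rfl

/-- The associator. -/
def assocIso {W X Y Z : CompCat.{v, u}} (f : Hom W X) (g : Hom X Y) (h : Hom Y Z) :
    (f.comp g).comp h ≅ f.comp (g.comp h) :=
  isoOfEq ((f.comp g).comp h) (h' := (f.comp (g.comp h)).isFibMor)
    (c' := (f.comp (g.comp h)).cod_ζ) (Hom.assoc_ζ f g h)

/-- The left unitor. -/
def leftIso {X Y : CompCat.{v, u}} (f : Hom X Y) : (Hom.id X).comp f ≅ f :=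
  isoOfEq ((Hom.id X).comp f) (h' := f.isFibMor) (c' := f.cod_ζ) (Hom.id_comp_ζ f)

/-- The right unitor. -/
def rightIso {X Y : CompCat.{v, u}} (f : Hom X Y) : f.comp (Hom.id Y) ≅ f :=
  isoOfEq (f.comp (Hom.id Y)) (h' := f.isFibMor) (c' := f.cod_ζ) (Hom.comp_id_ζ f)

theorem comp_base {X Y : CompCat.{v, u}} {f g h : Hom X Y} (η : f ⟶ g) (θ : g ⟶ h) :
    (η ≫ θ).base = η.base ≫ θ.base := rfl

theorem comp_total {X Y : CompCat.{v, u}} {f g h : Hom X Y} (η : f ⟶ g) (θ : g ⟶ h) :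
    (η ≫ θ).total = η.total ≫ θ.total := rfl

instance : Bicategory CompCat.{v, u} where
  Hom := Hom
  id := Hom.id
  comp := Hom.comp
  whiskerLeft := Hom₂.whiskerLeft
  whiskerRight := Hom₂.whiskerRight
  associator f g h := assocIso f g h
  leftUnitor f := leftIso f
  rightUnitor f := rightIso f
  whiskerLeft_id _ _ := Hom₂.ext' (Functor.whiskerLeft_id' _) (Functor.whiskerLeft_id' _)
  whiskerLeft_comp _ _ _ _ _ _ := Hom₂.ext' (Functor.whiskerLeft_comp _ _ _) (Functor.whiskerLeft_comp _ _ _)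
  id_whiskerLeft _ := by
    apply Hom₂.ext' <;> (apply NatTrans.ext; funext e; exact ((Category.id_comp _).trans (Category.comp_id _)).symm)
  comp_whiskerLeft _ _ _ _ _ := by
    apply Hom₂.ext' <;> (apply NatTrans.ext; funext e; exact ((Category.id_comp _).trans (Category.comp_id _)).symm)
  id_whiskerRight _ _ := Hom₂.ext' (Functor.whiskerRight_id' _) (Functor.whiskerRight_id' _)
  comp_whiskerRight _ _ _ := Hom₂.ext' (Functor.whiskerRight_comp _ _ _) (Functor.whiskerRight_comp _ _ _)
  whiskerRight_id _ := by
    apply Hom₂.ext' <;> (apply NatTrans.ext; funext e; exact ((Category.id_comp _).trans (Category.comp_id _)).symm)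
  whiskerRight_comp _ _ _ := by
    apply Hom₂.ext' <;> (apply NatTrans.ext; funext e; exact ((Category.id_comp _).trans (Category.comp_id _)).symm)
  whisker_assoc _ _ _ _ _ := by
    apply Hom₂.ext' <;> (apply NatTrans.ext; funext e; exact ((Category.id_comp _).trans (Category.comp_id _)).symm)
  whisker_exchange η θ := by
    apply Hom₂.ext'
    · exact NatTrans.ext (funext fun e => (θ.base.naturality (η.base.app e)).symm)
    · exact NatTrans.ext (funext fun e => (θ.total.naturality (η.total.app e)).symm)
  pentagon f g h i := by
    apply Hom₂.ext' <;> (apply NatTrans.ext; funext e)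
    · change i.base.map (𝟙 _) ≫ 𝟙 _ ≫ 𝟙 _ = 𝟙 _ ≫ 𝟙 _
      simp
    · change i.total.map (𝟙 _) ≫ 𝟙 _ ≫ 𝟙 _ = 𝟙 _ ≫ 𝟙 _
      simp
  triangle f g := by
    apply Hom₂.ext' <;> (apply NatTrans.ext; funext e)
    · change 𝟙 _ ≫ 𝟙 _ = g.base.map (𝟙 _)
      simp
    · change 𝟙 _ ≫ 𝟙 _ = g.total.map (𝟙 _)
      simp

instance : Bicategory.Strict CompCat.{v, u} where
  id_comp := Hom.id_comp'
  comp_id := Hom.comp_id'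
  assoc := Hom.assoc'
  leftUnitor_eqToIso f := isoOfEq_eq _ (Hom.id_comp_ζ f) (Hom.id_comp' f)
  rightUnitor_eqToIso f := isoOfEq_eq _ (Hom.comp_id_ζ f) (Hom.comp_id' f)
  associator_eqToIso f g h := isoOfEq_eq _ (Hom.assoc_ζ f g h) (Hom.assoc' f g h)

end CompCat

/-- A generalised category with families: two fibrations `u`, `du` over the same base and an
adjunction `Σ ⊣ Δ` between their total categories, where `Σ` is a morphism of fibrations over the
base and the components of unit and counit are cartesian. -/
structure GCwF : Type (max (u + 1) (v + 1)) where
  /-- the base category -/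
  Base : Type u
  [catBase : Category.{v} Base]
  /-- the category of types -/
  Ty : Type u
  [catTy : Category.{v} Ty]
  /-- the category of terms -/
  Tm : Type u
  [catTm : Category.{v} Tm]
  /-- the fibration of types -/
  u : Ty ⥤ Base
  /-- the fibration of terms -/
  du : Tm ⥤ Base
  fibered_u : u.IsFibered
  fibered_du : du.IsFibered
  /-- the functor `Σ`, a morphism of fibrations over the base -/
  Sig : Tm ⥤ Ty
  Sig_fib : IsFibMor du u (𝟭 Base) Sig
  /-- the right adjoint `Δ` of `Σ` -/
  Del : Ty ⥤ Tm
  adj : Sig ⊣ Del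
  unit_cart : ∀ a : Tm, IsCart du (adj.unit.app a)
  counit_cart : ∀ A : Ty, IsCart u (adj.counit.app A)

namespace GCwF

attribute [instance] catBase catTy catTm

/-- A loose morphism `(C, H, H', ζ)` of generalised categories with families: it commutes with the
left adjoints up to a vertical natural isomorphism `ζ : Σ' H' ≅ H Σ`. -/
structure Hom (X Y : GCwF.{v, u}) where
  base : X.Base ⥤ Y.Base
  ty : X.Ty ⥤ Y.Ty
  tm : X.Tm ⥤ Y.Tm
  ty_fib : IsFibMor X.u Y.u base ty
  tm_fib : IsFibMor X.du Y.du base tm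
  ζ : tm ⋙ Y.Sig ≅ X.Sig ⋙ ty
  /-- the components of `ζ` are vertical -/
  ζ_vert : ∀ a : X.Tm, Y.u.IsHomLift (𝟙 (base.obj (X.du.obj a))) (ζ.hom.app a)

theorem Hom.ext' {X Y : GCwF.{v, u}} {f g : Hom X Y} (h : f.base = g.base)
    (h' : f.ty = g.ty) (h'' : f.tm = g.tm) (h''' : HEq f.ζ g.ζ) : f = g := by
  cases f; cases g; cases h; cases h'; cases h''; cases h'''; rfl

/-- A 2-cell `(ψ, φ, φ')` between loose morphisms. -/
structure Hom₂ {X Y : GCwF.{v, u}} (f g : Hom X Y) where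
  base : f.base ⟶ g.base
  ty : f.ty ⟶ g.ty
  tm : f.tm ⟶ g.tm
  ty_fib : IsFibCell X.u Y.u base ty
  tm_fib : IsFibCell X.du Y.du base tm
  comm : Functor.whiskerRight tm Y.Sig ≫ g.ζ.hom = f.ζ.hom ≫ X.Sig.whiskerLeft ty

theorem Hom₂.ext' {X Y : GCwF.{v, u}} {f g : Hom X Y} {η θ : Hom₂ f g}
    (h : η.base = θ.base) (h' : η.ty = θ.ty) (h'' : η.tm = θ.tm) : η = θ := by
  cases η; cases θ; cases h; cases h'; cases h''; rfl

/-- The component of `ζ` at `a`. -/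
def Hom.z {X Y : GCwF.{v, u}} (f : Hom X Y) (a : X.Tm) :
    Y.Sig.obj (f.tm.obj a) ⟶ f.ty.obj (X.Sig.obj a) := f.ζ.hom.app a

theorem Hom.z_nat {X Y : GCwF.{v, u}} (f : Hom X Y) {a b : X.Tm} (h : a ⟶ b) :
    Y.Sig.map (f.tm.map h) ≫ f.z b = f.z a ≫ f.ty.map (X.Sig.map h) := f.ζ.hom.naturality h

theorem comm_iff {X Y : GCwF.{v, u}} {f g : Hom X Y} {ty : f.ty ⟶ g.ty} {tm : f.tm ⟶ g.tm} :
    Functor.whiskerRight tm Y.Sig ≫ g.ζ.hom = f.ζ.hom ≫ X.Sig.whiskerLeft ty ↔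
    ∀ a, Y.Sig.map (tm.app a) ≫ g.z a = f.z a ≫ ty.app (X.Sig.obj a) :=
  ⟨fun h a => NatTrans.congr_app h a, fun h => NatTrans.ext (funext h)⟩

instance (X Y : GCwF.{v, u}) : Category (Hom X Y) where
  Hom := Hom₂
  id f := ⟨𝟙 _, 𝟙 _, 𝟙 _, .id f.ty_fib, .id f.tm_fib, comm_iff.2 (by simp)⟩
  comp {f g h} η θ := ⟨η.base ≫ θ.base, η.ty ≫ θ.ty, η.tm ≫ θ.tm, η.ty_fib.comp θ.ty_fib,
    η.tm_fib.comp θ.tm_fib, comm_iff.2 fun a => by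
      have h1 := comm_iff.1 η.comm a
      have h2 := comm_iff.1 θ.comm a
      rw [NatTrans.comp_app, NatTrans.comp_app, Functor.map_comp, Category.assoc, h2,
        ← Category.assoc, h1, Category.assoc]⟩
  id_comp _ := Hom₂.ext' (Category.id_comp _) (Category.id_comp _) (Category.id_comp _)
  comp_id _ := Hom₂.ext' (Category.comp_id _) (Category.comp_id _) (Category.comp_id _)
  assoc _ _ _ := Hom₂.ext' (Category.assoc _ _ _) (Category.assoc _ _ _) (Category.assoc _ _ _)

/-- The identity morphism. -/
def Hom.id (X : GCwF.{v, u}) : Hom X X where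
  base := 𝟭 _
  ty := 𝟭 _
  tm := 𝟭 _
  ty_fib := .id
  tm_fib := .id
  ζ := Iso.refl X.Sig
  ζ_vert a := IsHomLift.id (X.Sig_fib.obj_eq a)

/-- The composite `(C₂ C₁, H₂ H₁, H₂' H₁', ζ)`, with `ζ` first `ζ₂ H₁'` and then `H₂ ζ₁`. -/
def Hom.comp {X Y Z : GCwF.{v, u}} (f : Hom X Y) (g : Hom Y Z) : Hom X Z where
  base := f.base ⋙ g.base
  ty := f.ty ⋙ g.ty
  tm := f.tm ⋙ g.tm
  ty_fib := f.ty_fib.comp g.ty_fib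
  tm_fib := f.tm_fib.comp g.tm_fib
  ζ := Functor.isoWhiskerLeft f.tm g.ζ ≪≫ Functor.isoWhiskerRight f.ζ g.ty
  ζ_vert a := by
    have h1 := g.ty_fib.isHomLift (f.ζ_vert a)
    have h2 := g.ζ_vert (f.tm.obj a)
    rw [f.tm_fib.obj_eq] at h2
    rw [CategoryTheory.Functor.map_id] at h1
    exact @IsHomLift.comp_of_lift_id _ _ _ _ _ _ _ _ _ _ _ h2 h1

theorem Hom.comp_z {X Y Z : GCwF.{v, u}} (f : Hom X Y) (g : Hom Y Z) (a : X.Tm) :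
    (f.comp g).z a = g.z (f.tm.obj a) ≫ g.ty.map (f.z a) := rfl

/-- Left whiskering. -/
def Hom₂.whiskerLeft {X Y Z : GCwF.{v, u}} (f : Hom X Y) {g h : Hom Y Z} (η : g ⟶ h) :
    f.comp g ⟶ f.comp h where
  base := f.base.whiskerLeft η.base
  ty := f.ty.whiskerLeft η.ty
  tm := f.tm.whiskerLeft η.tm
  ty_fib := η.ty_fib.whiskerLeft f.ty_fib
  tm_fib := η.tm_fib.whiskerLeft f.tm_fib
  comm := (comm_iff (f := f.comp g) (g := f.comp h)).2 fun a => by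
    have h1 := comm_iff.1 η.comm (f.tm.obj a)
    change Z.Sig.map (η.tm.app (f.tm.obj a)) ≫ h.z (f.tm.obj a) ≫ h.ty.map (f.z a) =
      (g.z (f.tm.obj a) ≫ g.ty.map (f.z a)) ≫ η.ty.app (f.ty.obj (X.Sig.obj a))
    rw [← Category.assoc, h1, Category.assoc, Category.assoc, η.ty.naturality]

/-- Right whiskering. -/
def Hom₂.whiskerRight {X Y Z : GCwF.{v, u}} {f g : Hom X Y} (η : f ⟶ g) (h : Hom Y Z) :
    f.comp h ⟶ g.comp h where
  base := Functor.whiskerRight η.base h.base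
  ty := Functor.whiskerRight η.ty h.ty
  tm := Functor.whiskerRight η.tm h.tm
  ty_fib := η.ty_fib.whiskerRight h.ty_fib
  tm_fib := η.tm_fib.whiskerRight h.tm_fib
  comm := (comm_iff (f := f.comp h) (g := g.comp h)).2 fun a => by
    have h1 := comm_iff.1 η.comm a
    change Z.Sig.map (h.tm.map (η.tm.app a)) ≫ h.z (g.tm.obj a) ≫ h.ty.map (g.z a) =
      (h.z (f.tm.obj a) ≫ h.ty.map (f.z a)) ≫ h.ty.map (η.ty.app (X.Sig.obj a))
    rw [← Category.assoc, h.z_nat, Category.assoc, Category.assoc, ← Functor.map_comp,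
      ← Functor.map_comp, h1]

theorem Hom.assoc_ζ {W X Y Z : GCwF.{v, u}} (f : Hom W X) (g : Hom X Y) (h : Hom Y Z) :
    ((f.comp g).comp h).ζ = (f.comp (g.comp h)).ζ := by
  refine Iso.ext (NatTrans.ext (funext fun a => ?_))
  change h.z (g.tm.obj (f.tm.obj a)) ≫ h.ty.map (g.z (f.tm.obj a) ≫ g.ty.map (f.z a)) =
    (h.z (g.tm.obj (f.tm.obj a)) ≫ h.ty.map (g.z (f.tm.obj a))) ≫ h.ty.map (g.ty.map (f.z a))
  rw [Functor.map_comp, Category.assoc]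

theorem Hom.id_comp_ζ {X Y : GCwF.{v, u}} (f : Hom X Y) : ((Hom.id X).comp f).ζ = f.ζ :=
  Iso.ext (NatTrans.ext (funext fun _ =>
    (congrArg (_ ≫ ·) (f.ty.map_id _)).trans (Category.comp_id _)))

theorem Hom.comp_id_ζ {X Y : GCwF.{v, u}} (f : Hom X Y) : (f.comp (Hom.id Y)).ζ = f.ζ :=
  Iso.ext (NatTrans.ext (funext fun _ => Category.id_comp _))

theorem Hom.assoc' {W X Y Z : GCwF.{v, u}} (f : Hom W X) (g : Hom X Y) (h : Hom Y Z) :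
    (f.comp g).comp h = f.comp (g.comp h) :=
  Hom.ext' rfl rfl rfl (heq_of_eq (Hom.assoc_ζ f g h))

theorem Hom.id_comp' {X Y : GCwF.{v, u}} (f : Hom X Y) : (Hom.id X).comp f = f :=
  Hom.ext' rfl rfl rfl (heq_of_eq (Hom.id_comp_ζ f))

theorem Hom.comp_id' {X Y : GCwF.{v, u}} (f : Hom X Y) : f.comp (Hom.id Y) = f :=
  Hom.ext' rfl rfl rfl (heq_of_eq (Hom.comp_id_ζ f))

/-- The invertible 2-cell with identity components between two morphisms with the same data. -/
def isoOfEq {X Y : GCwF.{v, u}} (f : Hom X Y) {h : IsFibMor X.u Y.u f.base f.ty}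
    {h' : IsFibMor X.du Y.du f.base f.tm} {ζ' : f.tm ⋙ Y.Sig ≅ X.Sig ⋙ f.ty} {c'}
    (e : f.ζ = ζ') : f ≅ ⟨f.base, f.ty, f.tm, h, h', ζ', c'⟩ where
  hom := ⟨𝟙 f.base, 𝟙 f.ty, 𝟙 f.tm, .id f.ty_fib, .id f.tm_fib, by
    subst e; exact Hom₂.comm (𝟙 f)⟩
  inv := ⟨𝟙 f.base, 𝟙 f.ty, 𝟙 f.tm, .id f.ty_fib, .id f.tm_fib, by
    subst e; exact Hom₂.comm (𝟙 f)⟩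
  hom_inv_id := Hom₂.ext' (Category.id_comp _) (Category.id_comp _) (Category.id_comp _)
  inv_hom_id := Hom₂.ext' (Category.id_comp _) (Category.id_comp _) (Category.id_comp _)

theorem isoOfEq_eq {X Y : GCwF.{v, u}} (f : Hom X Y) {h : IsFibMor X.u Y.u f.base f.ty}
    {h' : IsFibMor X.du Y.du f.base f.tm} {ζ' : f.tm ⋙ Y.Sig ≅ X.Sig ⋙ f.ty} {c'}
    (e : f.ζ = ζ') (e' : f = ⟨f.base, f.ty, f.tm, h, h', ζ', c'⟩) :
    isoOfEq f (h := h) (h' := h') (c' := c') e = eqToIso e' := by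
  subst e; rfl

/-- The associator. -/
def assocIso {W X Y Z : GCwF.{v, u}} (f : Hom W X) (g : Hom X Y) (h : Hom Y Z) :
    (f.comp g).comp h ≅ f.comp (g.comp h) :=
  isoOfEq ((f.comp g).comp h) (h := (f.comp (g.comp h)).ty_fib)
    (h' := (f.comp (g.comp h)).tm_fib) (c' := (f.comp (g.comp h)).ζ_vert) (Hom.assoc_ζ f g h)

/-- The left unitor. -/
def leftIso {X Y : GCwF.{v, u}} (f : Hom X Y) : (Hom.id X).comp f ≅ f :=
  isoOfEq ((Hom.id X).comp f) (h := f.ty_fib) (h' := f.tm_fib) (c' := f.ζ_vert) (Hom.id_comp_ζ f)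

/-- The right unitor. -/
def rightIso {X Y : GCwF.{v, u}} (f : Hom X Y) : f.comp (Hom.id Y) ≅ f :=
  isoOfEq (f.comp (Hom.id Y)) (h := f.ty_fib) (h' := f.tm_fib) (c' := f.ζ_vert) (Hom.comp_id_ζ f)

instance : Bicategory GCwF.{v, u} where
  Hom := Hom
  id := Hom.id
  comp := Hom.comp
  whiskerLeft := Hom₂.whiskerLeft
  whiskerRight := Hom₂.whiskerRight
  associator f g h := assocIso f g h
  leftUnitor f := leftIso f
  rightUnitor f := rightIso f
  whiskerLeft_id _ _ := Hom₂.ext' (Functor.whiskerLeft_id' _) (Functor.whiskerLeft_id' _)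
    (Functor.whiskerLeft_id' _)
  whiskerLeft_comp _ _ _ _ _ _ := Hom₂.ext' (Functor.whiskerLeft_comp _ _ _)
    (Functor.whiskerLeft_comp _ _ _) (Functor.whiskerLeft_comp _ _ _)
  id_whiskerLeft _ := by
    apply Hom₂.ext' <;> exact NatTrans.ext (funext fun _ =>
      ((Category.id_comp _).trans (Category.comp_id _)).symm)
  comp_whiskerLeft _ _ _ _ _ := by
    apply Hom₂.ext' <;> exact NatTrans.ext (funext fun _ =>
      ((Category.id_comp _).trans (Category.comp_id _)).symm)
  id_whiskerRight _ _ := Hom₂.ext' (Functor.whiskerRight_id' _) (Functor.whiskerRight_id' _)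
    (Functor.whiskerRight_id' _)
  comp_whiskerRight _ _ _ := Hom₂.ext' (Functor.whiskerRight_comp _ _ _)
    (Functor.whiskerRight_comp _ _ _) (Functor.whiskerRight_comp _ _ _)
  whiskerRight_id _ := by
    apply Hom₂.ext' <;> exact NatTrans.ext (funext fun _ =>
      ((Category.id_comp _).trans (Category.comp_id _)).symm)
  whiskerRight_comp _ _ _ := by
    apply Hom₂.ext' <;> exact NatTrans.ext (funext fun _ =>
      ((Category.id_comp _).trans (Category.comp_id _)).symm)
  whisker_assoc _ _ _ _ _ := by
    apply Hom₂.ext' <;> exact NatTrans.ext (funext fun _ =>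
      ((Category.id_comp _).trans (Category.comp_id _)).symm)
  whisker_exchange η θ := by
    apply Hom₂.ext'
    · exact NatTrans.ext (funext fun e => (θ.base.naturality (η.base.app e)).symm)
    · exact NatTrans.ext (funext fun e => (θ.ty.naturality (η.ty.app e)).symm)
    · exact NatTrans.ext (funext fun e => (θ.tm.naturality (η.tm.app e)).symm)
  pentagon f g h i := by
    apply Hom₂.ext' <;> (apply NatTrans.ext; funext e)
    · change i.base.map (𝟙 _) ≫ 𝟙 _ ≫ 𝟙 _ = 𝟙 _ ≫ 𝟙 _
      simp
    · change i.ty.map (𝟙 _) ≫ 𝟙 _ ≫ 𝟙 _ = 𝟙 _ ≫ 𝟙 _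
      simp
    · change i.tm.map (𝟙 _) ≫ 𝟙 _ ≫ 𝟙 _ = 𝟙 _ ≫ 𝟙 _
      simp
  triangle f g := by
    apply Hom₂.ext' <;> (apply NatTrans.ext; funext e)
    · change 𝟙 _ ≫ 𝟙 _ = g.base.map (𝟙 _)
      simp
    · change 𝟙 _ ≫ 𝟙 _ = g.ty.map (𝟙 _)
      simp
    · change 𝟙 _ ≫ 𝟙 _ = g.tm.map (𝟙 _)
      simp

instance : Bicategory.Strict GCwF.{v, u} where
  id_comp := Hom.id_comp'
  comp_id := Hom.comp_id'
  assoc := Hom.assoc'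
  leftUnitor_eqToIso f := isoOfEq_eq _ (Hom.id_comp_ζ f) (Hom.id_comp' f)
  rightUnitor_eqToIso f := isoOfEq_eq _ (Hom.comp_id_ζ f) (Hom.comp_id' f)
  associator_eqToIso f g h := isoOfEq_eq _ (Hom.assoc_ζ f g h) (Hom.assoc' f g h)

end GCwF

section Biequivalence

open Bicategory

universe w₁ w₂ v₁ v₂ u₁ u₂

/-- A 1-cell in a bicategory is an equivalence. -/
def IsEquivCell {A : Type u₁} [Bicategory.{w₁, v₁} A] {a b : A} (f : a ⟶ b) : Prop :=
  ∃ g : b ⟶ a, Nonempty (𝟙 a ≅ f ≫ g) ∧ Nonempty (g ≫ f ≅ 𝟙 b)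

/-- An adjoint biequivalence between 2-categories, given by 2-functors `left ⊣ right`:
the unit and the counit are pseudonatural transformations whose components are equivalences,
the triangle identities hold up to invertible modifications `leftTri` and `rightTri`,
and these satisfy the two swallowtail equations. -/
structure AdjointBiequivalence (A : Type u₁) [Bicategory.{w₁, v₁} A] (B : Type u₂)
    [Bicategory.{w₂, v₂} B] where
  left : StrictPseudofunctor A B
  right : StrictPseudofunctor B A
  unit : Pseudofunctor.StrongTrans (Pseudofunctor.id A)
    (left.toPseudofunctor.comp right.toPseudofunctor)
  counit : Pseudofunctor.StrongTrans (right.toPseudofunctor.comp left.toPseudofunctor)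
    (Pseudofunctor.id B)
  unit_equiv : ∀ a : A, IsEquivCell (unit.app a)
  counit_equiv : ∀ b : B, IsEquivCell (counit.app b)
  leftTri : ∀ a : A, left.map (unit.app a) ≫ counit.app (left.obj a) ≅ 𝟙 (left.obj a)
  rightTri : ∀ b : B, unit.app (right.obj b) ≫ right.map (counit.app b) ≅ 𝟙 (right.obj b)
  /-- the 2-cells `leftTri` form a modification -/
  leftTri_naturality : ∀ {a a' : A} (f : a ⟶ a'),
    left.map f ◁ (leftTri a').hom ≫ (ρ_ (left.map f)).hom ≫ (λ_ (left.map f)).inv =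
      (α_ (left.map f) (left.map (unit.app a')) (counit.app (left.obj a'))).inv ≫
      ((left.mapComp f (unit.app a')).inv ≫ left.map₂ (unit.naturality f).hom ≫
        (left.mapComp (unit.app a) (right.map (left.map f))).hom) ▷
          counit.app (left.obj a') ≫
      (α_ (left.map (unit.app a)) (left.map (right.map (left.map f)))
        (counit.app (left.obj a'))).hom ≫
      left.map (unit.app a) ◁ (counit.naturality (left.map f)).hom ≫
      (α_ (left.map (unit.app a)) (counit.app (left.obj a)) (left.map f)).inv ≫
      (leftTri a).hom ▷ left.map f
  /-- the 2-cells `rightTri` form a modification -/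
  rightTri_naturality : ∀ {b b' : B} (g : b ⟶ b'),
    right.map g ◁ (rightTri b').hom ≫ (ρ_ (right.map g)).hom ≫ (λ_ (right.map g)).inv =
      (α_ (right.map g) (unit.app (right.obj b')) (right.map (counit.app b'))).inv ≫
      (unit.naturality (right.map g)).hom ▷ right.map (counit.app b') ≫
      (α_ (unit.app (right.obj b)) (right.map (left.map (right.map g)))
        (right.map (counit.app b'))).hom ≫
      unit.app (right.obj b) ◁ ((right.mapComp (left.map (right.map g)) (counit.app b')).inv ≫
        right.map₂ (counit.naturality g).hom ≫ (right.mapComp (counit.app b) g).hom) ≫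
      (α_ (unit.app (right.obj b)) (right.map (counit.app b)) (right.map g)).inv ≫
      (rightTri b).hom ▷ right.map g
  unit_swallowtail : ∀ a : A,
    unit.app a ◁ (rightTri (left.obj a)).hom =
      (α_ (unit.app a) (unit.app (right.obj (left.obj a)))
        (right.map (counit.app (left.obj a)))).inv ≫
      (unit.naturality (unit.app a)).hom ▷ right.map (counit.app (left.obj a)) ≫
      (α_ (unit.app a) (right.map (left.map (unit.app a)))
        (right.map (counit.app (left.obj a)))).hom ≫
      unit.app a ◁ ((right.mapComp (left.map (unit.app a)) (counit.app (left.obj a))).inv ≫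
        right.map₂ (leftTri a).hom ≫ (right.mapId (left.obj a)).hom)
  counit_swallowtail : ∀ b : B,
    (leftTri (right.obj b)).hom ▷ counit.app b =
      (α_ (left.map (unit.app (right.obj b))) (counit.app (left.obj (right.obj b)))
        (counit.app b)).hom ≫
      left.map (unit.app (right.obj b)) ◁ (counit.naturality (counit.app b)).inv ≫
      (α_ (left.map (unit.app (right.obj b))) (left.map (right.map (counit.app b)))
        (counit.app b)).inv ≫
      ((left.mapComp (unit.app (right.obj b)) (right.map (counit.app b))).inv ≫
        left.map₂ (rightTri b).hom ≫ (left.mapId (right.obj b)).hom) ▷ counit.app b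

/-- A class of 1-cells containing the identities and closed under composition. -/
structure OneCellClass (A : Type u₁) [Bicategory.{w₁, v₁} A] where
  Mem : ∀ {a b : A}, (a ⟶ b) → Prop
  id_mem : ∀ a : A, Mem (𝟙 a)
  comp_mem : ∀ {a b c : A} {f : a ⟶ b} {g : b ⟶ c}, Mem f → Mem g → Mem (f ≫ g)

/-- The wide 2-full (that is, full on 2-cells) sub-2-category on a class of 1-cells. -/
structure Wide {A : Type u₁} [Bicategory.{w₁, v₁} A] (W : OneCellClass A) where
  obj : A

namespace Wide

variable {A : Type u₁} [Bicategory.{w₁, v₁} A] {W : OneCellClass A}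

/-- The 1-cells of the sub-2-category. -/
@[ext]
structure Hom (x y : Wide W) where
  hom : x.obj ⟶ y.obj
  mem : W.Mem hom

instance (x y : Wide W) : Category (Hom x y) where
  Hom f g := f.hom ⟶ g.hom
  id f := 𝟙 f.hom
  comp η θ := η ≫ θ
  id_comp η := Category.id_comp (X := (_ : x.obj ⟶ y.obj)) η
  comp_id η := Category.comp_id (X := (_ : x.obj ⟶ y.obj)) η
  assoc η θ ι := Category.assoc (W := (_ : x.obj ⟶ y.obj)) η θ ι

/-- An invertible 2-cell, viewed in the sub-2-category. -/
def mkIso {x y : Wide W} {f g : Hom x y} (e : f.hom ≅ g.hom) : f ≅ g :=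
  ⟨e.hom, e.inv, e.hom_inv_id, e.inv_hom_id⟩

instance : Bicategory (Wide W) where
  Hom := Hom
  id x := ⟨𝟙 x.obj, W.id_mem _⟩
  comp f g := ⟨f.hom ≫ g.hom, W.comp_mem f.mem g.mem⟩
  whiskerLeft f _ _ η := Bicategory.whiskerLeft f.hom η
  whiskerRight η h := Bicategory.whiskerRight η h.hom
  associator f g h := mkIso (α_ f.hom g.hom h.hom)
  leftUnitor f := mkIso (λ_ f.hom)
  rightUnitor f := mkIso (ρ_ f.hom)
  whiskerLeft_id f g := Bicategory.whiskerLeft_id f.hom g.hom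
  whiskerLeft_comp f _ _ _ η θ := Bicategory.whiskerLeft_comp f.hom η θ
  id_whiskerLeft η := Bicategory.id_whiskerLeft η
  comp_whiskerLeft f g _ _ η := Bicategory.comp_whiskerLeft f.hom g.hom η
  id_whiskerRight f g := Bicategory.id_whiskerRight f.hom g.hom
  comp_whiskerRight η θ i := Bicategory.comp_whiskerRight η θ i.hom
  whiskerRight_id η := Bicategory.whiskerRight_id η
  whiskerRight_comp η g h := Bicategory.whiskerRight_comp η g.hom h.hom
  whisker_assoc f _ _ η h := Bicategory.whisker_assoc f.hom η h.hom
  whisker_exchange η θ := Bicategory.whisker_exchange η θ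
  pentagon f g h i := Bicategory.pentagon f.hom g.hom h.hom i.hom
  triangle f g := Bicategory.triangle f.hom g.hom

theorem mkIso_eqToIso {x y : Wide W} {f g : Hom x y} (h : f.hom = g.hom) :
    mkIso (eqToIso h) = eqToIso (Hom.ext h) := by
  cases f; cases g; cases h; rfl

end Wide

variable {A : Type u₁} [Bicategory.{w₁, v₁} A] {B : Type u₂} [Bicategory.{w₂, v₂} B]

/-- A 2-functor that maps the 1-cells of a class `W` into a class `W'` restricts to the
sub-2-categories. -/
def restrictFunctor (W : OneCellClass A) (W' : OneCellClass B) (F : StrictPseudofunctor A B)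
    (h : ∀ {a b : A} (f : a ⟶ b), W.Mem f → W'.Mem (F.map f)) :
    StrictPseudofunctor (Wide W) (Wide W') where
  obj x := ⟨F.obj x.obj⟩
  map f := ⟨F.map f.hom, h f.hom f.mem⟩
  map₂ η := F.map₂ η
  map₂_id f := F.map₂_id f.hom
  map₂_comp η θ := F.map₂_comp η θ
  mapId x := Wide.mkIso (F.mapId x.obj)
  mapComp f g := Wide.mkIso (F.mapComp f.hom g.hom)
  map₂_whisker_left f _ _ η := F.map₂_whisker_left f.hom η
  map₂_whisker_right η h := F.map₂_whisker_right η h.hom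
  map₂_associator f g h := F.map₂_associator f.hom g.hom h.hom
  map₂_left_unitor f := F.map₂_left_unitor f.hom
  map₂_right_unitor f := F.map₂_right_unitor f.hom
  map_id x := Wide.Hom.ext (F.map_id x.obj)
  map_comp f g := Wide.Hom.ext (F.map_comp f.hom g.hom)
  mapId_eq_eqToIso x := (congrArg Wide.mkIso (F.mapId_eq_eqToIso x.obj)).trans
    (Wide.mkIso_eqToIso (f := Wide.Hom.mk _ (h _ (W.id_mem x.obj)))
      (g := Wide.Hom.mk _ (W'.id_mem (F.obj x.obj))) (F.map_id x.obj))
  mapComp_eq_eqToIso f g := (congrArg Wide.mkIso (F.mapComp_eq_eqToIso f.hom g.hom)).trans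
    (Wide.mkIso_eqToIso (f := Wide.Hom.mk _ (h _ (W.comp_mem f.mem g.mem)))
      (g := Wide.Hom.mk _ (W'.comp_mem (h _ f.mem) (h _ g.mem))) (F.map_comp f.hom g.hom))

namespace AdjointBiequivalence

/-- The adjoint biequivalence restricts to the wide 2-full sub-2-categories on the classes `W`
and `W'`: all its data lie in them, and the components of unit and counit are
equivalences in them. -/
structure Restricts (e : AdjointBiequivalence A B) (W : OneCellClass A) (W' : OneCellClass B) :
    Prop where
  left_mem : ∀ {a b : A} (f : a ⟶ b), W.Mem f → W'.Mem (e.left.map f)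
  right_mem : ∀ {a b : B} (f : a ⟶ b), W'.Mem f → W.Mem (e.right.map f)
  unit_mem : ∀ a : A, W.Mem (e.unit.app a)
  counit_mem : ∀ b : B, W'.Mem (e.counit.app b)
  unit_equiv : ∀ a : A, IsEquivCell (A := Wide W) (a := ⟨a⟩)
    (b := ⟨e.right.obj (e.left.obj a)⟩) (Wide.Hom.mk (e.unit.app a) (unit_mem a))
  counit_equiv : ∀ b : B, IsEquivCell (A := Wide W') (a := ⟨e.left.obj (e.right.obj b)⟩)
    (b := ⟨b⟩) (Wide.Hom.mk (e.counit.app b) (counit_mem b))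

/-- The restricted adjoint biequivalence. -/
def restrict (e : AdjointBiequivalence A B) {W : OneCellClass A} {W' : OneCellClass B}
    (h : e.Restricts W W') : AdjointBiequivalence (Wide W) (Wide W') where
  left := restrictFunctor W W' e.left h.left_mem
  right := restrictFunctor W' W e.right h.right_mem
  unit :=
    { app x := (Wide.Hom.mk (e.unit.app x.obj) (h.unit_mem x.obj) :
        Wide.Hom x ⟨e.right.obj (e.left.obj x.obj)⟩)
      naturality f := Wide.mkIso (e.unit.naturality f.hom)
      naturality_naturality η := e.unit.naturality_naturality η
      naturality_id x := e.unit.naturality_id x.obj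
      naturality_comp f g := e.unit.naturality_comp f.hom g.hom }
  counit :=
    { app x := (Wide.Hom.mk (e.counit.app x.obj) (h.counit_mem x.obj) :
        Wide.Hom ⟨e.left.obj (e.right.obj x.obj)⟩ x)
      naturality f := Wide.mkIso (e.counit.naturality f.hom)
      naturality_naturality η := e.counit.naturality_naturality η
      naturality_id x := e.counit.naturality_id x.obj
      naturality_comp f g := e.counit.naturality_comp f.hom g.hom }
  unit_equiv x := h.unit_equiv x.obj
  counit_equiv x := h.counit_equiv x.obj
  leftTri x := Wide.mkIso (e.leftTri x.obj)
  rightTri x := Wide.mkIso (e.rightTri x.obj)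
  leftTri_naturality f := e.leftTri_naturality f.hom
  rightTri_naturality f := e.rightTri_naturality f.hom
  unit_swallowtail x := e.unit_swallowtail x.obj
  counit_swallowtail x := e.counit_swallowtail x.obj

end AdjointBiequivalence

end Biequivalence

/-- The pseudo morphisms of comprehension categories: those with invertible `ζ`. -/
def CompCat.pseudo : OneCellClass CompCat.{v, u} where
  Mem {X Y} (f : CompCat.Hom X Y) := IsIso f.ζ
  id_mem X := by
    have : ∀ e, IsIso ((CompCat.Hom.id X).ζ.app e) := fun e =>
      inferInstanceAs (IsIso (𝟙 (X.χ.obj e)))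
    exact NatIso.isIso_of_isIso_app _
  comp_mem {X Y Z} (f : CompCat.Hom X Y) (g : CompCat.Hom Y Z) hf hg := by
    have : IsIso f.ζ := hf
    have : IsIso g.ζ := hg
    have : ∀ e, IsIso ((f.comp g).ζ.app e) := fun e =>
      inferInstanceAs (IsIso (g.base.mapArrow.map (f.ζ.app e) ≫ g.ζ.app (f.total.obj e)))
    exact NatIso.isIso_of_isIso_app _

namespace GCwF

/-- The mate `ζ^# : H' Δ ⟶ Δ' H` of `ζ`. -/
def Hom.mate {X Y : GCwF.{v, u}} (f : Hom X Y) : X.Del ⋙ f.tm ⟶ f.ty ⋙ Y.Del :=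
  (mateEquiv X.adj Y.adj (TwoSquare.mk f.tm X.Sig Y.Sig f.ty f.ζ.hom)).natTrans

theorem Hom.mate_app {X Y : GCwF.{v, u}} (f : Hom X Y) (A : X.Ty) :
    f.mate.app A = Y.adj.unit.app (f.tm.obj (X.Del.obj A)) ≫
      Y.Del.map (f.z (X.Del.obj A) ≫ f.ty.map (X.adj.counit.app A)) := by
  rw [Functor.map_comp]
  unfold Hom.mate
  rw [mateEquiv_apply]
  simp [TwoSquare.natTrans, TwoSquare.mk, Hom.z]

theorem Hom.mate_id_app (X : GCwF.{v, u}) (A : X.Ty) :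
    (Hom.id X).mate.app A = 𝟙 (X.Del.obj A) := by
  rw [Hom.mate_app]
  change X.adj.unit.app (X.Del.obj A) ≫ X.Del.map (𝟙 _ ≫ X.adj.counit.app A) = _
  rw [Category.id_comp, X.adj.right_triangle_components]

theorem Hom.mate_comp_app {X Y Z : GCwF.{v, u}} (f : Hom X Y) (g : Hom Y Z) (A : X.Ty) :
    (f.comp g).mate.app A = g.tm.map (f.mate.app A) ≫ g.mate.app (f.ty.obj A) := by
  have h1 : Y.Sig.map (f.mate.app A) ≫ Y.adj.counit.app (f.ty.obj A) =
      f.z (X.Del.obj A) ≫ f.ty.map (X.adj.counit.app A) := by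
    rw [Hom.mate_app, Functor.map_comp, Category.assoc]
    exact (congrArg (_ ≫ ·) (Y.adj.counit_naturality _)).trans
      (Y.adj.left_triangle_components_assoc _ _)
  rw [Hom.mate_app (f.comp g), Hom.mate_app g]
  change Z.adj.unit.app (g.tm.obj (f.tm.obj (X.Del.obj A))) ≫ Z.Del.map
      ((g.z (f.tm.obj (X.Del.obj A)) ≫ g.ty.map (f.z (X.Del.obj A))) ≫
        g.ty.map (f.ty.map (X.adj.counit.app A))) = _
  refine Eq.trans ?_ (Z.adj.unit_naturality_assoc (g.tm.map (f.mate.app A)) _)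
  refine congrArg (_ ≫ ·) ?_
  refine Eq.trans (congrArg Z.Del.map ?_) (Z.Del.map_comp _ _)
  refine Eq.trans ?_ (Category.assoc _ _ _)
  refine Eq.trans ?_ (congrArg (· ≫ _) (g.z_nat (f.mate.app A))).symm
  refine (Category.assoc _ _ _).trans (Eq.trans ?_ (Category.assoc _ _ _).symm)
  refine congrArg (_ ≫ ·) ?_
  exact (g.ty.map_comp _ _).symm.trans ((congrArg g.ty.map h1).symm.trans (g.ty.map_comp _ _))

/-- The pseudo loose morphisms: those for which the mate of `ζ` is invertible. -/
def pseudo : OneCellClass GCwF.{v, u} where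
  Mem {X Y} (f : Hom X Y) := IsIso f.mate
  id_mem X := by
    have : ∀ A, IsIso ((Hom.id X).mate.app A) := fun A => by
      rw [Hom.mate_id_app]
      exact inferInstanceAs (IsIso (𝟙 (X.Del.obj A)))
    exact NatIso.isIso_of_isIso_app _
  comp_mem {X Y Z} (f : Hom X Y) (g : Hom Y Z) hf hg := by
    have : IsIso f.mate := hf
    have : IsIso g.mate := hg
    have : ∀ A, IsIso ((f.comp g).mate.app A) := fun A => by
      rw [Hom.mate_comp_app]
      exact inferInstanceAs (IsIso (g.tm.map (f.mate.app A) ≫ g.mate.app (f.ty.obj A)))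
    exact NatIso.isIso_of_isIso_app _

end GCwF

/-!
A generalised category with families `X` has the comprehension category `(u, A ↦ u ε_A)`, and a
comprehension category has the generalised category with families whose terms are the pairs of a
type and a section of its comprehension, with `Δ A` the diagonal section of the weakening of `A`
along its own comprehension. These two constructions are the 2-functors `G`
(`GCwF.toCompCatFunctor`) and `E` (`CompCat.toGCwFFunctor`).

The fibration of terms is equal to the composite `u Σ`, and `Σ` preserves and reflects cartesian
arrows (`GCwF.isCart_of_isCart_sig`). Cartesian arrows of types have pullback squares as
comprehension, because an arrow `k` into the domain of `u ε_A` is the projection of a cartesian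
arrow of terms into `Δ A` (`GCwF.isPullback_comprehension`). A loose morphism `f` gives a
comparison `f.r A : H Σ Δ A ⟶ Σ' Δ' H A`, which is `Σ'` of the mate of `ζ` read along `ζ`; its
projection is the domain part of `G f`. The comparison is compatible with identities, composition
and 2-cells, which makes `G` a strict 2-functor, and the mate of `f` is invertible if and only if
the comparison of comprehensions of `G f` is (`GCwF.Hom.isIso_mate_iff_isIso_toCompCat_ζ`), so
that `G` preserves and reflects pseudo morphisms.

The unit is the identity on types and maps a term `a` to the section `u Σ η_a` of its type. It is
pseudonatural with constraint `ζ` on terms. It is an equivalence because a section of the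
comprehension of `A` is realized by reindexing the variable `Δ A` along it (`GCwF.realize`), and
both round trips are vertical and cartesian, hence invertible. The counit is the identity on the
base and on types. As the weakening of `A` lies strictly over the domain of the comprehension of
`A`, the comprehension of `E Y` is equal to that of `Y`, not merely isomorphic to it
(`CompCat.toGCwF_comprehension`); the counit has transports along equalities as components and is
strictly natural (`CompCat.counit_naturality`). This gives `G E = Id`
(`StrictPseudofunctor.hext`), after comparing the actions on 1-cells through the strict naturality
of the counit.

Both triangle identities hold strictly (`GCwF.leftTriangle`, `CompCat.rightTriangle`). The
remaining 2-cells in the modification and swallowtail equations have transports as components,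
with the only exception of the unit constraints, whose component `ζ` on terms is forgotten by `G`
and is an identity for the morphisms in the image of `E` and for the unit itself. Parallel 2-cells
of this kind are equal (`CompCat.Structural.eq`, `GCwF.Structural.eq`), and this proves the
coherence equations.
-/

/-! ### Cartesian arrows -/

namespace IsCart

variable {E : Type*} {B : Type*} [Category* E] [Category* B] {p : E ⥤ B}

theorem congr_functor {q : E ⥤ B} (h : p = q) {x y : E} {f : x ⟶ y} :
    IsCart p f ↔ IsCart q f := by
  subst h; rfl

theorem exists_lift {x y z : E} {f : x ⟶ y} (hf : IsCart p f) (g : z ⟶ y)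
    (w : p.obj z ⟶ p.obj x) (h : w ≫ p.map f = p.map g) :
    ∃ k : z ⟶ x, k ≫ f = g ∧ p.map k = w := by
  obtain ⟨k, ⟨h₁, h₂⟩, -⟩ :=
    Functor.IsStronglyCartesian.universal_property p (p.map f) f w (p.map g) h.symm g
  exact ⟨k, h₂, (IsHomLift.eq_of_isHomLift p w k).symm⟩

theorem hom_ext {x y z : E} {f : x ⟶ y} (hf : IsCart p f) {k k' : z ⟶ x}
    (h : k ≫ f = k' ≫ f) (h' : p.map k = p.map k') : k = k' := by
  have : p.IsHomLift (p.map k) k' := h' ▸ inferInstance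
  exact Functor.IsStronglyCartesian.ext p (p.map f) f (p.map k) h

theorem mk' {x y : E} {f : x ⟶ y}
    (h : ∀ {z : E} (g : z ⟶ y) (w : p.obj z ⟶ p.obj x), w ≫ p.map f = p.map g →
      ∃ k : z ⟶ x, k ≫ f = g ∧ p.map k = w)
    (h' : ∀ {z : E} {k k' : z ⟶ x}, k ≫ f = k' ≫ f → p.map k = p.map k' → k = k') :
    IsCart p f where
  universal_property' {z} w g hg := by
    obtain ⟨k, hk, hk'⟩ := h g w (IsHomLift.eq_of_isHomLift p _ g)
    subst hk'
    refine ⟨k, ⟨inferInstance, hk⟩, fun k' hk' => ?_⟩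
    have := hk'.1
    exact h' (hk'.2.trans hk.symm) (IsHomLift.eq_of_isHomLift p _ k').symm

theorem comp {x y z : E} {f : x ⟶ y} {g : y ⟶ z} (hf : IsCart p f) (hg : IsCart p g) :
    IsCart p (f ≫ g) := by
  unfold IsCart
  rw [p.map_comp]
  infer_instance

theorem of_comp {x y z : E} {f : x ⟶ y} {g : y ⟶ z} (hg : IsCart p g)
    (h : IsCart p (f ≫ g)) : IsCart p f := by
  unfold IsCart at h
  rw [p.map_comp] at h
  exact Functor.IsStronglyCartesian.of_comp p (g := p.map g) (ψ := g)

theorem of_isIso {x y : E} (f : x ⟶ y) [IsIso f] : IsCart p f :=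
  Functor.IsStronglyCartesian.of_isIso p (p.map f) f

theorem isIso {x y : E} {f : x ⟶ y} (hf : IsCart p f) (h : IsIso (p.map f)) : IsIso f :=
  Functor.IsStronglyCartesian.isIso_of_base_isIso p (p.map f) f

theorem of_isHomLift {R S : B} {x y : E} (w : R ⟶ S) (f : x ⟶ y)
    (h : p.IsStronglyCartesian w f) : IsCart p f := by
  obtain ⟨⟩ := h.toIsHomLift
  exact h

theorem exists_of_isFibered (h : p.IsFibered) {y : E} {b : B} (w : b ⟶ p.obj y) :
    ∃ (x : E) (f : x ⟶ y) (e : p.obj x = b), IsCart p f ∧ p.map f = eqToHom e ≫ w := by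
  have hc : p.IsCartesian w (Functor.IsPreFibered.pullbackMap rfl w) := inferInstance
  refine ⟨_, Functor.IsPreFibered.pullbackMap rfl w, Functor.IsPreFibered.pullbackObj_proj rfl w,
    of_isHomLift w _ inferInstance, ?_⟩
  simpa using IsHomLift.fac' p w (Functor.IsPreFibered.pullbackMap rfl w)

theorem isFibered_of_exists
    (h : ∀ {y : E} {b : B} (w : b ⟶ p.obj y),
      ∃ (x : E) (f : x ⟶ y) (e : p.obj x = b), IsCart p f ∧ p.map f = eqToHom e ≫ w) :
    p.IsFibered :=
  .of_exists_isStronglyCartesian fun y b w => by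
    obtain ⟨x, f, rfl, hf, hw⟩ := h w
    rw [eqToHom_refl, Category.id_comp] at hw
    exact ⟨x, f, hw ▸ hf⟩

end IsCart

/-- The projection of a vertical arrow is an identity up to transport. -/
theorem map_eq_eqToHom_of_isHomLift_id {E B : Type*} [Category* E] [Category* B] {p : E ⥤ B}
    {R : B} {x y : E} (f : x ⟶ y) (h : p.IsHomLift (𝟙 R) f) :
    ∃ e : p.obj x = p.obj y, p.map f = eqToHom e :=
  ⟨(IsHomLift.domain_eq p (𝟙 R) f).trans (IsHomLift.codomain_eq p (𝟙 R) f).symm, by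
    simpa using IsHomLift.fac' p (𝟙 R) f⟩

theorem isHomLift_id_of_map_eq {E B : Type*} [Category* E] [Category* B] {p : E ⥤ B}
    {R : B} {x y : E} (f : x ⟶ y) (h : p.obj x = R) (e : p.obj x = p.obj y)
    (he : p.map f = eqToHom e) : p.IsHomLift (𝟙 R) f :=
  IsHomLift.of_fac' p _ _ h (e ▸ h) (by simp [he])

theorem isHomLift_comp_of_isHomLift {D E B : Type*} [Category* D] [Category* E] [Category* B]
    (F : D ⥤ E) {p : E ⥤ B} {R S : B} {w : R ⟶ S} {x y : D} {k : x ⟶ y}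
    (h : p.IsHomLift w (F.map k)) : (F ⋙ p).IsHomLift w k :=
  IsHomLift.of_fac' _ _ _ (IsHomLift.domain_eq p w (F.map k)) (IsHomLift.codomain_eq p w (F.map k))
    (IsHomLift.fac' p w (F.map k))

namespace IsFibMor

variable {E B E' B' E'' B'' : Type*} [Category* E] [Category* B] [Category* E'] [Category* B']
  [Category* E''] [Category* B''] {p : E ⥤ B} {p' : E' ⥤ B'} {p'' : E'' ⥤ B''}
  {F : B ⥤ B'} {H : E ⥤ E'}

/-- The identification of `F (p e)` with `p' (H e)` for a morphism `(F, H)` of fibrations: the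
component of `p ⋙ F = H ⋙ p'` at `e`, as an arrow. -/
def cmp (h : IsFibMor p p' F H) (e : E) : F.obj (p.obj e) ⟶ p'.obj (H.obj e) :=
  eqToHom (h.obj_eq e).symm

instance (h : IsFibMor p p' F H) (e : E) : IsIso (h.cmp e) := by
  unfold cmp; infer_instance

theorem cmp_naturality (h : IsFibMor p p' F H) {e e' : E} (f : e ⟶ e') :
    h.cmp e ≫ p'.map (H.map f) = F.map (p.map f) ≫ h.cmp e' := by
  have := Functor.congr_hom h.comm f
  dsimp at this
  simp [cmp, this]

theorem cmp_comp {F' : B' ⥤ B''} {H' : E' ⥤ E''} (h : IsFibMor p p' F H)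
    (h' : IsFibMor p' p'' F' H') (e : E) :
    (h.comp h').cmp e = F'.map (h.cmp e) ≫ h'.cmp (H.obj e) := by
  simp [cmp, eqToHom_map]

theorem cmp_cell {G : B ⥤ B'} {K : E ⥤ E'} {ψ : F ⟶ G} {φ : H ⟶ K} (h : IsFibMor p p' F H)
    (h' : IsFibMor p p' G K) (hc : IsFibCell p p' ψ φ) (e : E) :
    h.cmp e ≫ p'.map (φ.app e) = ψ.app (p.obj e) ≫ h'.cmp e := by
  have := hc e
  have := IsHomLift.fac' p' (ψ.app (p.obj e)) (φ.app e)
  simp [cmp, this]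

end IsFibMor

theorem isFibCell_id_of_map_eq {E B E' B' : Type*} [Category* E] [Category* B] [Category* E']
    [Category* B'] {p : E ⥤ B} {p' : E' ⥤ B'} {F : B ⥤ B'} {H K : E ⥤ E'}
    (h : IsFibMor p p' F H) (φ : H ⟶ K)
    (h' : ∀ e, ∃ q : p'.obj (H.obj e) = p'.obj (K.obj e), p'.map (φ.app e) = eqToHom q) :
    IsFibCell p p' (𝟙 F) φ := fun e => by
  obtain ⟨q, hq⟩ := h' e
  exact isHomLift_id_of_map_eq _ (h.obj_eq e) q hq

namespace GCwF

variable (X : GCwF.{v, u})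

theorem sig_comp_u : X.Sig ⋙ X.u = X.du := X.Sig_fib.comm

theorem isCart_du_iff {a b : X.Tm} {f : a ⟶ b} : IsCart X.du f ↔ IsCart (X.Sig ⋙ X.u) f :=
  (IsCart.congr_functor X.sig_comp_u).symm

theorem isCart_sig {a b : X.Tm} {f : a ⟶ b} (h : IsCart (X.Sig ⋙ X.u) f) :
    IsCart X.u (X.Sig.map f) :=
  X.Sig_fib.cart f (X.isCart_du_iff.2 h)

theorem isCart_unit (a : X.Tm) : IsCart (X.Sig ⋙ X.u) (X.adj.unit.app a) :=
  X.isCart_du_iff.1 (X.unit_cart a)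

theorem exists_isCart_tm {a : X.Tm} {b : X.Base} (w : b ⟶ X.u.obj (X.Sig.obj a)) :
    ∃ (a' : X.Tm) (f : a' ⟶ a) (e : X.u.obj (X.Sig.obj a') = b), IsCart (X.Sig ⋙ X.u) f ∧
      X.u.map (X.Sig.map f) = eqToHom e ≫ w :=
  IsCart.exists_of_isFibered (p := X.Sig ⋙ X.u) (X.sig_comp_u ▸ X.fibered_du) w

/-- The functor `Σ` reflects cartesian arrows. The vertical part `v` of an arrow that `Σ` maps to a
cartesian one is sent to an isomorphism by `Σ`; comparing it with `Δ Σ v` along the cartesian unit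
shows that `v` is itself cartesian. -/
theorem isCart_of_isCart_sig {a b : X.Tm} {f : a ⟶ b} (h : IsCart X.u (X.Sig.map f)) :
    IsCart (X.Sig ⋙ X.u) f := by
  obtain ⟨x, c, e, hc, hw⟩ := X.exists_isCart_tm (X.u.map (X.Sig.map f))
  obtain ⟨w, hwc, hwu⟩ := hc.exists_lift f (eqToHom e.symm) (by simp [hw])
  have h₁ : IsCart X.u (X.Sig.map w) := by
    refine IsCart.of_comp (X.isCart_sig hc) ?_
    rwa [← Functor.map_comp, hwc]
  have h₂ : IsIso (X.Sig.map w) := h₁.isIso (by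
    change IsIso ((X.Sig ⋙ X.u).map w)
    rw [hwu]; infer_instance)
  have h₃ : IsCart (X.Sig ⋙ X.u) w := by
    refine IsCart.of_comp (X.isCart_unit x) ?_
    have := X.adj.unit.naturality w
    dsimp at this
    rw [this]
    exact (X.isCart_unit a).comp (IsCart.of_isIso _)
  rw [← hwc]
  exact h₃.comp hc

theorem isIso_of_isIso_sig {a b : X.Tm} {f : a ⟶ b} (h : IsIso (X.Sig.map f)) : IsIso f :=
  (X.isCart_of_isCart_sig (IsCart.of_isIso _)).isIso
    (inferInstanceAs (IsIso (X.u.map (X.Sig.map f))))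

theorem isCart_del {A A' : X.Ty} {f : A ⟶ A'} (h : IsCart X.u f) :
    IsCart (X.Sig ⋙ X.u) (X.Del.map f) := by
  refine X.isCart_of_isCart_sig (IsCart.of_comp (X.counit_cart A') ?_)
  have := X.adj.counit.naturality f
  dsimp at this
  rw [this]
  exact (X.counit_cart A).comp h

end GCwF

/-! ### The comprehension category of a generalised category with families -/

namespace GCwF

section Comparison

variable {X Y Z : GCwF.{v, u}}

theorem del_hom_ext {a : X.Tm} {A : X.Ty} {k k' : a ⟶ X.Del.obj A}
    (h : X.Sig.map k ≫ X.adj.counit.app A = X.Sig.map k' ≫ X.adj.counit.app A) : k = k' :=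
  (X.adj.homEquiv a A).symm.injective (by simpa [Adjunction.homEquiv_counit] using h)

theorem Hom.sig_mate_counit (f : Hom X Y) (A : X.Ty) :
    Y.Sig.map (f.mate.app A) ≫ Y.adj.counit.app (f.ty.obj A) =
      f.z (X.Del.obj A) ≫ f.ty.map (X.adj.counit.app A) := by
  rw [Hom.mate_app, Functor.map_comp, Category.assoc]
  exact (congrArg (_ ≫ ·) (Y.adj.counit_naturality _)).trans
    (Y.adj.left_triangle_components_assoc _ _)

instance (f : Hom X Y) (a : X.Tm) : IsIso (f.z a) :=
  inferInstanceAs (IsIso (f.ζ.hom.app a))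

/-- The comparison `H Σ Δ A ⟶ Σ' Δ' H A` of a loose morphism: `Σ'` of the mate of `ζ`, read from
`H Σ Δ A` along `ζ`. -/
noncomputable def Hom.r (f : Hom X Y) (A : X.Ty) :
    f.ty.obj (X.Sig.obj (X.Del.obj A)) ⟶ Y.Sig.obj (Y.Del.obj (f.ty.obj A)) :=
  inv (f.z (X.Del.obj A)) ≫ Y.Sig.map (f.mate.app A)

theorem Hom.z_r (f : Hom X Y) (A : X.Ty) :
    f.z (X.Del.obj A) ≫ f.r A = Y.Sig.map (f.mate.app A) := by
  simp [Hom.r]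

theorem Hom.r_counit (f : Hom X Y) (A : X.Ty) :
    f.r A ≫ Y.adj.counit.app (f.ty.obj A) = f.ty.map (X.adj.counit.app A) := by
  rw [← cancel_epi (f.z (X.Del.obj A)), reassoc_of% f.z_r, f.sig_mate_counit]

theorem Hom.r_naturality (f : Hom X Y) {A A' : X.Ty} (g : A ⟶ A') :
    f.ty.map (X.Sig.map (X.Del.map g)) ≫ f.r A' =
      f.r A ≫ Y.Sig.map (Y.Del.map (f.ty.map g)) := by
  rw [← cancel_epi (f.z (X.Del.obj A)), reassoc_of% f.z_r, ← Category.assoc, ← f.z_nat,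
    Category.assoc, f.z_r, ← Functor.map_comp, ← Functor.map_comp]
  exact congrArg Y.Sig.map (f.mate.naturality g)

/-- Naturality of the comparison in 2-cells. -/
theorem Hom.r_cell {f g : Hom X Y} (η : Hom₂ f g) (A : X.Ty) :
    f.r A ≫ Y.Sig.map (Y.Del.map (η.ty.app A)) =
      η.ty.app (X.Sig.obj (X.Del.obj A)) ≫ g.r A := by
  have h₁ := comm_iff.1 η.comm (X.Del.obj A)
  have h₂ : f.mate.app A ≫ Y.Del.map (η.ty.app A) =
      η.tm.app (X.Del.obj A) ≫ g.mate.app A := by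
    refine del_hom_ext ?_
    have h₃ := Y.adj.counit.naturality (η.ty.app A)
    dsimp at h₃
    rw [Functor.map_comp, Category.assoc, h₃, reassoc_of% f.sig_mate_counit, Functor.map_comp,
      Category.assoc, g.sig_mate_counit, reassoc_of% h₁, η.ty.naturality]
  rw [← cancel_epi (f.z (X.Del.obj A)), reassoc_of% f.z_r, ← Functor.map_comp, h₂, Functor.map_comp,
    ← g.z_r, reassoc_of% h₁]

theorem Hom.r_eq (f : Hom X Y) {A : X.Ty}
    {k : f.ty.obj (X.Sig.obj (X.Del.obj A)) ⟶ Y.Sig.obj (Y.Del.obj (f.ty.obj A))}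
    (h : Y.Sig.map (f.mate.app A) = f.z (X.Del.obj A) ≫ k) : f.r A = k := by
  rw [← cancel_epi (f.z (X.Del.obj A)), f.z_r, h]

theorem Hom.r_id (A : X.Ty) : (Hom.id X).r A = 𝟙 (X.Sig.obj (X.Del.obj A)) :=
  Hom.r_eq _ ((congrArg X.Sig.map (Hom.mate_id_app X A)).trans
    ((X.Sig.map_id _).trans (Category.id_comp _).symm))

theorem Hom.r_comp (f : Hom X Y) (g : Hom Y Z) (A : X.Ty) :
    (f.comp g).r A = g.ty.map (f.r A) ≫ g.r (f.ty.obj A) := by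
  have h : Z.Sig.map (g.tm.map (f.mate.app A)) ≫ Z.Sig.map (g.mate.app (f.ty.obj A)) =
      (g.z (f.tm.obj (X.Del.obj A)) ≫ g.ty.map (f.z (X.Del.obj A))) ≫
        g.ty.map (f.r A) ≫ g.r (f.ty.obj A) :=
    calc
      _ = _ ≫ g.z (Y.Del.obj (f.ty.obj A)) ≫ g.r (f.ty.obj A) := by rw [g.z_r]
      _ = (g.z (f.tm.obj (X.Del.obj A)) ≫ g.ty.map (Y.Sig.map (f.mate.app A))) ≫
          g.r (f.ty.obj A) := by
        rw [← Category.assoc]; exact congrArg (· ≫ _) (g.z_nat _)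
      _ = _ := by rw [← f.z_r, Functor.map_comp]; simp only [Category.assoc]
  exact Hom.r_eq _ ((congrArg Z.Sig.map (Hom.mate_comp_app f g A)).trans
    ((Z.Sig.map_comp _ _).trans h))

theorem Hom.exists_u_map_z (f : Hom X Y) (a : X.Tm) :
    ∃ e : Y.u.obj (Y.Sig.obj (f.tm.obj a)) = Y.u.obj (f.ty.obj (X.Sig.obj a)),
      Y.u.map (f.z a) = eqToHom e :=
  map_eq_eqToHom_of_isHomLift_id _ (f.ζ_vert a)

/-- The comparison is cartesian, so it is invertible as soon as its projection is. -/
theorem Hom.isCart_r (f : Hom X Y) (A : X.Ty) : IsCart Y.u (f.r A) := by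
  refine IsCart.of_comp (Y.counit_cart _) ?_
  rw [f.r_counit]
  exact f.ty_fib.cart _ (X.counit_cart A)

/-- The mate is invertible when its image under `Σ` is, because `Σ` reflects isomorphisms. -/
theorem Hom.isIso_mate_iff (f : Hom X Y) : IsIso f.mate ↔ ∀ A, IsIso (Y.u.map (f.r A)) := by
  constructor
  · intro h A
    unfold Hom.r
    infer_instance
  · intro h
    have : ∀ A, IsIso (f.mate.app A) := fun A => by
      refine Y.isIso_of_isIso_sig ?_
      have := (f.isCart_r A).isIso (h A)
      rw [← f.z_r]
      infer_instance
    exact NatIso.isIso_of_isIso_app _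

end Comparison

/-- The projection of the counit at `A`, an arrow of the base. -/
def ext (X : GCwF.{v, u}) (A : X.Ty) : X.u.obj (X.Sig.obj (X.Del.obj A)) ⟶ X.u.obj A :=
  X.u.map (X.adj.counit.app A)

/-- The functor `A ↦ u ε_A` to arrows of the base. -/
def comprehension (X : GCwF.{v, u}) : X.Ty ⥤ Arrow X.Base where
  obj A := Arrow.mk (X.ext A)
  map f := Arrow.homMk (X.u.map (X.Sig.map (X.Del.map f))) (X.u.map f) (by
    have := X.adj.counit.naturality f
    dsimp at this
    simp [ext, ← Functor.map_comp, this])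
  map_id A := by ext <;> simp
  map_comp f g := by ext <;> simp

/-- Cartesian arrows have pullback squares as comprehension. An arrow into the corner is obtained by
transposing the factorization through the given cartesian arrow of types; any two such arrows are
compared through a cartesian arrow of terms over one of the legs. -/
theorem isPullback_comprehension (X : GCwF.{v, u}) {A A' : X.Ty} {f : A ⟶ A'}
    (hf : IsCart X.u f) :
    IsPullback (X.comprehension.map f).left (X.comprehension.obj A).hom
      (X.comprehension.obj A').hom (X.comprehension.map f).right := by
  have key : ∀ {b : X.Base} (k : b ⟶ X.u.obj (X.Sig.obj (X.Del.obj A'))) (h : b ⟶ X.u.obj A),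
      k ≫ X.ext A' = h ≫ X.u.map f →
      ∃! m : b ⟶ X.u.obj (X.Sig.obj (X.Del.obj A)),
        m ≫ X.u.map (X.Sig.map (X.Del.map f)) = k ∧ m ≫ X.ext A = h := by
    intro b k h hkh
    -- a term `t` over `b` with a cartesian arrow to the variable `Δ A'`, whose projection is `k`
    obtain ⟨t, c, e, hc, hw⟩ := X.exists_isCart_tm k
    subst e
    rw [eqToHom_refl, Category.id_comp] at hw
    subst hw
    have hnat := X.adj.counit.naturality f
    dsimp at hnat
    obtain ⟨g, hg, hgu⟩ := hf.exists_lift (X.Sig.map c ≫ X.adj.counit.app A') h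
      (by rw [← hkh, Functor.map_comp]; rfl)
    refine ⟨X.u.map (X.Sig.map ((X.adj.homEquiv t A) g)), ⟨?_, ?_⟩, ?_⟩
    · rw [← Functor.map_comp, ← Functor.map_comp]
      congr 2
      refine del_hom_ext ?_
      rw [Functor.map_comp, Category.assoc, hnat, ← Category.assoc, ← hg]
      congr 1
      simp [Adjunction.homEquiv_unit]
    · rw [ext, ← Functor.map_comp, ← hgu]
      congr 1
      simp [Adjunction.homEquiv_unit]
    -- for uniqueness, `m` lifts to an arrow of terms along the cartesian arrow `Δ f`
    · rintro m ⟨hm₁, hm₂⟩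
      obtain ⟨l, hl, hlu⟩ := (X.isCart_del hf).exists_lift c m hm₁
      change X.u.map (X.Sig.map l) = m at hlu
      rw [← hlu]
      congr 2
      refine (X.adj.homEquiv t A).symm.injective ?_
      rw [Equiv.symm_apply_apply]
      refine hf.hom_ext ?_ ?_
      · rw [hg, Adjunction.homEquiv_counit, Category.assoc, ← hnat, ← hl, Functor.map_comp,
          Category.assoc]
      · rw [hgu, ← hm₂, ← hlu, Adjunction.homEquiv_counit, Functor.map_comp, ext]
  refine ⟨⟨(X.comprehension.map f).w⟩, ⟨Limits.PullbackCone.IsLimit.mk _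
    (fun s => (key s.fst s.snd s.condition).choose)
    (fun s => (key s.fst s.snd s.condition).choose_spec.1.1)
    (fun s => (key s.fst s.snd s.condition).choose_spec.1.2)
    (fun s m h₁ h₂ => (key s.fst s.snd s.condition).choose_spec.2 m ⟨h₁, h₂⟩)⟩⟩

/-- The comprehension category `(u, A ↦ u ε_A)`. -/
def toCompCat (X : GCwF.{v, u}) : CompCat.{v, u} where
  Base := X.Base
  Total := X.Ty
  p := X.u
  fibered := X.fibered_u
  χ := X.comprehension
  χ_cod := rfl
  χ_cart _ hf := X.isPullback_comprehension hf

variable {X Y Z : GCwF.{v, u}}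

/-- The comparison between the comprehensions induced by a loose morphism. -/
noncomputable def Hom.comprehensionNat (f : Hom X Y) :
    X.comprehension ⋙ f.base.mapArrow ⟶ f.ty ⋙ Y.comprehension where
  app A := Arrow.homMk (f := Arrow.mk (f.base.map (X.ext A))) (g := Arrow.mk (Y.ext (f.ty.obj A)))
    (f.ty_fib.cmp _ ≫ Y.u.map (f.r A)) (f.ty_fib.cmp A) (by
      have h : (f.ty_fib.cmp _ ≫ Y.u.map (f.r A)) ≫ Y.ext (f.ty.obj A) =
          f.base.map (X.ext A) ≫ f.ty_fib.cmp A := by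
        rw [ext, ext, Category.assoc, ← Functor.map_comp, f.r_counit]
        exact f.ty_fib.cmp_naturality _
      exact h)
  naturality A A' g := by
    apply Arrow.hom_ext
    · change f.base.map (X.u.map (X.Sig.map (X.Del.map g))) ≫ f.ty_fib.cmp _ ≫ Y.u.map (f.r A') =
        (f.ty_fib.cmp _ ≫ Y.u.map (f.r A)) ≫ Y.u.map (Y.Sig.map (Y.Del.map (f.ty.map g)))
      rw [← reassoc_of% f.ty_fib.cmp_naturality, ← Functor.map_comp, f.r_naturality,
        Functor.map_comp, Category.assoc]
    · exact (f.ty_fib.cmp_naturality g).symm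

/-- The lax morphism of comprehension categories induced by a loose morphism. -/
noncomputable def Hom.toCompCat (f : Hom X Y) : CompCat.Hom X.toCompCat Y.toCompCat where
  base := f.base
  total := f.ty
  isFibMor := f.ty_fib
  ζ := f.comprehensionNat
  cod_ζ A := isHomLift_id_of_map_eq (p := Arrow.rightFunc) _ rfl (f.ty_fib.obj_eq A).symm rfl

/-- The 2-cell of comprehension categories induced by a 2-cell of loose morphisms. -/
noncomputable def Hom₂.toCompCat {f g : Hom X Y} (η : f ⟶ g) : f.toCompCat ⟶ g.toCompCat where
  base := η.base
  total := η.ty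
  isFibCell := η.ty_fib
  comm := (CompCat.comm_iff (f := f.toCompCat) (g := g.toCompCat)).2 ⟨fun A : X.Ty => by
      have h : (f.ty_fib.cmp (X.Sig.obj (X.Del.obj A)) ≫ Y.u.map (f.r A)) ≫
          Y.u.map (Y.Sig.map (Y.Del.map (η.ty.app A))) =
            η.base.app _ ≫ g.ty_fib.cmp _ ≫ Y.u.map (g.r A) := by
        rw [Category.assoc, ← Functor.map_comp, Hom.r_cell, Functor.map_comp,
          reassoc_of% IsFibMor.cmp_cell f.ty_fib g.ty_fib η.ty_fib]
      exact h,
    fun A => f.ty_fib.cmp_cell g.ty_fib η.ty_fib A⟩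

theorem Hom.toCompCat_id_ζ : (Hom.id X).toCompCat.ζ = (CompCat.Hom.id X.toCompCat).ζ := by
  refine NatTrans.ext (funext fun (A : X.Ty) => Arrow.hom_ext _ _ ?_ rfl)
  exact (Category.id_comp _).trans ((congrArg X.u.map (Hom.r_id A)).trans (X.u.map_id _))

theorem Hom.toCompCat_comp_ζ (f : Hom X Y) (g : Hom Y Z) :
    (f.comp g).toCompCat.ζ = (f.toCompCat.comp g.toCompCat).ζ := by
  refine NatTrans.ext (funext fun (A : X.Ty) => Arrow.hom_ext _ _ ?_
    (IsFibMor.cmp_comp f.ty_fib g.ty_fib A))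
  have h₁ := IsFibMor.cmp_comp f.ty_fib g.ty_fib (X.Sig.obj (X.Del.obj A))
  have h₂ := congrArg Z.u.map (Hom.r_comp f g A)
  have h₃ : (g.base.map (f.ty_fib.cmp (X.Sig.obj (X.Del.obj A))) ≫ g.ty_fib.cmp _) ≫
      Z.u.map (g.ty.map (f.r A) ≫ g.r (f.ty.obj A)) =
      g.base.map (f.ty_fib.cmp _ ≫ Y.u.map (f.r A)) ≫ g.ty_fib.cmp _ ≫
        Z.u.map (g.r (f.ty.obj A)) := by
    simp [← reassoc_of% g.ty_fib.cmp_naturality]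
  exact (congrArg₂ (· ≫ ·) h₁ h₂).trans h₃

end GCwF

/-! ### Two-cells whose components are identities up to transport -/

/-- An arrow that is an identity up to transport along an equality of objects. Any two parallel such
arrows are equal, which disposes of the coherence equations between structural 2-cells. -/
def IsTransport {C : Type*} [Category* C] {x y : C} (k : x ⟶ y) : Prop :=
  ∃ h : x = y, k = eqToHom h

namespace IsTransport

variable {C D : Type*} [Category* C] [Category* D]

theorem id (x : C) : IsTransport (𝟙 x) := ⟨rfl, rfl⟩

theorem comp {x y z : C} {k : x ⟶ y} {l : y ⟶ z} (hk : IsTransport k) (hl : IsTransport l) :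
    IsTransport (k ≫ l) := by
  obtain ⟨rfl, rfl⟩ := hk
  obtain ⟨rfl, rfl⟩ := hl
  exact ⟨rfl, by simp⟩

theorem map (F : C ⥤ D) {x y : C} {k : x ⟶ y} (hk : IsTransport k) : IsTransport (F.map k) := by
  obtain ⟨rfl, rfl⟩ := hk
  exact ⟨rfl, by simp⟩

theorem eq {x y : C} {k l : x ⟶ y} (hk : IsTransport k) (hl : IsTransport l) : k = l :=
  hk.choose_spec.trans hl.choose_spec.symm

theorem isIso {x y : C} {k : x ⟶ y} (hk : IsTransport k) : IsIso k := by
  obtain ⟨rfl, rfl⟩ := hk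
  rw [eqToHom_refl]; infer_instance

theorem eq_id {x : C} {k : x ⟶ x} (hk : IsTransport k) : k = 𝟙 x := hk.eq (.id x)

theorem map_congr {F G : C ⥤ D} (h : F = G) {x y : C} {k : x ⟶ y} (hk : IsTransport (F.map k)) :
    IsTransport (G.map k) := h ▸ hk

end IsTransport

namespace CompCat

open Bicategory

variable {X Y Z : CompCat.{v, u}}

/-- A 2-cell of comprehension categories with identity components, up to transport. -/
def Structural {f g : X ⟶ Y} (η : f ⟶ g) : Prop :=
  (∀ b, IsTransport (Hom₂.base η |>.app b)) ∧ ∀ e, IsTransport (Hom₂.total η |>.app e)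

namespace Structural

theorem eq {f g : X ⟶ Y} {η θ : f ⟶ g} (hη : Structural η) (hθ : Structural θ) : η = θ :=
  Hom₂.ext' (NatTrans.ext (funext fun b => (hη.1 b).eq (hθ.1 b)))
    (NatTrans.ext (funext fun e => (hη.2 e).eq (hθ.2 e)))

theorem id (f : X ⟶ Y) : Structural (𝟙 f) := ⟨fun _ => .id _, fun _ => .id _⟩

theorem comp {f g h : X ⟶ Y} {η : f ⟶ g} {θ : g ⟶ h} (hη : Structural η) (hθ : Structural θ) :
    Structural (η ≫ θ) := ⟨fun b => (hη.1 b).comp (hθ.1 b), fun e => (hη.2 e).comp (hθ.2 e)⟩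

theorem whiskerLeft (f : X ⟶ Y) {g h : Y ⟶ Z} {η : g ⟶ h} (hη : Structural η) :
    Structural (f ◁ η) := ⟨fun b => hη.1 (f.base.obj b), fun e => hη.2 (f.total.obj e)⟩

theorem whiskerRight {f g : X ⟶ Y} {η : f ⟶ g} (hη : Structural η) (h : Y ⟶ Z) :
    Structural (η ▷ h) := ⟨fun b => (hη.1 b).map h.base, fun e => (hη.2 e).map h.total⟩

theorem isoOfEq_hom (f : Hom X Y) {h' : IsFibMor X.p Y.p f.base f.total}
    {ζ' : X.χ ⋙ f.base.mapArrow ⟶ f.total ⋙ Y.χ} {c'} (e : f.ζ = ζ') :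
    Structural (isoOfEq f (h' := h') (c' := c') e).hom := ⟨fun _ => .id _, fun _ => .id _⟩

theorem isoOfEq_inv (f : Hom X Y) {h' : IsFibMor X.p Y.p f.base f.total}
    {ζ' : X.χ ⋙ f.base.mapArrow ⟶ f.total ⋙ Y.χ} {c'} (e : f.ζ = ζ') :
    Structural (isoOfEq f (h' := h') (c' := c') e).inv := ⟨fun _ => .id _, fun _ => .id _⟩

theorem eqToHom {f g : X ⟶ Y} (h : f = g) : Structural (eqToHom h) := by
  subst h; exact .id _

theorem eqToIso_hom {f g : X ⟶ Y} (h : f = g) : Structural (eqToIso h).hom := .eqToHom h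

theorem eqToIso_inv {f g : X ⟶ Y} (h : f = g) : Structural (eqToIso h).inv := .eqToHom h.symm

theorem associator_hom {W : CompCat.{v, u}} (f : W ⟶ X) (g : X ⟶ Y) (h : Y ⟶ Z) :
    Structural (α_ f g h).hom := ⟨fun _ => .id _, fun _ => .id _⟩

theorem associator_inv {W : CompCat.{v, u}} (f : W ⟶ X) (g : X ⟶ Y) (h : Y ⟶ Z) :
    Structural (α_ f g h).inv := ⟨fun _ => .id _, fun _ => .id _⟩

theorem leftUnitor_hom (f : X ⟶ Y) : Structural (λ_ f).hom := ⟨fun _ => .id _, fun _ => .id _⟩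

theorem leftUnitor_inv (f : X ⟶ Y) : Structural (λ_ f).inv := ⟨fun _ => .id _, fun _ => .id _⟩

theorem rightUnitor_hom (f : X ⟶ Y) : Structural (ρ_ f).hom := ⟨fun _ => .id _, fun _ => .id _⟩

theorem rightUnitor_inv (f : X ⟶ Y) : Structural (ρ_ f).inv := ⟨fun _ => .id _, fun _ => .id _⟩

end Structural

end CompCat

namespace GCwF

open Bicategory

variable {X Y Z : GCwF.{v, u}}

/-- A 2-cell of generalised categories with families with identity components, up to transport. -/
def Structural {f g : X ⟶ Y} (η : f ⟶ g) : Prop :=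
  (∀ b, IsTransport (Hom₂.base η |>.app b)) ∧ (∀ A, IsTransport (Hom₂.ty η |>.app A)) ∧
    ∀ a, IsTransport (Hom₂.tm η |>.app a)

namespace Structural

theorem eq {f g : X ⟶ Y} {η θ : f ⟶ g} (hη : Structural η) (hθ : Structural θ) : η = θ :=
  Hom₂.ext' (NatTrans.ext (funext fun b => (hη.1 b).eq (hθ.1 b)))
    (NatTrans.ext (funext fun e => (hη.2.1 e).eq (hθ.2.1 e)))
    (NatTrans.ext (funext fun e => (hη.2.2 e).eq (hθ.2.2 e)))

theorem id (f : X ⟶ Y) : Structural (𝟙 f) := ⟨fun _ => .id _, fun _ => .id _, fun _ => .id _⟩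

theorem comp {f g h : X ⟶ Y} {η : f ⟶ g} {θ : g ⟶ h} (hη : Structural η) (hθ : Structural θ) :
    Structural (η ≫ θ) := ⟨fun b => (hη.1 b).comp (hθ.1 b),
      fun e => (hη.2.1 e).comp (hθ.2.1 e), fun e => (hη.2.2 e).comp (hθ.2.2 e)⟩

theorem whiskerLeft (f : X ⟶ Y) {g h : Y ⟶ Z} {η : g ⟶ h} (hη : Structural η) :
    Structural (f ◁ η) :=
  ⟨fun b => hη.1 (f.base.obj b), fun e => hη.2.1 (f.ty.obj e), fun e => hη.2.2 (f.tm.obj e)⟩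

theorem whiskerRight {f g : X ⟶ Y} {η : f ⟶ g} (hη : Structural η) (h : Y ⟶ Z) :
    Structural (η ▷ h) :=
  ⟨fun b => (hη.1 b).map h.base, fun e => (hη.2.1 e).map h.ty, fun e => (hη.2.2 e).map h.tm⟩

theorem eqToHom {f g : X ⟶ Y} (h : f = g) : Structural (eqToHom h) := by
  subst h; exact .id _

theorem eqToIso_hom {f g : X ⟶ Y} (h : f = g) : Structural (eqToIso h).hom := .eqToHom h

theorem eqToIso_inv {f g : X ⟶ Y} (h : f = g) : Structural (eqToIso h).inv := .eqToHom h.symm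

theorem associator_hom {W : GCwF.{v, u}} (f : W ⟶ X) (g : X ⟶ Y) (h : Y ⟶ Z) :
    Structural (α_ f g h).hom := ⟨fun _ => .id _, fun _ => .id _, fun _ => .id _⟩

theorem associator_inv {W : GCwF.{v, u}} (f : W ⟶ X) (g : X ⟶ Y) (h : Y ⟶ Z) :
    Structural (α_ f g h).inv := ⟨fun _ => .id _, fun _ => .id _, fun _ => .id _⟩

theorem leftUnitor_hom (f : X ⟶ Y) : Structural (λ_ f).hom :=
  ⟨fun _ => .id _, fun _ => .id _, fun _ => .id _⟩

theorem leftUnitor_inv (f : X ⟶ Y) : Structural (λ_ f).inv :=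
  ⟨fun _ => .id _, fun _ => .id _, fun _ => .id _⟩

theorem rightUnitor_hom (f : X ⟶ Y) : Structural (ρ_ f).hom :=
  ⟨fun _ => .id _, fun _ => .id _, fun _ => .id _⟩

theorem rightUnitor_inv (f : X ⟶ Y) : Structural (ρ_ f).inv :=
  ⟨fun _ => .id _, fun _ => .id _, fun _ => .id _⟩

end Structural

/-! ### The 2-functor to comprehension categories -/

/-- The 2-functor `G`, which maps a generalised category with families to the comprehension category
`(u, A ↦ u ε_A)`. -/
noncomputable def toCompCatFunctor : StrictPseudofunctor GCwF.{v, u} CompCat.{v, u} where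
  obj X := X.toCompCat
  map f := Hom.toCompCat f
  map₂ η := Hom₂.toCompCat η
  map₂_id _ := rfl
  map₂_comp _ _ := rfl
  mapId X := CompCat.isoOfEq (Hom.id X).toCompCat (h' := (CompCat.Hom.id X.toCompCat).isFibMor)
    (c' := (CompCat.Hom.id X.toCompCat).cod_ζ) Hom.toCompCat_id_ζ
  mapComp f g := CompCat.isoOfEq (Hom.comp f g).toCompCat
    (h' := ((Hom.toCompCat f).comp (Hom.toCompCat g)).isFibMor)
    (c' := ((Hom.toCompCat f).comp (Hom.toCompCat g)).cod_ζ) (Hom.toCompCat_comp_ζ f g)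
  map₂_whisker_left _ _ _ _ := by
    apply CompCat.Hom₂.ext' <;> exact NatTrans.ext (funext fun _ =>
      ((Category.id_comp _).trans (Category.comp_id _)).symm)
  map₂_whisker_right _ _ := by
    apply CompCat.Hom₂.ext' <;> exact NatTrans.ext (funext fun _ =>
      ((Category.id_comp _).trans (Category.comp_id _)).symm)
  map₂_associator f g h := CompCat.Structural.eq ⟨fun _ => .id _, fun _ => .id _⟩
    (.comp (CompCat.Structural.isoOfEq_hom _ _) <|
      .comp (.whiskerRight (CompCat.Structural.isoOfEq_hom _ _) _) <|
      .comp (.associator_hom _ _ _) <|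
      .comp (.whiskerLeft _ (CompCat.Structural.isoOfEq_inv _ _))
        (CompCat.Structural.isoOfEq_inv _ _))
  map₂_left_unitor f := CompCat.Structural.eq ⟨fun _ => .id _, fun _ => .id _⟩
    (.comp (CompCat.Structural.isoOfEq_hom _ _) <|
      .comp (.whiskerRight (CompCat.Structural.isoOfEq_hom _ _) _) (.leftUnitor_hom _))
  map₂_right_unitor f := CompCat.Structural.eq ⟨fun _ => .id _, fun _ => .id _⟩
    (.comp (CompCat.Structural.isoOfEq_hom _ _) <|
      .comp (.whiskerLeft _ (CompCat.Structural.isoOfEq_hom _ _)) (.rightUnitor_hom _))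
  map_id X := CompCat.Hom.ext' rfl rfl (heq_of_eq Hom.toCompCat_id_ζ)
  mapId_eq_eqToIso X := CompCat.isoOfEq_eq _ _ _
  map_comp f g := CompCat.Hom.ext' rfl rfl (heq_of_eq (Hom.toCompCat_comp_ζ f g))
  mapComp_eq_eqToIso f g := CompCat.isoOfEq_eq _ _ _

end GCwF

/-! ### Sections of comprehensions as terms -/

namespace CompCat

/-- A term of a comprehension category: a type together with a section of its comprehension. -/
structure Term (X : CompCat.{v, u}) : Type (max u v) where
  /-- the type of the term -/
  type : X.Total
  /-- the section -/
  sec : (X.χ.obj type).right ⟶ (X.χ.obj type).left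
  sec_hom : sec ≫ (X.χ.obj type).hom = 𝟙 _

namespace Term

variable {X : CompCat.{v, u}}

/-- A morphism of terms: a morphism of types that is compatible with the sections. -/
@[ext]
structure Hom (a b : Term X) where
  /-- the morphism of types -/
  hom : a.type ⟶ b.type
  w : (X.χ.map hom).right ≫ b.sec = a.sec ≫ (X.χ.map hom).left

instance : Category (Term X) where
  Hom := Hom
  id a := ⟨𝟙 _, by simp⟩
  comp f g := ⟨f.hom ≫ g.hom, by simp [g.w, reassoc_of% f.w]⟩
  id_comp f := Hom.ext (Category.id_comp _)
  comp_id f := Hom.ext (Category.comp_id _)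
  assoc f g h := Hom.ext (Category.assoc _ _ _)

theorem hom_ext {a b : Term X} {f g : a ⟶ b} (h : f.hom = g.hom) : f = g := Hom.ext h

/-- The functor that forgets the section. -/
def forget (X : CompCat.{v, u}) : Term X ⥤ X.Total where
  obj a := a.type
  map f := f.hom

theorem isIso_of_isIso_hom {a b : Term X} (f : a ⟶ b) (h : IsIso f.hom) : IsIso f := by
  refine ⟨⟨inv f.hom, ?_⟩, hom_ext (IsIso.hom_inv_id f.hom), hom_ext (IsIso.inv_hom_id f.hom)⟩
  have h₁ : (X.χ.map (inv f.hom)).right ≫ (X.χ.map f.hom).right = 𝟙 _ := by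
    rw [← Arrow.comp_right, ← Functor.map_comp]; simp
  have h₂ : (X.χ.map f.hom).left ≫ (X.χ.map (inv f.hom)).left = 𝟙 _ := by
    rw [← Arrow.comp_left, ← Functor.map_comp]; simp
  have h₃ := congrArg (fun k => (X.χ.map (inv f.hom)).right ≫ k ≫ (X.χ.map (inv f.hom)).left) f.w
  rw [Category.assoc, Category.assoc, h₂, Category.comp_id, reassoc_of% h₁] at h₃
  exact h₃.symm

/-- The functor into terms with given types and sections. -/
def lift {C : Type*} [Category* C] (H : C ⥤ X.Total)
    (s : ∀ c, (X.χ.obj (H.obj c)).right ⟶ (X.χ.obj (H.obj c)).left)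
    (hs : ∀ c, s c ≫ (X.χ.obj (H.obj c)).hom = 𝟙 _)
    (w : ∀ {c d : C} (f : c ⟶ d),
      (X.χ.map (H.map f)).right ≫ s d = s c ≫ (X.χ.map (H.map f)).left) : C ⥤ Term X where
  obj c := ⟨H.obj c, s c, hs c⟩
  map f := ⟨H.map f, w f⟩
  map_id c := hom_ext (H.map_id c)
  map_comp f g := hom_ext (H.map_comp f g)

theorem lift_congr {C : Type*} [Category* C] {H : C ⥤ X.Total}
    {s s' : ∀ c, (X.χ.obj (H.obj c)).right ⟶ (X.χ.obj (H.obj c)).left} {hs hs'}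
    {w : ∀ {c d : C} (f : c ⟶ d),
      (X.χ.map (H.map f)).right ≫ s d = s c ≫ (X.χ.map (H.map f)).left}
    {w' : ∀ {c d : C} (f : c ⟶ d),
      (X.χ.map (H.map f)).right ≫ s' d = s' c ≫ (X.χ.map (H.map f)).left}
    (h : ∀ c, s c = s' c) : lift H s hs w = lift H s' hs' w' := by
  obtain rfl : s = s' := funext h
  rfl

theorem isTransport_hom {a b : Term X} {f : a ⟶ b} (h : IsTransport f) : IsTransport f.hom :=
  h.map (forget X)

theorem isTransport_of_hom {a b : Term X} {f : a ⟶ b} (h : IsTransport f.hom) :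
    IsTransport f := by
  obtain ⟨A, s, hs⟩ := a
  obtain ⟨A', s', hs'⟩ := b
  obtain ⟨k, hk⟩ := f
  obtain ⟨e, h⟩ := h
  dsimp at e
  subst e
  obtain rfl : k = 𝟙 A := h
  obtain rfl : s' = s := by simpa using hk
  exact .id _

end Term

variable (X : CompCat.{v, u})

theorem isCart_iff_right {x y : X.Total} {f : x ⟶ y} :
    IsCart X.p f ↔ IsCart (X.χ ⋙ Arrow.rightFunc) f :=
  (IsCart.congr_functor X.χ_cod).symm

theorem isCart_exists_lift {x y z : X.Total} {f : x ⟶ y} (hf : IsCart X.p f) (g : z ⟶ y)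
    (w : (X.χ.obj z).right ⟶ (X.χ.obj x).right)
    (h : w ≫ (X.χ.map f).right = (X.χ.map g).right) :
    ∃ k : z ⟶ x, k ≫ f = g ∧ (X.χ.map k).right = w :=
  (X.isCart_iff_right.1 hf).exists_lift g w h

theorem isCart_hom_ext {x y z : X.Total} {f : x ⟶ y} (hf : IsCart X.p f) {k k' : z ⟶ x}
    (h : k ≫ f = k' ≫ f) (h' : (X.χ.map k).right = (X.χ.map k').right) : k = k' :=
  (X.isCart_iff_right.1 hf).hom_ext h h'

theorem exists_isCart {y : X.Total} {b : X.Base} (w : b ⟶ (X.χ.obj y).right) :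
    ∃ (x : X.Total) (f : x ⟶ y) (e : (X.χ.obj x).right = b), IsCart X.p f ∧
      (X.χ.map f).right = eqToHom e ≫ w := by
  obtain ⟨x, f, e, hf, hw⟩ := IsCart.exists_of_isFibered (p := X.χ ⋙ Arrow.rightFunc)
    (X.χ_cod.symm ▸ X.fibered) w
  exact ⟨x, f, e, X.isCart_iff_right.2 hf, hw⟩

namespace Term

variable {X}

/-- Over a cartesian arrow of types, every section of the target restricts to the source. -/
theorem exists_restrict {x : X.Total} {b : Term X} {f : x ⟶ b.type} (hf : IsCart X.p f) :
    ∃ (a : Term X) (e : a.type = x) (g : a ⟶ b), g.hom = eqToHom e ≫ f := by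
  have hp := X.χ_cart f hf
  have hc : ((X.χ.map f).right ≫ b.sec) ≫ (X.χ.obj b.type).hom = 𝟙 _ ≫ (X.χ.map f).right := by
    simp [b.sec_hom]
  refine ⟨⟨x, hp.lift _ _ hc, hp.lift_snd _ _ hc⟩, rfl, ⟨f, ?_⟩, by simp⟩
  exact (hp.lift_fst _ _ hc).symm

theorem isCart_right_of_isCart_hom {a b : Term X} {f : a ⟶ b} (hf : IsCart X.p f.hom) :
    IsCart (forget X ⋙ X.χ ⋙ Arrow.rightFunc) f := by
  refine IsCart.mk' (fun {c} g w h => ?_) (fun {c k k'} h h' => ?_)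
  · obtain ⟨k, hk, hk'⟩ := X.isCart_exists_lift hf g.hom w h
    refine ⟨⟨k, (X.χ_cart _ hf).hom_ext ?_ ?_⟩, hom_ext hk, hk'⟩
    · rw [Category.assoc, ← f.w, ← Arrow.comp_right_assoc, ← Functor.map_comp, hk, g.w,
        Category.assoc, ← Arrow.comp_left, ← Functor.map_comp, hk]
    · rw [Category.assoc, a.sec_hom, Category.assoc, Arrow.w, reassoc_of% c.sec_hom,
        Category.comp_id]
  · exact hom_ext (X.isCart_hom_ext hf (congrArg Hom.hom h) h')

theorem isCart_of_isCart_hom {a b : Term X} {f : a ⟶ b} (hf : IsCart X.p f.hom) :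
    IsCart (forget X ⋙ X.p) f :=
  (IsCart.congr_functor (congrArg (forget X ⋙ ·) X.χ_cod)).1 (isCart_right_of_isCart_hom hf)

theorem exists_isCart {b : Term X} {c : X.Base} (w : c ⟶ X.p.obj b.type) :
    ∃ (a : Term X) (f : a ⟶ b) (e : X.p.obj a.type = c), IsCart X.p f.hom ∧
      X.p.map f.hom = eqToHom e ≫ w := by
  obtain ⟨x, f, e, hf, hw⟩ := IsCart.exists_of_isFibered X.fibered w
  obtain ⟨a, rfl, g, hg⟩ := exists_restrict (b := b) hf
  obtain rfl : g.hom = f := by simpa using hg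
  exact ⟨a, g, e, hf, hw⟩

theorem isFibered : (forget X ⋙ X.p).IsFibered :=
  IsCart.isFibered_of_exists fun {b _} w => by
    obtain ⟨a, f, e, hf, hw⟩ := exists_isCart (b := b) w
    exact ⟨a, f, e, isCart_of_isCart_hom hf, hw⟩

/-- A cartesian arrow of terms is compared with the lift of its projection whose underlying arrow of
types is cartesian; the comparison is invertible. -/
theorem isCart_iff {a b : Term X} {f : a ⟶ b} :
    IsCart (forget X ⋙ X.p) f ↔ IsCart X.p f.hom := by
  refine ⟨fun h => ?_, isCart_of_isCart_hom⟩
  obtain ⟨x, c, e, hc, hw⟩ := exists_isCart (b := b) (X.p.map f.hom)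
  have hw' : eqToHom e.symm ≫ X.p.map c.hom = X.p.map f.hom := by
    rw [hw, eqToHom_trans_assoc, eqToHom_refl, Category.id_comp]
  obtain ⟨k, hk, hk'⟩ := (isCart_of_isCart_hom hc).exists_lift f (eqToHom e.symm) hw'
  have h₁ : IsCart (forget X ⋙ X.p) k := IsCart.of_comp (isCart_of_isCart_hom hc) (hk ▸ h)
  have h₂ : IsIso k := h₁.isIso (by rw [hk']; exact inferInstanceAs (IsIso (eqToHom e.symm)))
  have h₃ : IsIso k.hom := inferInstanceAs (IsIso ((forget X).map k))
  rw [← hk]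
  exact (IsCart.of_isIso k.hom).comp hc

end Term

/-! ### Context extension as right adjoint -/

/-- A type weakened to its own comprehension. -/
noncomputable def wk (A : X.Total) : X.Total := (X.exists_isCart (X.χ.obj A).hom).choose

/-- The cartesian arrow from the weakening of a type, over its comprehension. -/
noncomputable def wkMap (A : X.Total) : X.wk A ⟶ A :=
  (X.exists_isCart (X.χ.obj A).hom).choose_spec.choose

theorem wk_right (A : X.Total) : (X.χ.obj (X.wk A)).right = (X.χ.obj A).left :=
  (X.exists_isCart (X.χ.obj A).hom).choose_spec.choose_spec.choose

theorem isCart_wkMap (A : X.Total) : IsCart X.p (X.wkMap A) :=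
  (X.exists_isCart (X.χ.obj A).hom).choose_spec.choose_spec.choose_spec.1

theorem wkMap_right (A : X.Total) :
    (X.χ.map (X.wkMap A)).right = eqToHom (X.wk_right A) ≫ (X.χ.obj A).hom :=
  (X.exists_isCart (X.χ.obj A).hom).choose_spec.choose_spec.choose_spec.2

theorem exists_diag (A : X.Total) : ∃ d : (X.χ.obj (X.wk A)).right ⟶ (X.χ.obj (X.wk A)).left,
    d ≫ (X.χ.map (X.wkMap A)).left = eqToHom (X.wk_right A) ∧
      d ≫ (X.χ.obj (X.wk A)).hom = 𝟙 _ := by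
  have h : eqToHom (X.wk_right A) ≫ (X.χ.obj A).hom = 𝟙 _ ≫ (X.χ.map (X.wkMap A)).right := by
    rw [wkMap_right, Category.id_comp]
  exact ⟨(X.χ_cart _ (X.isCart_wkMap A)).lift _ _ h, IsPullback.lift_fst _ _ _ _,
    IsPullback.lift_snd _ _ _ _⟩

/-- The diagonal section of the weakening of a type. -/
noncomputable def diag (A : X.Total) : (X.χ.obj (X.wk A)).right ⟶ (X.χ.obj (X.wk A)).left :=
  (X.exists_diag A).choose

theorem diag_left (A : X.Total) :
    X.diag A ≫ (X.χ.map (X.wkMap A)).left = eqToHom (X.wk_right A) :=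
  (X.exists_diag A).choose_spec.1

theorem diag_hom (A : X.Total) : X.diag A ≫ (X.χ.obj (X.wk A)).hom = 𝟙 _ :=
  (X.exists_diag A).choose_spec.2

/-- The variable: the diagonal section of the weakening of a type. -/
noncomputable abbrev var (A : X.Total) : Term X := ⟨X.wk A, X.diag A, X.diag_hom A⟩

variable {X}

/-- The projection of an arrow into a variable is determined by its composite with the weakening
arrow: it is the section followed by the domain part of the comprehension of the composite. -/
theorem right_eq_of_hom_var {a : Term X} {A : X.Total} (k : a ⟶ X.var A) :
    (X.χ.map k.hom).right ≫ eqToHom (X.wk_right A) =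
      a.sec ≫ (X.χ.map (k.hom ≫ X.wkMap A)).left := by
  rw [Functor.map_comp, Arrow.comp_left, ← Category.assoc, ← k.w, Category.assoc, X.diag_left]

/-- An arrow of types `f` out of a term extends uniquely to an arrow into the variable: its
projection is forced to be the section followed by the domain part of `χ f`. -/
theorem bijective_comp_wkMap (a : Term X) (A : X.Total) :
    Function.Bijective (fun k : a ⟶ X.var A => k.hom ≫ X.wkMap A) := by
  constructor
  · intro k k' h
    refine Term.hom_ext (X.isCart_hom_ext (X.isCart_wkMap A) h ?_)
    rw [← cancel_mono (eqToHom (X.wk_right A))]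
    refine (right_eq_of_hom_var k).trans (Eq.trans ?_ (right_eq_of_hom_var k').symm)
    dsimp only at h
    rw [h]
  · intro f
    obtain ⟨k, hk, hk'⟩ := X.isCart_exists_lift (X.isCart_wkMap A) f
      (a.sec ≫ (X.χ.map f).left ≫ eqToHom (X.wk_right A).symm)
      (by simp [wkMap_right, reassoc_of% a.sec_hom])
    refine ⟨⟨k, (X.χ_cart _ (X.isCart_wkMap A)).hom_ext ?_ ?_⟩, hk⟩
    · have h : (X.χ.map k).left ≫ (X.χ.map (X.wkMap A)).left = (X.χ.map f).left := by
        rw [← Arrow.comp_left, ← Functor.map_comp, hk]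
      rw [hk', Category.assoc, Category.assoc, Category.assoc, Category.assoc, h]
      simp [X.diag_left]
    · simp [X.diag_hom, reassoc_of% a.sec_hom]

/-- Terms of type `A` over `a` correspond to arrows into the variable. -/
noncomputable def varEquiv (a : Term X) (A : X.Total) :
    ((Term.forget X).obj a ⟶ A) ≃ (a ⟶ X.var A) :=
  (Equiv.ofBijective _ (bijective_comp_wkMap a A)).symm

theorem varEquiv_symm (a : Term X) (A : X.Total) (k : a ⟶ X.var A) :
    (varEquiv a A).symm k = k.hom ≫ X.wkMap A := rfl

theorem varEquiv_naturality {a b : Term X} {A : X.Total} (f : a ⟶ b) (g : b.type ⟶ A) :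
    varEquiv a A (f.hom ≫ g) = f ≫ varEquiv b A g := by
  refine (varEquiv a A).symm.injective ?_
  rw [Equiv.symm_apply_apply]
  have h := (varEquiv b A).symm_apply_apply g
  rw [varEquiv_symm] at h
  exact (congrArg (f.hom ≫ ·) h).symm.trans (Category.assoc _ _ _).symm

variable (X) in
/-- The functor that maps a type to its variable. -/
noncomputable def varFunctor : X.Total ⥤ Term X :=
  Adjunction.rightAdjointOfEquiv (F := Term.forget X) (G_obj := X.var) varEquiv
    (fun _ _ _ => varEquiv_naturality)

variable (X) in
/-- Forgetting the section is left adjoint to taking the variable. -/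
noncomputable def varAdj : Term.forget X ⊣ X.varFunctor :=
  Adjunction.adjunctionOfEquivRight varEquiv (fun _ _ _ => varEquiv_naturality)

theorem varAdj_counit (A : X.Total) : X.varAdj.counit.app A = X.wkMap A := by
  refine Eq.trans (b := Term.Hom.hom (𝟙 (X.var A)) ≫ X.wkMap A) ?_ (Category.id_comp _)
  exact Adjunction.adjunctionOfEquivRight_counit_app _ _ _

/-- The unit is cartesian, as a section of the cartesian arrow from the weakening. -/
theorem isCart_varAdj_unit (a : Term X) : IsCart X.p (X.varAdj.unit.app a).hom := by
  refine IsCart.of_comp (X.isCart_wkMap _) ?_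
  have := X.varAdj.left_triangle_components a
  rw [varAdj_counit] at this
  exact (show (X.varAdj.unit.app a).hom ≫ X.wkMap a.type = 𝟙 a.type from this) ▸
    IsCart.of_isIso (𝟙 a.type)

/-- The generalised category with families of terms of a comprehension category. -/
noncomputable def toGCwF (X : CompCat.{v, max u v}) : GCwF.{v, max u v} where
  Base := X.Base
  Ty := X.Total
  Tm := Term X
  u := X.p
  du := Term.forget X ⋙ X.p
  fibered_u := X.fibered
  fibered_du := Term.isFibered
  Sig := Term.forget X
  Sig_fib := ⟨rfl, fun _ h => Term.isCart_iff.1 h⟩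
  Del := X.varFunctor
  adj := X.varAdj
  unit_cart a := Term.isCart_iff.2 (isCart_varAdj_unit a)
  counit_cart A := by rw [varAdj_counit]; exact X.isCart_wkMap A

end CompCat

/-! ### The 2-functor to generalised categories with families -/

namespace CompCat

section

variable {X Y Z : CompCat.{v, u}}

theorem Hom.isTransport_cod (f : Hom X Y) (e : X.Total) : IsTransport (f.cod e) :=
  map_eq_eqToHom_of_isHomLift_id (p := Arrow.rightFunc) _ (f.cod_ζ e)

instance (f : Hom X Y) (e : X.Total) : IsIso (f.cod e) := (f.isTransport_cod e).isIso

theorem Hom.dom_hom (f : Hom X Y) (e : X.Total) :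
    f.dom e ≫ (Y.χ.obj (f.total.obj e)).hom = f.base.map (X.χ.obj e).hom ≫ f.cod e :=
  Arrow.w (f.ζ.app e)

theorem Hom.dom_naturality (f : Hom X Y) {e e' : X.Total} (k : e ⟶ e') :
    f.dom e ≫ (Y.χ.map (f.total.map k)).left = f.base.map (X.χ.map k).left ≫ f.dom e' :=
  (congrArg CommaMorphism.left (f.ζ.naturality k)).symm

theorem Hom.cod_naturality (f : Hom X Y) {e e' : X.Total} (k : e ⟶ e') :
    f.cod e ≫ (Y.χ.map (f.total.map k)).right = f.base.map (X.χ.map k).right ≫ f.cod e' :=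
  (congrArg CommaMorphism.right (f.ζ.naturality k)).symm

/-- The section of `H A` induced by a section of `A`. -/
noncomputable def Hom.mapSec (f : Hom X Y) (a : Term X) :
    (Y.χ.obj (f.total.obj a.type)).right ⟶ (Y.χ.obj (f.total.obj a.type)).left :=
  inv (f.cod a.type) ≫ f.base.map a.sec ≫ f.dom a.type

theorem Hom.cod_mapSec (f : Hom X Y) (a : Term X) :
    f.cod a.type ≫ f.mapSec a = f.base.map a.sec ≫ f.dom a.type := by
  simp [mapSec]

/-- The action of a lax morphism on terms. -/
noncomputable def Hom.mapTerm (f : Hom X Y) : Term X ⥤ Term Y :=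
  Term.lift (Term.forget X ⋙ f.total) f.mapSec
    (fun a => by
      have h : f.mapSec a ≫ (Y.χ.obj (f.total.obj a.type)).hom = 𝟙 _ := by
        rw [← cancel_epi (f.cod a.type), reassoc_of% f.cod_mapSec, f.dom_hom,
          ← Functor.map_comp_assoc, a.sec_hom, CategoryTheory.Functor.map_id, Category.id_comp,
          Category.comp_id]
      exact h)
    (fun {a b} k => by
      have h : (Y.χ.map (f.total.map k.hom)).right ≫ f.mapSec b =
          f.mapSec a ≫ (Y.χ.map (f.total.map k.hom)).left := by
        rw [← cancel_epi (f.cod a.type), reassoc_of% f.cod_mapSec, reassoc_of% f.cod_naturality,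
          f.dom_naturality, f.cod_mapSec, ← Functor.map_comp_assoc, ← Functor.map_comp_assoc, k.w]
      exact h)

theorem Hom.mapTerm_id : (Hom.id X).mapTerm = 𝟭 (Term X) :=
  Term.lift_congr (H := Term.forget X) (s' := Term.sec) (hs' := Term.sec_hom)
    (w := fun k => ((Hom.id X).mapTerm.map k).w) (w' := fun k => k.w) fun a => by
      refine (cancel_epi ((Hom.id X).cod a.type)).1 ((Hom.cod_mapSec _ a).trans ?_)
      exact (Category.comp_id _).trans (Category.id_comp _).symm

theorem Hom.mapTerm_comp (f : Hom X Y) (g : Hom Y Z) :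
    (f.comp g).mapTerm = f.mapTerm ⋙ g.mapTerm :=
  Term.lift_congr (H := Term.forget X ⋙ f.total ⋙ g.total)
    (s' := fun a => g.mapSec (f.mapTerm.obj a))
    (hs' := fun a => (g.mapTerm.obj (f.mapTerm.obj a)).sec_hom)
    (w := fun k => ((f.comp g).mapTerm.map k).w)
    (w' := fun k => (g.mapTerm.map (f.mapTerm.map k)).w) fun a => by
      refine (cancel_epi ((f.comp g).cod a.type)).1 ((Hom.cod_mapSec _ a).trans ?_)
      have h : g.base.map (f.base.map a.sec) ≫ g.base.map (f.dom a.type) ≫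
          g.dom (f.total.obj a.type) =
          (g.base.map (f.cod a.type) ≫ g.cod (f.total.obj a.type)) ≫
            g.mapSec (f.mapTerm.obj a) := by
        refine Eq.trans ?_ (Category.assoc _ _ _).symm
        refine Eq.trans ?_ (congrArg (_ ≫ ·) (g.cod_mapSec (f.mapTerm.obj a))).symm
        refine Eq.trans ?_ (g.base.map_comp_assoc (f.cod a.type) (f.mapSec a) _)
        rw [f.cod_mapSec, Functor.map_comp]
        exact (Category.assoc _ _ _).symm
      exact h

theorem isFibMor_mapTerm (f : Hom X Y) :
    IsFibMor (Term.forget X ⋙ X.p) (Term.forget Y ⋙ Y.p) f.base f.mapTerm where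
  comm := congrArg (Term.forget X ⋙ ·) f.isFibMor.comm
  cart _ h := Term.isCart_iff.2 (f.isFibMor.cart _ (Term.isCart_iff.1 h))

/-- The action of a 2-cell on terms: its components on types are compatible with the sections. -/
noncomputable def Hom₂.mapTerm {f g : Hom X Y} (η : Hom₂ f g) : f.mapTerm ⟶ g.mapTerm where
  app a := ⟨η.total.app a.type, by
    have h : (Y.χ.map (η.total.app a.type)).right ≫ g.mapSec a =
        f.mapSec a ≫ (Y.χ.map (η.total.app a.type)).left := by
      have h₁ := (comm_iff.1 η.comm).1 a.type
      have h₂ := (comm_iff.1 η.comm).2 a.type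
      rw [← cancel_epi (f.cod a.type), reassoc_of% f.cod_mapSec, h₁, reassoc_of% h₂, g.cod_mapSec,
        η.base.naturality_assoc]
    exact h⟩
  naturality _ _ k := Term.hom_ext (η.total.naturality k.hom)

end

section

variable {X Y Z : CompCat.{v, max u v}}

/-- The loose morphism of generalised categories with families induced by a lax morphism. -/
noncomputable def Hom.toGCwF (f : Hom X Y) : GCwF.Hom X.toGCwF Y.toGCwF where
  base := f.base
  ty := f.total
  tm := f.mapTerm
  ty_fib := f.isFibMor
  tm_fib := isFibMor_mapTerm f
  ζ := Iso.refl (Term.forget X ⋙ f.total)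
  ζ_vert a := IsHomLift.id (f.isFibMor.obj_eq a.type)

/-- The 2-cell of generalised categories with families induced by a 2-cell of comprehension
categories. -/
noncomputable def Hom₂.toGCwF {f g : X ⟶ Y} (η : f ⟶ g) : Hom.toGCwF f ⟶ Hom.toGCwF g where
  base := η.base
  ty := η.total
  tm := Hom₂.mapTerm η
  ty_fib := η.isFibCell
  tm_fib a := isHomLift_comp_of_isHomLift (Term.forget Y) (η.isFibCell a.type)
  comm := (GCwF.comm_iff (f := Hom.toGCwF f) (g := Hom.toGCwF g)).2 fun _ =>
    (Category.comp_id _).trans (Category.id_comp _).symm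

end

end CompCat

namespace GCwF

theorem Hom.ext_app {X Y : GCwF.{v, u}} {f g : Hom X Y} (h : f.base = g.base)
    (h' : f.ty = g.ty) (h'' : f.tm = g.tm) (h''' : ∀ a, HEq (f.ζ.hom.app a) (g.ζ.hom.app a)) :
    f = g := by
  cases f; cases g; cases h; cases h'; cases h''
  congr
  exact Iso.ext (NatTrans.ext (funext fun a => eq_of_heq (h''' a)))

end GCwF

namespace CompCat

variable {X Y Z : CompCat.{v, max u v}}

theorem Hom.toGCwF_id : (Hom.id X).toGCwF = GCwF.Hom.id X.toGCwF :=
  GCwF.Hom.ext_app rfl rfl Hom.mapTerm_id fun _ => HEq.rfl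

theorem Hom.toGCwF_comp (f : Hom X Y) (g : Hom Y Z) :
    (f.comp g).toGCwF = f.toGCwF.comp g.toGCwF :=
  GCwF.Hom.ext_app rfl rfl (Hom.mapTerm_comp f g) fun _ =>
    heq_of_eq ((Category.id_comp _).trans (g.total.map_id _)).symm

/-- Two 2-cells into the terms of a comprehension category agree when they do so on types. -/
theorem toGCwF_hom₂_ext {W : GCwF.{v, max u v}} {f g : W ⟶ X.toGCwF} {η θ : f ⟶ g}
    (h : ∀ b, (GCwF.Hom₂.base η).app b = (GCwF.Hom₂.base θ).app b)
    (h' : ∀ A, (GCwF.Hom₂.ty η).app A = (GCwF.Hom₂.ty θ).app A)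
    (h'' : ∀ a, ((GCwF.Hom₂.tm η).app a).hom = ((GCwF.Hom₂.tm θ).app a).hom) : η = θ :=
  GCwF.Hom₂.ext' (NatTrans.ext (funext h)) (NatTrans.ext (funext h'))
    (NatTrans.ext (funext fun a => Term.hom_ext (h'' a)))

open Bicategory

/-- The 2-functor `E`, which maps a comprehension category to the generalised category with families
of its terms. -/
noncomputable def toGCwFFunctor : StrictPseudofunctor CompCat.{v, max u v} GCwF.{v, max u v} :=
  StrictPseudofunctor.mk''
  { obj X := X.toGCwF
    map f := Hom.toGCwF f
    map₂ η := Hom₂.toGCwF η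
    map₂_id _ := rfl
    map₂_comp _ _ := rfl
    map_id X := Hom.toGCwF_id
    map_comp f g := Hom.toGCwF_comp f g
    map₂_whisker_left {X Y Z} f g g' η := by
      have h₁ := GCwF.Structural.eqToHom (Hom.toGCwF_comp f g)
      have h₂ := GCwF.Structural.eqToHom (Hom.toGCwF_comp f g').symm
      refine toGCwF_hom₂_ext (fun b => ?_) (fun b => ?_) (fun b => ?_)
      · have h₃ := (h₁.1 b).eq_id
        have h₄ := (h₂.1 b).eq_id
        exact ((congrArg₂ (fun k l => k ≫ _ ≫ l) h₃ h₄).trans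
          ((Category.id_comp _).trans (Category.comp_id _))).symm
      · have h₃ := (h₁.2.1 b).eq_id
        have h₄ := (h₂.2.1 b).eq_id
        exact ((congrArg₂ (fun k l => k ≫ _ ≫ l) h₃ h₄).trans
          ((Category.id_comp _).trans (Category.comp_id _))).symm
      · have h₃ := (Term.isTransport_hom (h₁.2.2 b)).eq_id
        have h₄ := (Term.isTransport_hom (h₂.2.2 b)).eq_id
        exact ((congrArg₂ (fun k l => k ≫ _ ≫ l) h₃ h₄).trans
          ((Category.id_comp _).trans (Category.comp_id _))).symm
    map₂_whisker_right {X Y Z} f f' η g := by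
      have h₁ := GCwF.Structural.eqToHom (Hom.toGCwF_comp f g)
      have h₂ := GCwF.Structural.eqToHom (Hom.toGCwF_comp f' g).symm
      refine toGCwF_hom₂_ext (fun b => ?_) (fun b => ?_) (fun b => ?_)
      · have h₃ := (h₁.1 b).eq_id
        have h₄ := (h₂.1 b).eq_id
        exact ((congrArg₂ (fun k l => k ≫ _ ≫ l) h₃ h₄).trans
          ((Category.id_comp _).trans (Category.comp_id _))).symm
      · have h₃ := (h₁.2.1 b).eq_id
        have h₄ := (h₂.2.1 b).eq_id
        exact ((congrArg₂ (fun k l => k ≫ _ ≫ l) h₃ h₄).trans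
          ((Category.id_comp _).trans (Category.comp_id _))).symm
      · have h₃ := (Term.isTransport_hom (h₁.2.2 b)).eq_id
        have h₄ := (Term.isTransport_hom (h₂.2.2 b)).eq_id
        exact ((congrArg₂ (fun k l => k ≫ _ ≫ l) h₃ h₄).trans
          ((Category.id_comp _).trans (Category.comp_id _))).symm }

end CompCat

/-! ### The unit -/

namespace GCwF

section

variable {X Y : GCwF.{v, u}}

theorem sig_unit_counit (a : X.Tm) :
    X.Sig.map (X.adj.unit.app a) ≫ X.adj.counit.app (X.Sig.obj a) = 𝟙 (X.Sig.obj a) :=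
  X.adj.left_triangle_components a

theorem u_sig_unit_ext (a : X.Tm) :
    X.u.map (X.Sig.map (X.adj.unit.app a)) ≫ X.ext (X.Sig.obj a) = 𝟙 (X.u.obj (X.Sig.obj a)) := by
  rw [ext, ← Functor.map_comp, X.sig_unit_counit]
  exact X.u.map_id _

variable (X) in
/-- A term `a` as a section: the projection of `Σ η_a`. -/
def toTerm : X.Tm ⥤ CompCat.Term X.toCompCat :=
  CompCat.Term.lift (X := X.toCompCat) X.Sig
    (fun a => X.u.map (X.Sig.map (X.adj.unit.app a))) u_sig_unit_ext
    (fun {a b} f => by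
      have h : X.u.map (X.Sig.map f) ≫ X.u.map (X.Sig.map (X.adj.unit.app b)) =
          X.u.map (X.Sig.map (X.adj.unit.app a)) ≫
            X.u.map (X.Sig.map (X.Del.map (X.Sig.map f))) := by
        simp [← Functor.map_comp]
      exact h)

theorem isFibMor_toTerm :
    IsFibMor X.du (CompCat.Term.forget X.toCompCat ⋙ X.u) (𝟭 X.Base) X.toTerm where
  comm := X.sig_comp_u
  cart f hf := CompCat.Term.isCart_iff.2
    (show IsCart X.u (X.Sig.map f) from X.isCart_sig (X.isCart_du_iff.1 hf))

theorem Hom.tm_unit_mate (f : Hom X Y) (a : X.Tm) :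
    f.tm.map (X.adj.unit.app a) ≫ f.mate.app (X.Sig.obj a) =
      Y.adj.unit.app (f.tm.obj a) ≫ Y.Del.map (f.z a) := by
  refine del_hom_ext ?_
  have h₁ : Y.Sig.map (Y.Del.map (f.z a)) ≫ Y.adj.counit.app _ =
      Y.adj.counit.app (Y.Sig.obj (f.tm.obj a)) ≫ f.z a := Y.adj.counit.naturality (f.z a)
  have h₂ : Y.Sig.map (f.tm.map (X.adj.unit.app a)) ≫ f.z (X.Del.obj (X.Sig.obj a)) =
      f.z a ≫ f.ty.map (X.Sig.map (X.adj.unit.app a)) := f.z_nat _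
  calc
    _ = Y.Sig.map (f.tm.map (X.adj.unit.app a)) ≫ Y.Sig.map (f.mate.app (X.Sig.obj a)) ≫
        Y.adj.counit.app (f.ty.obj (X.Sig.obj a)) :=
      (congrArg (· ≫ _) (Y.Sig.map_comp _ _)).trans (Category.assoc _ _ _)
    _ = f.z a := by
      rw [f.sig_mate_counit, reassoc_of% h₂, ← Functor.map_comp, X.sig_unit_counit,
        CategoryTheory.Functor.map_id, Category.comp_id]
    _ = _ := by
      rw [Functor.map_comp, Category.assoc, h₁]
      exact ((reassoc_of% (Y.sig_unit_counit (f.tm.obj a))) _).symm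

theorem Hom.mapSec_toTerm (f : Hom X Y) (a : X.Tm) :
    f.toCompCat.mapSec (X.toTerm.obj a) =
      Y.u.map (f.ty.map (X.Sig.map (X.adj.unit.app a)) ≫ f.r (X.Sig.obj a)) := by
  refine (cancel_epi (f.ty_fib.cmp (X.Sig.obj a))).1 ?_
  refine (f.toCompCat.cod_mapSec (X.toTerm.obj a)).trans ?_
  have h : f.base.map (X.u.map (X.Sig.map (X.adj.unit.app a))) ≫ f.ty_fib.cmp _ ≫
      Y.u.map (f.r (X.Sig.obj a)) = f.ty_fib.cmp (X.Sig.obj a) ≫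
        Y.u.map (f.ty.map (X.Sig.map (X.adj.unit.app a)) ≫ f.r (X.Sig.obj a)) := by
    rw [Functor.map_comp, reassoc_of% f.ty_fib.cmp_naturality]
  exact h

/-- The naturality constraint of `toTerm` at a loose morphism, with components those of `ζ`. -/
noncomputable def Hom.toTermNat (f : Hom X Y) :
    f.tm ⋙ Y.toTerm ⟶ X.toTerm ⋙ f.toCompCat.mapTerm where
  app a := ⟨f.z a, by
    have h₁ : f.z a ≫ f.ty.map (X.Sig.map (X.adj.unit.app a)) ≫ f.r (X.Sig.obj a) =
        Y.Sig.map (Y.adj.unit.app (f.tm.obj a)) ≫ Y.Sig.map (Y.Del.map (f.z a)) :=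
      calc
        _ = Y.Sig.map (f.tm.map (X.adj.unit.app a)) ≫ f.z _ ≫ f.r (X.Sig.obj a) :=
          (Category.assoc _ _ _).symm.trans ((congrArg (· ≫ _)
            (f.z_nat (X.adj.unit.app a)).symm).trans (Category.assoc _ _ _))
        _ = Y.Sig.map (f.tm.map (X.adj.unit.app a) ≫ f.mate.app (X.Sig.obj a)) :=
          (congrArg (_ ≫ ·) (f.z_r _)).trans (Y.Sig.map_comp _ _).symm
        _ = _ := by rw [f.tm_unit_mate, Functor.map_comp]
    have h₂ : Y.u.map (f.z a) ≫ Y.u.map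
          (f.ty.map (X.Sig.map (X.adj.unit.app a)) ≫ f.r (X.Sig.obj a)) =
        Y.u.map (Y.Sig.map (Y.adj.unit.app (f.tm.obj a))) ≫
          Y.u.map (Y.Sig.map (Y.Del.map (f.z a))) := by
      rw [← Functor.map_comp, ← Functor.map_comp, h₁]
    exact (congrArg (Y.u.map (f.z a) ≫ ·) (f.mapSec_toTerm a)).trans h₂⟩
  naturality _ _ k := CompCat.Term.hom_ext (f.z_nat k)

end

end GCwF

theorem IsFibCell.inv {E B E' B' : Type*} [Category* E] [Category* B] [Category* E'] [Category* B']
    {p : E ⥤ B} {p' : E' ⥤ B'} {F G : B ⥤ B'} {H K : E ⥤ E'} {ψ : F ⟶ G} {φ : H ⟶ K}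
    (h : IsFibCell p p' ψ φ) [IsIso ψ] [IsIso φ] : IsFibCell p p' (inv ψ) (inv φ) := fun e => by
  have := h e
  rw [NatIso.isIso_inv_app, NatIso.isIso_inv_app]
  infer_instance

namespace GCwF

/-- A 2-cell whose components are invertible is invertible. -/
theorem Hom₂.isIso {X Y : GCwF.{v, u}} {f g : X ⟶ Y} (η : f ⟶ g) (h : IsIso (Hom₂.base η))
    (h' : IsIso (Hom₂.ty η)) (h'' : IsIso (Hom₂.tm η)) : IsIso η := by
  refine ⟨⟨Hom₂.mk (inv (Hom₂.base η)) (inv (Hom₂.ty η)) (inv (Hom₂.tm η))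
    (Hom₂.ty_fib η).inv (Hom₂.tm_fib η).inv ?_, ?_, ?_⟩⟩
  · refine comm_iff.2 fun a => ?_
    have h₁ := comm_iff.1 (Hom₂.comm η) a
    have h₂ : IsIso (Y.Sig.map ((Hom₂.tm η).app a)) := inferInstance
    rw [NatIso.isIso_inv_app, NatIso.isIso_inv_app, Functor.map_inv, IsIso.inv_comp_eq,
      reassoc_of% h₁, IsIso.hom_inv_id, Category.comp_id]
  · exact Hom₂.ext' (IsIso.hom_inv_id _) (IsIso.hom_inv_id _) (IsIso.hom_inv_id _)
  · exact Hom₂.ext' (IsIso.inv_hom_id _) (IsIso.inv_hom_id _) (IsIso.inv_hom_id _)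

variable {X Y Z : GCwF.{v, max u v}}

variable (X) in
/-- The component of the unit: the identity on types, and terms as sections. -/
def unitApp : Hom X X.toCompCat.toGCwF where
  base := 𝟭 X.Base
  ty := 𝟭 X.Ty
  tm := X.toTerm
  ty_fib := .id
  tm_fib := isFibMor_toTerm
  ζ := Iso.refl X.Sig
  ζ_vert a := IsHomLift.id (X.Sig_fib.obj_eq a)

/-- The naturality constraint of the unit: the identity on the base and on types, and `ζ` on
terms. -/
noncomputable def unitNat (f : Hom X Y) :
    f.comp Y.unitApp ⟶ X.unitApp.comp f.toCompCat.toGCwF where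
  base := 𝟙 f.base
  ty := 𝟙 f.ty
  tm := f.toTermNat
  ty_fib := .id f.ty_fib
  tm_fib := isFibCell_id_of_map_eq (f.comp Y.unitApp).tm_fib _ fun a => f.exists_u_map_z a
  comm := (comm_iff (f := f.comp Y.unitApp)
    (g := X.unitApp.comp f.toCompCat.toGCwF)).2 fun a => by
      have h : f.z a ≫ 𝟙 (f.ty.obj (X.Sig.obj a)) ≫ f.ty.map (𝟙 (X.Sig.obj a)) =
          (𝟙 (Y.Sig.obj (f.tm.obj a)) ≫ f.z a) ≫ 𝟙 (f.ty.obj (X.Sig.obj a)) := by simp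
      exact h

theorem isIso_unitNat (f : Hom X Y) : IsIso (unitNat f) := by
  refine Hom₂.isIso _ (inferInstanceAs (IsIso (𝟙 f.base))) (inferInstanceAs (IsIso (𝟙 f.ty))) ?_
  have : ∀ a, IsIso (f.toTermNat.app a) := fun a =>
    CompCat.Term.isIso_of_isIso_hom _ (inferInstanceAs (IsIso (f.z a)))
  exact NatIso.isIso_of_isIso_app f.toTermNat

theorem unitNat_structural (f : Hom X Y) (h : ∀ a, IsTransport (f.z a)) :
    Structural (unitNat f) :=
  ⟨fun _ => .id _, fun _ => .id _, fun a => CompCat.Term.isTransport_of_hom (h a)⟩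

end GCwF

theorem CompCat.Hom₂.toGCwF_structural {X Y : CompCat.{v, max u v}} {f g : X ⟶ Y} {η : f ⟶ g}
    (h : CompCat.Structural η) : GCwF.Structural (CompCat.Hom₂.toGCwF η) :=
  ⟨h.1, h.2, fun a => CompCat.Term.isTransport_of_hom (h.2 a.type)⟩

namespace GCwF

theorem Hom₂.toCompCat_structural {X Y : GCwF.{v, u}} {f g : X ⟶ Y} {η : f ⟶ g}
    (h : Structural η) : CompCat.Structural (Hom₂.toCompCat η) :=
  ⟨h.1, h.2.1⟩

theorem toCompCatFunctor_mapComp_structural {X Y Z : GCwF.{v, u}} (f : X ⟶ Y) (g : Y ⟶ Z) :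
    CompCat.Structural (toCompCatFunctor.mapComp f g).hom ∧
      CompCat.Structural (toCompCatFunctor.mapComp f g).inv :=
  ⟨CompCat.Structural.isoOfEq_hom _ (Hom.toCompCat_comp_ζ f g),
    CompCat.Structural.isoOfEq_inv _ (Hom.toCompCat_comp_ζ f g)⟩

theorem toCompCatFunctor_mapId_structural (X : GCwF.{v, u}) :
    CompCat.Structural (toCompCatFunctor.mapId X).hom :=
  CompCat.Structural.isoOfEq_hom _ Hom.toCompCat_id_ζ

end GCwF

namespace CompCat

theorem toGCwFFunctor_mapComp_structural {X Y Z : CompCat.{v, max u v}} (f : X ⟶ Y) (g : Y ⟶ Z) :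
    GCwF.Structural (toGCwFFunctor.mapComp f g).hom ∧
      GCwF.Structural (toGCwFFunctor.mapComp f g).inv :=
  ⟨GCwF.Structural.eqToIso_hom _, GCwF.Structural.eqToIso_inv _⟩

theorem toGCwFFunctor_mapId_structural (X : CompCat.{v, max u v}) :
    GCwF.Structural (toGCwFFunctor.mapId X).hom :=
  GCwF.Structural.eqToIso_hom _

end CompCat

namespace GCwF

open Bicategory

variable {X Y Z : GCwF.{v, max u v}}

/-- The composite 2-functor `E G`. -/
noncomputable abbrev monad : Pseudofunctor GCwF.{v, max u v} GCwF.{v, max u v} :=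
  toCompCatFunctor.toPseudofunctor.comp CompCat.toGCwFFunctor.toPseudofunctor

theorem monad_mapId_structural (X : GCwF.{v, max u v}) : Structural (monad.mapId X).hom :=
  .comp (CompCat.Hom₂.toGCwF_structural (toCompCatFunctor_mapId_structural X))
    (CompCat.toGCwFFunctor_mapId_structural X.toCompCat)

theorem monad_mapComp_structural (f : X ⟶ Y) (g : Y ⟶ Z) :
    Structural (monad.mapComp f g).hom :=
  .comp (CompCat.Hom₂.toGCwF_structural (toCompCatFunctor_mapComp_structural f g).1)
    (CompCat.toGCwFFunctor_mapComp_structural (Hom.toCompCat f) (Hom.toCompCat g)).1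

theorem unitNat_naturality {f g : X ⟶ Y} (η : f ⟶ g) :
    Hom₂.whiskerRight η Y.unitApp ≫ unitNat g =
      unitNat f ≫ Hom₂.whiskerLeft X.unitApp (CompCat.Hom₂.toGCwF (Hom₂.toCompCat η)) := by
  refine CompCat.toGCwF_hom₂_ext (fun b => ?_) (fun A => ?_) (fun a => ?_)
  · exact (Category.comp_id _).trans (Category.id_comp _).symm
  · exact (Category.comp_id _).trans (Category.id_comp _).symm
  · exact comm_iff.1 (Hom₂.comm η) a

theorem unitNat_comp (f : X ⟶ Y) (g : Y ⟶ Z) :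
    unitNat (Hom.comp f g) ≫ (unitApp X : X ⟶ _) ◁ (monad.mapComp f g).hom =
      (α_ f g (unitApp Z : Z ⟶ _)).hom ≫ f ◁ unitNat g ≫
        (α_ f (unitApp Y : Y ⟶ _) (monad.map g)).inv ≫ unitNat f ▷ monad.map g ≫
          (α_ (unitApp X : X ⟶ _) (monad.map f) (monad.map g)).hom := by
  have hs := (monad_mapComp_structural f g).whiskerLeft (unitApp X : X ⟶ _)
  refine CompCat.toGCwF_hom₂_ext (fun b => ?_) (fun A => ?_) (fun a => ?_)
  · exact (((IsTransport.id _).comp (hs.1 b)).eq (.comp (.id _) (.comp (.id _)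
      (.comp (.id _) (.comp (.map (Hom.base g) (.id _)) (.id _))))))
  · exact (((IsTransport.id _).comp (hs.2.1 A)).eq (.comp (.id _) (.comp (.id _)
      (.comp (.id _) (.comp (.map (Hom.ty g) (.id _)) (.id _))))))
  · have h₁ := (CompCat.Term.isTransport_hom (hs.2.2 a)).eq_id
    have h₂ : (Hom.z g ((Hom.tm f).obj a) ≫ (Hom.ty g).map (Hom.z f a)) ≫ 𝟙 _ =
        𝟙 _ ≫ Hom.z g ((Hom.tm f).obj a) ≫ 𝟙 _ ≫ (Hom.ty g).map (Hom.z f a) ≫ 𝟙 _ := by simp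
    exact (congrArg ((Hom.comp f g).z a ≫ ·) h₁).trans h₂

/-- The unit, a pseudonatural transformation from the identity to `E G`. -/
noncomputable def unit : Pseudofunctor.StrongTrans (Pseudofunctor.id GCwF.{v, max u v}) monad where
  app X := X.unitApp
  naturality f := @asIso _ _ _ _ (unitNat f) (isIso_unitNat f)
  naturality_naturality η := unitNat_naturality η
  naturality_id X := Structural.eq
    (.comp (unitNat_structural (Hom.id X) fun _ => .id _)
      (.whiskerLeft _ (monad_mapId_structural X)))
    (.comp (.whiskerRight (.id _) _) (.comp (.leftUnitor_hom _) (.rightUnitor_inv _)))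
  naturality_comp {_ _ Z} f g := by
    have h : ((Pseudofunctor.id GCwF.{v, max u v}).mapComp f g).hom ▷ (unitApp Z : Z ⟶ _) = 𝟙 _ :=
      (Structural.whiskerRight (.id _) _).eq (.id _)
    exact (unitNat_comp f g).trans ((congrArg (· ≫ _) h).trans (Category.id_comp _)).symm

end GCwF

/-! ### The counit -/

theorem Arrow.isTransport_of_left_of_right {C : Type*} [Category* C] {x y : Arrow C} (k : x ⟶ y)
    (h : IsTransport k.left) (h' : IsTransport k.right) : IsTransport k := by
  obtain ⟨x₁, x₂, x⟩ := x
  obtain ⟨y₁, y₂, y⟩ := y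
  obtain ⟨e, h⟩ := h
  obtain ⟨e', h'⟩ := h'
  obtain rfl : x₁ = y₁ := e
  obtain ⟨⟩ : x₂ = y₂ := e'
  have hk := Arrow.w k
  rw [h, h'] at hk
  obtain rfl : x = y := by simpa using hk.symm
  exact ⟨rfl, Arrow.hom_ext _ _ h h'⟩

theorem functor_eq_of_isTransport {C D : Type*} [Category* C] [Category* D] {F G : C ⥤ D}
    (φ : F ⟶ G) (h : ∀ c, IsTransport (φ.app c)) : F = G :=
  CategoryTheory.Functor.ext (fun c => (h c).choose) fun c d f => by
    obtain ⟨hc, hc'⟩ := h c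
    obtain ⟨hd, hd'⟩ := h d
    have hf : F.map f = eqToHom hc ≫ G.map f ≫ eqToHom hd.symm := by
      rw [← hc', ← φ.naturality_assoc, hd', eqToHom_trans, eqToHom_refl, Category.comp_id]
    exact hf

namespace CompCat

open Bicategory

variable {X Y Z : CompCat.{v, max u v}}

theorem p_map_eq {X : CompCat.{v, u}} {A B : X.Total} (f : A ⟶ B) :
    X.p.map f = eqToHom (X.cod_obj A).symm ≫ (X.χ.map f).right ≫ eqToHom (X.cod_obj B) :=
  CategoryTheory.Functor.congr_hom X.χ_cod.symm f

/-- The action of context extension on arrows, as an arrow between variables. -/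
noncomputable def varMap {X : CompCat.{v, u}} {A B : X.Total} (f : A ⟶ B) : X.var A ⟶ X.var B :=
  X.varFunctor.map f

theorem varMap_wkMap {X : CompCat.{v, u}} {A B : X.Total} (f : A ⟶ B) :
    (varMap f).hom ≫ X.wkMap B = X.wkMap A ≫ f :=
  (congrArg ((varMap f).hom ≫ ·) (varAdj_counit B)).symm.trans
    ((X.varAdj.counit.naturality f).trans (congrArg (· ≫ f) (varAdj_counit A)))

variable (X) in
/-- The projection of the weakening of a type is the domain of its comprehension. -/
noncomputable def counitLeft (A : X.Total) : X.p.obj (X.wk A) ⟶ (X.χ.obj A).left :=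
  eqToHom ((X.cod_obj (X.wk A)).symm.trans (X.wk_right A))

theorem counitLeft_hom (A : X.Total) : X.counitLeft A ≫ (X.χ.obj A).hom =
    X.p.map (X.wkMap A) ≫ eqToHom (X.cod_obj A).symm := by
  simp [counitLeft, p_map_eq, X.wkMap_right]

theorem counitLeft_naturality {A B : X.Total} (f : A ⟶ B) :
    X.p.map (varMap f).hom ≫ X.counitLeft B = X.counitLeft A ≫ (X.χ.map f).left := by
  have h₁ := right_eq_of_hom_var (varMap f)
  rw [varMap_wkMap, Functor.map_comp, Arrow.comp_left, reassoc_of% X.diag_left] at h₁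
  rw [counitLeft, counitLeft, p_map_eq, Category.assoc, Category.assoc, eqToHom_trans, h₁,
    eqToHom_trans_assoc]

variable (X) in
/-- The comprehension of the generalised category with families of terms is, up to transport, the
given one. -/
noncomputable def counitNat : X.toGCwF.comprehension ⟶ X.χ where
  app (A : X.Total) := Arrow.homMk (f := Arrow.mk (X.toGCwF.ext A))
    (X.counitLeft A) (eqToHom (X.cod_obj A).symm)
    ((counitLeft_hom A).trans (congrArg (X.p.map · ≫ _) (varAdj_counit A).symm))
  naturality (A B : X.Total) (f : A ⟶ B) := Arrow.hom_ext _ _ (counitLeft_naturality f) (by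
    have h : X.p.map f ≫ eqToHom (X.cod_obj B).symm =
        eqToHom (X.cod_obj A).symm ≫ (X.χ.map f).right := by simp [p_map_eq]
    exact h)

theorem isTransport_counitNat_app (A : X.Total) : IsTransport (X.counitNat.app A) :=
  Arrow.isTransport_of_left_of_right _ (show IsTransport (X.counitLeft A) from ⟨_, rfl⟩)
    (show IsTransport (eqToHom (X.cod_obj A).symm) from ⟨_, rfl⟩)

variable (X) in
/-- The comprehension is recovered on the nose: the weakening of `A` lies strictly over the domain
of the comprehension of `A`, and all comparisons are transports. -/
theorem toGCwF_comprehension : X.toGCwF.comprehension = X.χ :=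
  functor_eq_of_isTransport X.counitNat isTransport_counitNat_app

variable (X) in
/-- The component of the counit: the identity on the base and on types. -/
noncomputable def counitApp : Hom X.toGCwF.toCompCat X where
  base := 𝟭 X.Base
  total := 𝟭 X.Total
  isFibMor := .id
  ζ :=
    { app A := X.counitNat.app A
      naturality _ _ f := X.counitNat.naturality f }
  cod_ζ A := isHomLift_id_of_map_eq (p := Arrow.rightFunc) _ rfl (X.cod_obj A).symm rfl

variable (X) in
/-- The inverse of the component of the counit. -/
noncomputable def counitInvApp : Hom X X.toGCwF.toCompCat where
  base := 𝟭 X.Base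
  total := 𝟭 X.Total
  isFibMor := .id
  ζ :=
    { app A := eqToHom (Functor.congr_obj X.toGCwF_comprehension A).symm
      naturality A B f := by
        have h := Functor.congr_hom X.toGCwF_comprehension f
        have h' : X.χ.map f ≫ eqToHom (Functor.congr_obj X.toGCwF_comprehension B).symm =
            eqToHom (Functor.congr_obj X.toGCwF_comprehension A).symm ≫
              X.toGCwF.comprehension.map f := by
          rw [h, eqToHom_trans_assoc, eqToHom_refl, Category.id_comp]
          rfl
        exact h' }
  cod_ζ A := by
    obtain ⟨e, h⟩ := IsTransport.map Arrow.rightFunc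
      (k := eqToHom (Functor.congr_obj X.toGCwF_comprehension A).symm) ⟨_, rfl⟩
    exact isHomLift_id_of_map_eq (p := Arrow.rightFunc) _ (X.cod_obj A) e h

end CompCat

namespace CompCat

open Bicategory

variable {X Y Z : CompCat.{v, max u v}}

/-- The comparison of weakenings induced by a lax morphism. -/
noncomputable def Hom.wkComp (g : Hom X Y) (A : X.Total) :
    g.total.obj (X.wk A) ⟶ Y.wk (g.total.obj A) := g.toGCwF.r A

theorem Hom.wkComp_wkMap (g : Hom X Y) (A : X.Total) :
    g.wkComp A ≫ Y.wkMap (g.total.obj A) = g.total.map (X.wkMap A) :=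
  (congrArg (g.wkComp A ≫ ·) (varAdj_counit _)).symm.trans
    ((g.toGCwF.r_counit A).trans (congrArg g.total.map (varAdj_counit A)))

/-- The mate of the identity `ζ` at a type, an arrow from the image of a variable to a variable. -/
noncomputable def Hom.varComp (g : Hom X Y) (A : X.Total) :
    g.mapTerm.obj (X.var A) ⟶ Y.var (g.total.obj A) := g.toGCwF.mate.app A

theorem Hom.varComp_hom (g : Hom X Y) (A : X.Total) : (g.varComp A).hom = g.wkComp A :=
  (g.toGCwF.z_r A).symm.trans (Category.id_comp _)

theorem Hom.cod_wkComp_right (g : Hom X Y) (A : X.Total) :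
    g.cod (X.wk A) ≫ (Y.χ.map (g.wkComp A)).right ≫ eqToHom (Y.wk_right (g.total.obj A)) =
      g.base.map (eqToHom (X.wk_right A)) ≫ g.dom A := by
  have h₁ := right_eq_of_hom_var (g.varComp A)
  rw [g.varComp_hom] at h₁
  replace h₁ := h₁.trans (congrArg (fun k => g.mapSec (X.var A) ≫ (Y.χ.map k).left)
    (g.wkComp_wkMap A))
  refine (congrArg (g.cod (X.wk A) ≫ ·) h₁).trans ?_
  refine ((reassoc_of% (g.cod_mapSec (X.var A))) _).trans ?_
  rw [g.dom_naturality, ← Functor.map_comp_assoc, X.diag_left]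

theorem Hom.cmp_cod (g : Hom X Y) (A : X.Total) :
    g.isFibMor.cmp A ≫ eqToHom (Y.cod_obj (g.total.obj A)).symm =
      g.base.map (eqToHom (X.cod_obj A).symm) ≫ g.cod A :=
  IsTransport.eq (.comp ⟨_, rfl⟩ ⟨_, rfl⟩) (.comp (.map _ ⟨_, rfl⟩) (g.isTransport_cod A))

theorem Hom.cmp_wkComp_counitLeft (g : Hom X Y) (A : X.Total) :
    (g.isFibMor.cmp (X.wk A) ≫ Y.p.map (g.wkComp A)) ≫ Y.counitLeft (g.total.obj A) =
      g.base.map (X.counitLeft A) ≫ g.dom A := by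
  have h₁ := g.cmp_cod (X.wk A)
  have h₂ := g.cod_wkComp_right A
  have h₃ : X.counitLeft A = eqToHom (X.cod_obj (X.wk A)).symm ≫ eqToHom (X.wk_right A) := by
    simp [counitLeft]
  rw [h₃, Functor.map_comp, Category.assoc, Category.assoc, ← h₂, ← reassoc_of% h₁, p_map_eq,
    counitLeft]
  simp

/-- The counit is strictly natural: on domains, the comparison of weakenings recovers `ζ`, since the
image of the diagonal section of `A` is the diagonal followed by the domain part of `ζ`. -/
theorem counit_naturality (g : Hom X Y) :
    g.toGCwF.toCompCat.comp Y.counitApp = X.counitApp.comp g :=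
  Hom.ext' rfl rfl (heq_of_eq (NatTrans.ext (funext fun (A : X.Total) =>
    Arrow.hom_ext _ _ (g.cmp_wkComp_counitLeft A) (g.cmp_cod A))))

/-- The composite 2-functor `G E`. -/
noncomputable abbrev comonad : Pseudofunctor CompCat.{v, max u v} CompCat.{v, max u v} :=
  toGCwFFunctor.toPseudofunctor.comp GCwF.toCompCatFunctor.toPseudofunctor

theorem comonad_mapId_structural (X : CompCat.{v, max u v}) : Structural (comonad.mapId X).hom :=
  .comp (GCwF.Hom₂.toCompCat_structural (toGCwFFunctor_mapId_structural X))
    (GCwF.toCompCatFunctor_mapId_structural X.toGCwF)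

theorem comonad_mapComp_structural (f : X ⟶ Y) (g : Y ⟶ Z) :
    Structural (comonad.mapComp f g).hom :=
  .comp (GCwF.Hom₂.toCompCat_structural (toGCwFFunctor_mapComp_structural f g).1)
    (GCwF.toCompCatFunctor_mapComp_structural (Hom.toGCwF f) (Hom.toGCwF g)).1

/-- The counit, a strictly natural transformation from `G E` to the identity. -/
noncomputable def counit : Pseudofunctor.StrongTrans comonad
    (Pseudofunctor.id CompCat.{v, max u v}) where
  app X := X.counitApp
  naturality f := eqToIso (counit_naturality f)
  naturality_naturality {X Y f g} η := by
    have h₁ := Structural.eqToIso_hom (counit_naturality f)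
    have h₂ := Structural.eqToIso_hom (counit_naturality g)
    refine Hom₂.ext' (NatTrans.ext (funext fun b => ?_)) (NatTrans.ext (funext fun A => ?_))
    · exact ((congrArg (_ ≫ ·) (h₂.1 b).eq_id).trans (Category.comp_id _)).trans
        ((congrArg (· ≫ _) (h₁.1 b).eq_id).trans (Category.id_comp _)).symm
    · exact ((congrArg (_ ≫ ·) (h₂.2 A).eq_id).trans (Category.comp_id _)).trans
        ((congrArg (· ≫ _) (h₁.2 A).eq_id).trans (Category.id_comp _)).symm
  naturality_id X := Structural.eq
    (.comp (.eqToIso_hom (counit_naturality (Hom.id X))) (.whiskerLeft _ (.id _)))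
    (.comp (.whiskerRight (comonad_mapId_structural X) _)
      (.comp (.leftUnitor_hom _) (.rightUnitor_inv _)))
  naturality_comp f g := Structural.eq
    (.comp (.eqToIso_hom (counit_naturality (Hom.comp f g))) (.whiskerLeft _ (.id _)))
    (.comp (.whiskerRight (comonad_mapComp_structural f g) _) <| .comp (.associator_hom _ _ _) <|
      .comp (.whiskerLeft _ (.eqToIso_hom (counit_naturality g))) <|
      .comp (.associator_inv _ _ _) <|
      .comp (.whiskerRight (.eqToIso_hom (counit_naturality f)) _) (.associator_hom _ _ _))

theorem isTransport_counitInvApp (A : X.Total) : IsTransport (X.counitInvApp.ζ.app A) :=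
  ⟨(Functor.congr_obj X.toGCwF_comprehension A).symm, rfl⟩

theorem counitApp_comp_counitInvApp (X : CompCat.{v, max u v}) :
    X.counitApp.comp X.counitInvApp = Hom.id X.toGCwF.toCompCat :=
  Hom.ext' rfl rfl (heq_of_eq (NatTrans.ext (funext fun (A : X.Total) =>
    (((isTransport_counitNat_app A).map (𝟭 X.Base).mapArrow).comp
      (isTransport_counitInvApp A)).eq (.id _))))

theorem counitInvApp_comp_counitApp (X : CompCat.{v, max u v}) :
    X.counitInvApp.comp X.counitApp = Hom.id X :=
  Hom.ext' rfl rfl (heq_of_eq (NatTrans.ext (funext fun (A : X.Total) =>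
    (((isTransport_counitInvApp A).map (𝟭 X.Base).mapArrow).comp
      (isTransport_counitNat_app A)).eq (.id _))))

theorem counitApp_equiv (X : CompCat.{v, max u v}) :
    IsEquivCell (A := CompCat.{v, max u v}) X.counitApp :=
  ⟨X.counitInvApp, ⟨eqToIso (counitApp_comp_counitInvApp X).symm⟩,
    ⟨eqToIso (counitInvApp_comp_counitApp X)⟩⟩

/-! ### The composite `G E` -/

/-- Replacing the comprehension of `X` by an equal functor gives an equal comprehension category. -/
theorem eq_of_comprehension_eq (X : CompCat.{v, u}) (χ' : X.Total ⥤ Arrow X.Base) (h : χ' = X.χ)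
    (hc : χ' ⋙ Arrow.rightFunc = X.p) (hp) :
    (⟨X.Base, X.Total, X.p, X.fibered, χ', hc, hp⟩ : CompCat.{v, u}) = X := by
  subst h; rfl

/-- A morphism that changes only the comprehension, along an equality of functors, is the identity
up to transport. -/
theorem heq_id_of_comprehension_eq (X : CompCat.{v, u}) (χ' : X.Total ⥤ Arrow X.Base)
    (h : χ' = X.χ) (hc : χ' ⋙ Arrow.rightFunc = X.p) (hp)
    (φ : Hom ⟨X.Base, X.Total, X.p, X.fibered, χ', hc, hp⟩ X)
    (hb : φ.base = 𝟭 X.Base) (ht : φ.total = 𝟭 X.Total)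
    (hφ : ∀ A, IsTransport (φ.ζ.app A)) : HEq φ (Hom.id X) := by
  subst h
  obtain ⟨B, T, hf, ζ, hζ⟩ := φ
  dsimp at hb ht
  subst hb ht
  refine heq_of_eq (Hom.ext' rfl rfl (heq_of_eq (NatTrans.ext (funext fun A => ?_))))
  exact (hφ A).eq (.id _)

theorem toGCwF_toCompCat (X : CompCat.{v, max u v}) : X.toGCwF.toCompCat = X :=
  eq_of_comprehension_eq X _ X.toGCwF_comprehension rfl _

theorem counitApp_heq (X : CompCat.{v, max u v}) : HEq X.counitApp (Hom.id X) :=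
  heq_id_of_comprehension_eq X _ X.toGCwF_comprehension rfl _ X.counitApp rfl rfl
    (isTransport_counitNat_app (X := X))

/-- Two morphisms are equal up to transport when they are related by a strictly commuting square
whose other sides are identities up to transport. -/
theorem heq_of_comp_heq_id {X X' Y Y' : CompCat.{v, u}} (hX : X' = X) (hY : Y' = Y)
    {i : Hom X' X} {j : Hom Y' Y} (hi : HEq i (Hom.id X)) (hj : HEq j (Hom.id Y))
    {f' : Hom X' Y'} {f : Hom X Y} (h : f'.comp j = i.comp f) : HEq f' f := by
  subst hX hY
  obtain rfl := eq_of_heq hi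
  obtain rfl := eq_of_heq hj
  rw [Hom.comp_id', Hom.id_comp'] at h
  exact heq_of_eq h

theorem Hom.toGCwF_toCompCat_heq (g : Hom X Y) : HEq g.toGCwF.toCompCat g :=
  heq_of_comp_heq_id (toGCwF_toCompCat X) (toGCwF_toCompCat Y) (counitApp_heq X) (counitApp_heq Y)
    (counit_naturality g)

theorem Hom₂.heq_of_heq {X X' Y Y' : CompCat.{v, u}} (hX : X' = X) (hY : Y' = Y)
    {f' g' : Hom X' Y'} {f g : Hom X Y} (hf : HEq f' f) (hg : HEq g' g) {η' : Hom₂ f' g'}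
    {η : Hom₂ f g} (hb : HEq η'.base η.base) (ht : HEq η'.total η.total) : HEq η' η := by
  subst hX hY
  obtain rfl := eq_of_heq hf
  obtain rfl := eq_of_heq hg
  exact heq_of_eq (Hom₂.ext' (eq_of_heq hb) (eq_of_heq ht))

theorem Hom₂.toGCwF_toCompCat_heq {f g : X ⟶ Y} (η : f ⟶ g) :
    HEq (GCwF.Hom₂.toCompCat (Hom₂.toGCwF η)) η :=
  Hom₂.heq_of_heq (toGCwF_toCompCat X) (toGCwF_toCompCat Y) (Hom.toGCwF_toCompCat_heq f)
    (Hom.toGCwF_toCompCat_heq g) HEq.rfl HEq.rfl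

end CompCat

section StrictPseudofunctor

open Bicategory

universe w₁ w₂ v₁ v₂ u₁ u₂

variable {B : Type u₁} [Bicategory.{w₁, v₁} B] {C : Type u₂} [Bicategory.{w₂, v₂} C]

/-- Strict pseudofunctors are equal when they agree on cells of all dimensions; their constraints
are then equal, being transports. -/
theorem StrictPseudofunctor.hext {F G : StrictPseudofunctor B C}
    (h : ∀ a, F.obj a = G.obj a) (h' : ∀ {a b : B} (f : a ⟶ b), HEq (F.map f) (G.map f))
    (h'' : ∀ {a b : B} {f g : a ⟶ b} (η : f ⟶ g), HEq (F.map₂ η) (G.map₂ η)) : F = G := by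
  obtain ⟨⟨⟨⟨⟨⟨Fobj, Fmap⟩, Fmap₂⟩, _, _⟩, FmapId, FmapComp, _, _, _, _, _⟩, Fid, Fid'⟩, Fc, Fc'⟩ :=
    F
  obtain ⟨⟨⟨⟨⟨⟨Gobj, Gmap⟩, Gmap₂⟩, _, _⟩, GmapId, GmapComp, _, _, _, _, _⟩, Gid, Gid'⟩, Gc, Gc'⟩ :=
    G
  dsimp only at h h' h'' Fid Fid' Fc Fc' Gid Gid' Gc Gc'
  obtain rfl : Fobj = Gobj := funext h
  obtain rfl : @Fmap = @Gmap := by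
    funext a b f; exact eq_of_heq (h' f)
  obtain rfl : @Fmap₂ = @Gmap₂ := by
    funext a b f g η; exact eq_of_heq (h'' η)
  obtain rfl : FmapId = GmapId := by
    funext a; exact (Fid' a).trans (Gid' a).symm
  obtain rfl : @FmapComp = @GmapComp := by
    funext a b c f g; exact (Fc' f g).trans (Gc' f g).symm
  rfl

end StrictPseudofunctor

/-! ### The unit is an equivalence -/

namespace GCwF

section Realize

variable {X : GCwF.{v, u}}

/-- The type of a section, as an object of the category of types. -/
def secTy (t : CompCat.Term X.toCompCat) : X.Ty := t.type

/-- A section, as an arrow of the base. -/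
def secMap (t : CompCat.Term X.toCompCat) :
    X.u.obj (secTy t) ⟶ X.u.obj (X.Sig.obj (X.Del.obj (secTy t))) := t.sec

theorem secMap_ext (t : CompCat.Term X.toCompCat) :
    secMap t ≫ X.ext (secTy t) = 𝟙 (X.u.obj (secTy t)) := t.sec_hom

/-- The morphism of types underlying a morphism of sections. -/
def secHom {s t : CompCat.Term X.toCompCat} (f : s ⟶ t) : secTy s ⟶ secTy t := f.hom

theorem exists_realize (t : CompCat.Term X.toCompCat) :
    ∃ (a : X.Tm) (c : a ⟶ X.Del.obj (secTy t)) (e : X.u.obj (X.Sig.obj a) = X.u.obj (secTy t)),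
      IsCart (X.Sig ⋙ X.u) c ∧ X.u.map (X.Sig.map c) = eqToHom e ≫ secMap t :=
  X.exists_isCart_tm (a := X.Del.obj (secTy t)) (secMap t)

/-- A term with a given section: the reindexing of the variable `Δ A` along the section. -/
noncomputable def realize (t : CompCat.Term X.toCompCat) : X.Tm := (exists_realize t).choose

/-- The cartesian arrow from a term to the variable, over the section. -/
noncomputable def realizeMap (t : CompCat.Term X.toCompCat) : realize t ⟶ X.Del.obj (secTy t) :=
  (exists_realize t).choose_spec.choose

theorem u_sig_realize (t : CompCat.Term X.toCompCat) :
    X.u.obj (X.Sig.obj (realize t)) = X.u.obj (secTy t) :=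
  (exists_realize t).choose_spec.choose_spec.choose

theorem isCart_realizeMap (t : CompCat.Term X.toCompCat) :
    IsCart (X.Sig ⋙ X.u) (realizeMap t) :=
  (exists_realize t).choose_spec.choose_spec.choose_spec.1

theorem u_sig_realizeMap (t : CompCat.Term X.toCompCat) :
    X.u.map (X.Sig.map (realizeMap t)) = eqToHom (u_sig_realize t) ≫ secMap t :=
  (exists_realize t).choose_spec.choose_spec.choose_spec.2

/-- The comparison of the type of the realization of a section with the given type. -/
noncomputable def realizeTy (t : CompCat.Term X.toCompCat) : X.Sig.obj (realize t) ⟶ secTy t :=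
  X.Sig.map (realizeMap t) ≫ X.adj.counit.app (secTy t)

theorem u_realizeTy (t : CompCat.Term X.toCompCat) :
    X.u.map (realizeTy t) = eqToHom (u_sig_realize t) := by
  have h : (eqToHom (u_sig_realize t) ≫ secMap t) ≫ X.ext (secTy t) = eqToHom (u_sig_realize t) :=
    (Category.assoc _ _ _).trans ((congrArg (_ ≫ ·) (secMap_ext t)).trans (Category.comp_id _))
  rw [← u_sig_realizeMap] at h
  exact (X.u.map_comp _ _).trans h

/-- The comparison is the composite of two cartesian arrows, and lies over an identity because the
given arrow is a section. -/
theorem isIso_realizeTy (t : CompCat.Term X.toCompCat) : IsIso (realizeTy t) :=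
  ((X.isCart_sig (isCart_realizeMap t)).comp (X.counit_cart (secTy t))).isIso
    (IsTransport.isIso ⟨_, u_realizeTy t⟩)

attribute [instance] isIso_realizeTy

instance (t : CompCat.Term X.toCompCat) : Mono (realizeMap t) where
  right_cancellation k k' h := by
    refine (isCart_realizeMap t).hom_ext h ?_
    have h' : X.Sig.map k = X.Sig.map k' := by
      rw [← cancel_mono (realizeTy t), realizeTy, ← Category.assoc, ← Category.assoc,
        ← Functor.map_comp, ← Functor.map_comp, h]
    exact congrArg X.u.map h'

theorem unit_del_realizeTy (t : CompCat.Term X.toCompCat) :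
    X.adj.unit.app (realize t) ≫ X.Del.map (realizeTy t) = realizeMap t := by
  refine del_hom_ext ?_
  have h : X.Sig.map (X.Del.map (realizeTy t)) ≫ X.adj.counit.app (secTy t) =
      X.adj.counit.app (X.Sig.obj (realize t)) ≫ realizeTy t := X.adj.counit.naturality _
  rw [Functor.map_comp, Category.assoc, h]
  exact (reassoc_of% (X.sig_unit_counit (realize t))) _

theorem exists_realize_hom {s t : CompCat.Term X.toCompCat} (f : s ⟶ t) :
    ∃ k : realize s ⟶ realize t, k ≫ realizeMap t = realizeMap s ≫ X.Del.map (secHom f) := by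
  have h₁ : X.u.map (secHom f) ≫ secMap t =
      secMap s ≫ X.u.map (X.Sig.map (X.Del.map (secHom f))) := f.w
  obtain ⟨k, hk, -⟩ := (isCart_realizeMap t).exists_lift (realizeMap s ≫ X.Del.map (secHom f))
    (eqToHom (u_sig_realize s) ≫ X.u.map (secHom f) ≫ eqToHom (u_sig_realize t).symm) (by
      have h : (eqToHom (u_sig_realize s) ≫ X.u.map (secHom f) ≫ eqToHom (u_sig_realize t).symm) ≫
          X.u.map (X.Sig.map (realizeMap t)) =
            X.u.map (X.Sig.map (realizeMap s ≫ X.Del.map (secHom f))) := by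
        rw [Functor.map_comp, Functor.map_comp, u_sig_realizeMap, u_sig_realizeMap, Category.assoc,
          Category.assoc, eqToHom_trans_assoc, eqToHom_refl, Category.id_comp, Category.assoc]
        exact congrArg (_ ≫ ·) h₁
      exact h)
  exact ⟨k, hk⟩

/-- The action of realization on arrows. -/
noncomputable def realizeHom {s t : CompCat.Term X.toCompCat} (f : s ⟶ t) :
    realize s ⟶ realize t := (exists_realize_hom f).choose

theorem realizeHom_realizeMap {s t : CompCat.Term X.toCompCat} (f : s ⟶ t) :
    realizeHom f ≫ realizeMap t = realizeMap s ≫ X.Del.map (secHom f) :=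
  (exists_realize_hom f).choose_spec

theorem sig_realizeHom_realizeTy {s t : CompCat.Term X.toCompCat} (f : s ⟶ t) :
    X.Sig.map (realizeHom f) ≫ realizeTy t = realizeTy s ≫ secHom f := by
  have h : X.Sig.map (X.Del.map (secHom f)) ≫ X.adj.counit.app (secTy t) =
      X.adj.counit.app (secTy s) ≫ secHom f := X.adj.counit.naturality (secHom f)
  rw [realizeTy, realizeTy, Category.assoc, ← h, ← Functor.map_comp_assoc, realizeHom_realizeMap,
    Functor.map_comp_assoc]

variable (X) in
/-- The functor that realizes sections as terms. -/
noncomputable def realizeFunctor : CompCat.Term X.toCompCat ⥤ X.Tm where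
  obj := realize
  map := realizeHom
  map_id t := by
    rw [← cancel_mono (realizeMap t), realizeHom_realizeMap]
    exact (congrArg (_ ≫ ·) (X.Del.map_id _)).trans
      ((Category.comp_id _).trans (Category.id_comp _).symm)
  map_comp {r s t} f g := by
    rw [← cancel_mono (realizeMap t), realizeHom_realizeMap, Category.assoc, realizeHom_realizeMap,
      reassoc_of% realizeHom_realizeMap]
    exact congrArg (_ ≫ ·) (X.Del.map_comp (secHom f) (secHom g))

variable (X) in
/-- The type of a realization is the given one. -/
noncomputable def realizeTyIso :
    X.realizeFunctor ⋙ X.Sig ≅ CompCat.Term.forget X.toCompCat :=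
  NatIso.ofComponents (fun t => @asIso _ _ _ _ (realizeTy t) (isIso_realizeTy t))
    fun f => sig_realizeHom_realizeTy f

theorem realizeFunctor_comm :
    X.realizeFunctor ⋙ X.Sig ⋙ X.u = CompCat.Term.forget X.toCompCat ⋙ X.u :=
  functor_eq_of_isTransport (Functor.whiskerRight X.realizeTyIso.hom X.u)
    fun t => ⟨u_sig_realize t, u_realizeTy t⟩

theorem isFibMor_realizeFunctor :
    IsFibMor (CompCat.Term.forget X.toCompCat ⋙ X.u) X.du (𝟭 X.Base) X.realizeFunctor where
  comm := (congrArg (X.realizeFunctor ⋙ ·) X.sig_comp_u.symm).trans realizeFunctor_comm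
  cart {s t} f hf := by
    refine X.isCart_du_iff.2 (X.isCart_of_isCart_sig ?_)
    refine IsCart.of_comp (IsCart.of_isIso (realizeTy t)) ?_
    refine (sig_realizeHom_realizeTy f).symm ▸ (IsCart.of_isIso (realizeTy s)).comp ?_
    exact CompCat.Term.isCart_iff.1 hf

/-- The unit `η_a` is a cartesian arrow into the variable over the section of `a`, so that it
factors through the realization of this section by a vertical isomorphism. -/
theorem exists_toRealize (a : X.Tm) : ∃ k : a ⟶ realize (X.toTerm.obj a),
    k ≫ realizeMap (X.toTerm.obj a) = X.adj.unit.app a ∧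
      X.u.map (X.Sig.map k) = eqToHom (u_sig_realize (X.toTerm.obj a)).symm := by
  refine (isCart_realizeMap (X.toTerm.obj a)).exists_lift (X.adj.unit.app a) _ ?_
  refine (congrArg (_ ≫ ·) (u_sig_realizeMap (X.toTerm.obj a))).trans ?_
  have h : eqToHom (u_sig_realize (X.toTerm.obj a)).symm ≫
      eqToHom (u_sig_realize (X.toTerm.obj a)) ≫ secMap (X.toTerm.obj a) =
        secMap (X.toTerm.obj a) := by simp
  exact h

/-- The comparison of a term with the realization of its section. -/
noncomputable def toRealize (a : X.Tm) : a ⟶ realize (X.toTerm.obj a) :=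
  (exists_toRealize a).choose

theorem toRealize_realizeMap (a : X.Tm) :
    toRealize a ≫ realizeMap (X.toTerm.obj a) = X.adj.unit.app a :=
  (exists_toRealize a).choose_spec.1

theorem u_sig_toRealize (a : X.Tm) :
    X.u.map (X.Sig.map (toRealize a)) = eqToHom (u_sig_realize (X.toTerm.obj a)).symm :=
  (exists_toRealize a).choose_spec.2

instance (a : X.Tm) : IsIso (toRealize a) :=
  (IsCart.of_comp (isCart_realizeMap _) (toRealize_realizeMap a ▸ X.isCart_unit a)).isIso
    (IsTransport.isIso ⟨_, u_sig_toRealize a⟩)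

theorem sig_toRealize_realizeTy (a : X.Tm) :
    X.Sig.map (toRealize a) ≫ realizeTy (X.toTerm.obj a) = 𝟙 (X.Sig.obj a) :=
  (Category.assoc _ _ _).symm.trans ((congrArg (· ≫ X.adj.counit.app (X.Sig.obj a))
    ((X.Sig.map_comp _ _).symm.trans (congrArg X.Sig.map (toRealize_realizeMap a)))).trans
      (X.sig_unit_counit a))

variable (X) in
/-- The unit of the equivalence between terms and sections. -/
noncomputable def toRealizeNat : 𝟭 X.Tm ⟶ X.toTerm ⋙ X.realizeFunctor where
  app a := toRealize a
  naturality a b f := by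
    refine (cancel_mono (realizeMap (X.toTerm.obj b))).1 ?_
    have h : f ≫ toRealize b ≫ realizeMap (X.toTerm.obj b) =
        toRealize a ≫ realizeHom (X.toTerm.map f) ≫ realizeMap (X.toTerm.obj b) := by
      rw [toRealize_realizeMap, realizeHom_realizeMap]
      refine (X.adj.unit.naturality f).trans ?_
      exact (congrArg (· ≫ _) (toRealize_realizeMap a)).symm.trans (Category.assoc _ _ _)
    exact (Category.assoc _ _ _).trans (h.trans (Category.assoc _ _ _).symm)

variable (X) in
/-- The counit of the equivalence between terms and sections. -/
noncomputable def ofRealizeNat :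
    X.realizeFunctor ⋙ X.toTerm ⟶ 𝟭 (CompCat.Term X.toCompCat) where
  app t := ⟨realizeTy t, by
    have h : X.u.map (realizeTy t) ≫ secMap t =
        X.u.map (X.Sig.map (X.adj.unit.app (realize t))) ≫
          X.u.map (X.Sig.map (X.Del.map (realizeTy t))) := by
      rw [← Functor.map_comp, ← Functor.map_comp, unit_del_realizeTy, u_sig_realizeMap,
        u_realizeTy]
    exact h⟩
  naturality _ _ f := CompCat.Term.hom_ext (sig_realizeHom_realizeTy f)

theorem isIso_ofRealizeNat : IsIso X.ofRealizeNat := by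
  have : ∀ t, IsIso (X.ofRealizeNat.app t) := fun t =>
    CompCat.Term.isIso_of_isIso_hom _ (inferInstanceAs (IsIso (realizeTy t)))
  exact NatIso.isIso_of_isIso_app _

theorem isIso_toRealizeNat : IsIso X.toRealizeNat := by
  have : ∀ a, IsIso (X.toRealizeNat.app a) := fun a => inferInstanceAs (IsIso (toRealize a))
  exact NatIso.isIso_of_isIso_app _

end Realize

variable {X Y Z : GCwF.{v, max u v}}

variable (X) in
/-- The quasi-inverse of the component of the unit: sections are realized as terms. -/
noncomputable def unitInvApp : Hom X.toCompCat.toGCwF X where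
  base := 𝟭 X.Base
  ty := 𝟭 X.Ty
  tm := X.realizeFunctor
  ty_fib := .id
  tm_fib := isFibMor_realizeFunctor
  ζ := X.realizeTyIso
  ζ_vert t := isHomLift_id_of_map_eq _ (u_sig_realize t) (u_sig_realize t) (u_realizeTy t)

variable (X) in
/-- The 2-cell from the identity to the composite of the unit with its quasi-inverse. -/
noncomputable def unitEquivUnit : Hom.id X ⟶ X.unitApp.comp X.unitInvApp where
  base := 𝟙 (𝟭 X.Base)
  ty := 𝟙 (𝟭 X.Ty)
  tm := X.toRealizeNat
  ty_fib := .id .id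
  tm_fib := isFibCell_id_of_map_eq .id _ fun a =>
    IsTransport.map_congr X.sig_comp_u (k := toRealize a) ⟨_, u_sig_toRealize a⟩
  comm := (comm_iff (f := Hom.id X) (g := X.unitApp.comp X.unitInvApp)).2 fun a => by
    refine (congrArg (X.Sig.map (toRealize a) ≫ ·)
      (Category.comp_id (realizeTy (X.toTerm.obj a)))).trans ?_
    exact (sig_toRealize_realizeTy a).trans (Category.id_comp (𝟙 (X.Sig.obj a))).symm

variable (X) in
/-- The 2-cell from the composite of the quasi-inverse of the unit with the unit to the identity. -/
noncomputable def unitEquivCounit :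
    X.unitInvApp.comp X.unitApp ⟶ Hom.id X.toCompCat.toGCwF where
  base := 𝟙 (𝟭 X.Base)
  ty := 𝟙 (𝟭 X.Ty)
  tm := X.ofRealizeNat
  ty_fib := .id .id
  tm_fib := isFibCell_id_of_map_eq (X.unitInvApp.comp X.unitApp).tm_fib _ fun t =>
    ⟨u_sig_realize t, u_realizeTy t⟩
  comm := (comm_iff (f := X.unitInvApp.comp X.unitApp) (g := Hom.id X.toCompCat.toGCwF)).2
    fun t => (congrArg (· ≫ 𝟙 (secTy t)) (Category.id_comp (realizeTy t))).symm

/-- Realizing the section of a term gives the term back, up to an invertible 2-cell. -/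
noncomputable def unitEquivUnitIso (X : GCwF.{v, max u v}) :
    Hom.id X ≅ X.unitApp.comp X.unitInvApp :=
  @asIso _ _ _ _ X.unitEquivUnit (Hom₂.isIso _ (inferInstanceAs (IsIso (𝟙 (𝟭 X.Base))))
    (inferInstanceAs (IsIso (𝟙 (𝟭 X.Ty)))) isIso_toRealizeNat)

/-- The section of a realization is the given one, up to an invertible 2-cell. -/
noncomputable def unitEquivCounitIso (X : GCwF.{v, max u v}) :
    X.unitInvApp.comp X.unitApp ≅ Hom.id X.toCompCat.toGCwF :=
  @asIso _ _ _ _ X.unitEquivCounit (Hom₂.isIso _ (inferInstanceAs (IsIso (𝟙 (𝟭 X.Base))))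
    (inferInstanceAs (IsIso (𝟙 (𝟭 X.Ty)))) isIso_ofRealizeNat)

theorem unitApp_equiv (X : GCwF.{v, max u v}) : IsEquivCell (A := GCwF.{v, max u v}) X.unitApp :=
  ⟨X.unitInvApp, ⟨X.unitEquivUnitIso⟩, ⟨X.unitEquivCounitIso⟩⟩

end GCwF

/-! ### The triangle identities -/

namespace GCwF

variable {X : GCwF.{v, max u v}}

/-- The mate of the identity `ζ` of the unit at a type, an arrow between variables. -/
noncomputable def unitVar (A : X.Ty) : X.toTerm.obj (X.Del.obj A) ⟶ X.toCompCat.var A :=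
  X.unitApp.mate.app A

/-- The comparison of weakenings induced by the unit. -/
noncomputable def unitWk (A : X.Ty) : X.Sig.obj (X.Del.obj A) ⟶ X.toCompCat.wk A :=
  X.unitApp.r A

theorem unitVar_hom (A : X.Ty) : (unitVar A).hom = unitWk A :=
  (X.unitApp.z_r A).symm.trans (Category.id_comp _)

theorem unitWk_wkMap (A : X.Ty) : unitWk A ≫ X.toCompCat.wkMap A = X.adj.counit.app A :=
  (congrArg (unitWk A ≫ ·) (CompCat.varAdj_counit _)).symm.trans (X.unitApp.r_counit A)

/-- The comparison of weakenings induced by the unit is inverse to the counit. -/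
theorem u_unitWk_counitLeft (A : X.Ty) : X.u.map (unitWk A) ≫ X.toCompCat.counitLeft A =
    𝟙 (X.u.obj (X.Sig.obj (X.Del.obj A))) := by
  have h₁ := CompCat.right_eq_of_hom_var (unitVar A)
  rw [unitVar_hom] at h₁
  refine h₁.trans ?_
  refine (congrArg (fun k => (X.toTerm.obj (X.Del.obj A)).sec ≫ (X.toCompCat.χ.map k).left)
    (unitWk_wkMap A)).trans ?_
  have h₂ : X.u.map (X.Sig.map (X.adj.unit.app (X.Del.obj A))) ≫
      X.u.map (X.Sig.map (X.Del.map (X.adj.counit.app A))) = 𝟙 _ := by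
    rw [← Functor.map_comp, ← Functor.map_comp, X.adj.right_triangle_components]
    exact (congrArg X.u.map (X.Sig.map_id _)).trans (X.u.map_id _)
  exact h₂

theorem unitApp_dom_counitLeft (A : X.Ty) :
    X.unitApp.toCompCat.dom A ≫ X.toCompCat.counitLeft A =
      𝟙 (X.u.obj (X.Sig.obj (X.Del.obj A))) :=
  (Category.assoc _ _ _).trans ((Category.id_comp _).trans (u_unitWk_counitLeft A))

theorem leftTriangle (X : GCwF.{v, max u v}) :
    X.unitApp.toCompCat.comp X.toCompCat.counitApp = CompCat.Hom.id X.toCompCat :=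
  CompCat.Hom.ext' rfl rfl (heq_of_eq (NatTrans.ext (funext fun (A : X.Ty) =>
    Arrow.hom_ext _ _ (unitApp_dom_counitLeft A)
      (Category.id_comp (𝟙 (X.u.obj A))))))

end GCwF

namespace CompCat

variable {X : CompCat.{v, max u v}}

/-- The unit at a term `a`, as an arrow to the variable. -/
noncomputable def unitHom (a : Term X) : a ⟶ X.var a.type := X.varAdj.unit.app a

theorem unitHom_wkMap (a : Term X) : (unitHom a).hom ≫ X.wkMap a.type = 𝟙 a.type := by
  have h := X.varAdj.left_triangle_components a
  rw [varAdj_counit] at h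
  exact h

theorem p_unitHom_counitLeft (a : Term X) :
    X.p.map (unitHom a).hom ≫ X.counitLeft a.type = eqToHom (X.cod_obj a.type).symm ≫ a.sec := by
  have h := right_eq_of_hom_var (unitHom a)
  rw [unitHom_wkMap, CategoryTheory.Functor.map_id, Arrow.id_left, Category.comp_id] at h
  rw [p_map_eq, counitLeft, Category.assoc, Category.assoc, eqToHom_trans, h]

theorem counitApp_mapSec (a : Term X) :
    X.counitApp.mapSec (X.toGCwF.toTerm.obj a) = a.sec := by
  have : IsIso (X.counitApp.cod a.type) := (X.counitApp.isTransport_cod a.type).isIso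
  refine (cancel_epi (X.counitApp.cod a.type)).1 ?_
  exact (X.counitApp.cod_mapSec (X.toGCwF.toTerm.obj a)).trans (p_unitHom_counitLeft a)

theorem toTerm_comp_mapTerm (X : CompCat.{v, max u v}) :
    X.toGCwF.toTerm ⋙ X.counitApp.mapTerm = 𝟭 (Term X) :=
  Term.lift_congr (H := Term.forget X) (s' := Term.sec) (hs' := Term.sec_hom)
    (w := fun k => (X.counitApp.mapTerm.map (X.toGCwF.toTerm.map k)).w) (w' := fun k => k.w)
    counitApp_mapSec

theorem rightTriangle (X : CompCat.{v, max u v}) :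
    X.toGCwF.unitApp.comp X.counitApp.toGCwF = GCwF.Hom.id X.toGCwF :=
  GCwF.Hom.ext_app rfl rfl (toTerm_comp_mapTerm X)
    fun a => heq_of_eq (Category.id_comp (𝟙 a.type))

end CompCat

/-! ### The adjoint biequivalence -/

namespace GCwF

open Bicategory

variable {X Y : GCwF.{v, max u v}}

/-- The functor to comprehension categories forgets the terms, on which the unit constraints are not
identities. -/
theorem unitNat_toCompCat_structural (f : X ⟶ Y) :
    CompCat.Structural (toCompCatFunctor.map₂ (unit.naturality f).hom) :=
  ⟨fun _ => .id _, fun _ => .id _⟩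

theorem unitNat_toGCwF_structural {X Y : CompCat.{v, max u v}} (g : X ⟶ Y) :
    Structural (unit.naturality (CompCat.toGCwFFunctor.map g)).hom :=
  unitNat_structural (CompCat.Hom.toGCwF g) fun _ => .id _

theorem unitNat_unitApp_structural (X : GCwF.{v, max u v}) :
    Structural (unit.naturality (unit.app X)).hom :=
  unitNat_structural X.unitApp fun _ => .id _

/-- The adjoint biequivalence between generalised categories with families and comprehension
categories. -/
noncomputable def biequivalence :
    AdjointBiequivalence GCwF.{v, max u v} CompCat.{v, max u v} where
  left := toCompCatFunctor
  right := CompCat.toGCwFFunctor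
  unit := unit
  counit := CompCat.counit
  unit_equiv := unitApp_equiv
  counit_equiv := CompCat.counitApp_equiv
  leftTri X := eqToIso (leftTriangle X)
  rightTri X := eqToIso (CompCat.rightTriangle X)
  leftTri_naturality {X Y} f := CompCat.Structural.eq
    (.comp (.whiskerLeft _ (.eqToIso_hom (leftTriangle Y)))
      (.comp (.rightUnitor_hom _) (.leftUnitor_inv _)))
    (.comp (.associator_inv _ _ _) <|
      .comp (.whiskerRight (.comp (toCompCatFunctor_mapComp_structural _ _).2
        (.comp (unitNat_toCompCat_structural f) (toCompCatFunctor_mapComp_structural _ _).1)) _) <|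
      .comp (.associator_hom _ _ _) <|
      .comp (.whiskerLeft _ (.eqToIso_hom (CompCat.counit_naturality (Hom.toCompCat f)))) <|
      .comp (.associator_inv _ _ _) (.whiskerRight (.eqToIso_hom (leftTriangle X)) _))
  rightTri_naturality {X Y} g := Structural.eq
    (.comp (.whiskerLeft _ (.eqToIso_hom (CompCat.rightTriangle Y)))
      (.comp (.rightUnitor_hom _) (.leftUnitor_inv _)))
    (.comp (.associator_inv _ _ _) <|
      .comp (.whiskerRight (unitNat_toGCwF_structural g) _) <|
      .comp (.associator_hom _ _ _) <|
      .comp (.whiskerLeft _ (.comp (CompCat.toGCwFFunctor_mapComp_structural _ _).2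
        (.comp (CompCat.Hom₂.toGCwF_structural (.eqToIso_hom (CompCat.counit_naturality g)))
          (CompCat.toGCwFFunctor_mapComp_structural _ _).1))) <|
      .comp (.associator_inv _ _ _) (.whiskerRight (.eqToIso_hom (CompCat.rightTriangle X)) _))
  unit_swallowtail X := Structural.eq
    (.whiskerLeft _ (.eqToIso_hom (CompCat.rightTriangle X.toCompCat)))
    (.comp (.associator_inv _ _ _) <|
      .comp (.whiskerRight (unitNat_unitApp_structural X) _) <|
      .comp (.associator_hom _ _ _) <|
      .whiskerLeft _ (.comp (CompCat.toGCwFFunctor_mapComp_structural _ _).2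
        (.comp (CompCat.Hom₂.toGCwF_structural (.eqToIso_hom (leftTriangle X)))
          (CompCat.toGCwFFunctor_mapId_structural X.toCompCat))))
  counit_swallowtail X := CompCat.Structural.eq
    (.whiskerRight (.eqToIso_hom (leftTriangle X.toGCwF)) _)
    (.comp (.associator_hom _ _ _) <|
      .comp (.whiskerLeft _ (.eqToIso_inv (CompCat.counit_naturality X.counitApp))) <|
      .comp (.associator_inv _ _ _) <|
      .whiskerRight (.comp (toCompCatFunctor_mapComp_structural _ _).2
        (.comp (Hom₂.toCompCat_structural (.eqToIso_hom (CompCat.rightTriangle X)))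
          (toCompCatFunctor_mapId_structural X.toGCwF))) _)

theorem biequivalence_right_comp_left :
    biequivalence.right.comp biequivalence.left =
      StrictPseudofunctor.id CompCat.{v, max u v} :=
  StrictPseudofunctor.hext CompCat.toGCwF_toCompCat
    (fun f => CompCat.Hom.toGCwF_toCompCat_heq f) fun η => CompCat.Hom₂.toGCwF_toCompCat_heq η

end GCwF

/-! ### Restriction to the pseudo morphisms -/

namespace CompCat

section

variable {X Y : CompCat.{v, u}}

theorem Hom.isIso_ζ_iff (f : Hom X Y) : IsIso f.ζ ↔ ∀ e, IsIso (f.dom e) := by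
  constructor
  · intro h e
    exact inferInstanceAs (IsIso (f.ζ.app e).left)
  · intro h
    have : ∀ e, IsIso (f.ζ.app e) := fun e => by
      have h₁ : IsIso (f.ζ.app e).left := h e
      have h₂ : IsIso (f.ζ.app e).right := inferInstanceAs (IsIso (f.cod e))
      exact Arrow.isIso_of_isIso_left_of_isIso_right _
    exact NatIso.isIso_of_isIso_app _

/-- A lax morphism isomorphic to a pseudo morphism is pseudo. -/
theorem Hom.isIso_ζ_of_iso {f g : X ⟶ Y} (e : f ≅ g) (h : IsIso (Hom.ζ f)) : IsIso (Hom.ζ g) := by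
  refine (Hom.isIso_ζ_iff g).2 fun A => ?_
  have h₁ : (Hom₂.base e.inv).app (X.χ.obj A).left ≫ (Hom₂.base e.hom).app (X.χ.obj A).left = 𝟙 _ :=
    congrArg (fun η => (Hom₂.base η).app (X.χ.obj A).left) e.inv_hom_id
  have h₂ : (Hom₂.base e.hom).app (X.χ.obj A).left ≫ (Hom₂.base e.inv).app (X.χ.obj A).left = 𝟙 _ :=
    congrArg (fun η => (Hom₂.base η).app (X.χ.obj A).left) e.hom_inv_id
  have h₃ : (Hom₂.total e.inv).app A ≫ (Hom₂.total e.hom).app A = 𝟙 _ :=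
    congrArg (fun η => (Hom₂.total η).app A) e.inv_hom_id
  have h₄ : (Hom₂.total e.hom).app A ≫ (Hom₂.total e.inv).app A = 𝟙 _ :=
    congrArg (fun η => (Hom₂.total η).app A) e.hom_inv_id
  have i₁ : IsIso ((Hom₂.base e.hom).app (X.χ.obj A).left) := ⟨_, h₂, h₁⟩
  have i₂ : IsIso ((Hom₂.total e.hom).app A) := ⟨_, h₄, h₃⟩
  have i₃ := (Hom.isIso_ζ_iff f).1 h A
  have h₅ := (comm_iff.1 (Hom₂.comm e.hom)).1 A
  have i₄ : IsIso ((Hom₂.base e.hom).app (X.χ.obj A).left ≫ Hom.dom g A) := by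
    rw [← h₅]
    infer_instance
  exact (isIso_comp_left_iff _ _).1 i₄

theorem Hom.isIso_ζ_of_heq {X' Y' : CompCat.{v, u}} (hX : X' = X) (hY : Y' = Y) {f' : Hom X' Y'}
    {f : Hom X Y} (h : HEq f' f) (hf : IsIso f.ζ) : IsIso f'.ζ := by
  subst hX hY
  obtain rfl := eq_of_heq h
  exact hf

theorem Hom.isIso_ζ_of_isTransport (f : Hom X Y) (h : ∀ A, IsTransport (f.ζ.app A)) :
    IsIso f.ζ := by
  have : ∀ A, IsIso (f.ζ.app A) := fun A => (h A).isIso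
  exact NatIso.isIso_of_isIso_app _

theorem Hom.isIso_ζ_of_comp {X Y Z : CompCat.{v, u}} (f : Hom X Y) (g : Hom Y Z)
    (hg : ∀ A, IsIso (g.dom A)) (h : IsIso (f.comp g).ζ) (A : X.Total) :
    IsIso (g.base.map (f.dom A)) := by
  have h₁ : IsIso (g.base.map (f.dom A) ≫ g.dom (f.total.obj A)) :=
    (Hom.isIso_ζ_iff _).1 h A
  have h₂ := hg (f.total.obj A)
  exact (isIso_comp_right_iff _ _).1 h₁

end

variable {X : CompCat.{v, max u v}}

theorem isIso_counitApp_ζ (X : CompCat.{v, max u v}) : IsIso X.counitApp.ζ :=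
  Hom.isIso_ζ_of_isTransport _ (isTransport_counitNat_app (X := X))

theorem isIso_counitInvApp_ζ (X : CompCat.{v, max u v}) : IsIso X.counitInvApp.ζ :=
  Hom.isIso_ζ_of_isTransport _ isTransport_counitInvApp

end CompCat

namespace GCwF

theorem Hom.isIso_mate_iff_isIso_toCompCat_ζ {X Y : GCwF.{v, u}} (f : Hom X Y) :
    IsIso f.mate ↔ IsIso f.toCompCat.ζ := by
  rw [f.isIso_mate_iff, CompCat.Hom.isIso_ζ_iff]
  refine forall_congr' fun A => ?_
  have h₁ : IsIso (f.ty_fib.cmp (X.Sig.obj (X.Del.obj A))) :=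
    IsTransport.isIso ⟨_, rfl⟩
  exact (isIso_comp_left_iff (f.ty_fib.cmp (X.Sig.obj (X.Del.obj A))) (Y.u.map (f.r A))).symm

variable {X Y : GCwF.{v, max u v}}

theorem isIso_unitApp_dom (A : X.Ty) : IsIso (X.unitApp.toCompCat.dom A) := by
  have h : IsIso (X.toCompCat.counitLeft A) := IsTransport.isIso ⟨_, rfl⟩
  have h' : IsIso (X.unitApp.toCompCat.dom A ≫ X.toCompCat.counitLeft A) := by
    rw [unitApp_dom_counitLeft]
    exact inferInstanceAs (IsIso (𝟙 (X.u.obj (X.Sig.obj (X.Del.obj A)))))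
  exact (@isIso_comp_right_iff _ _ _ _ _ (X.unitApp.toCompCat.dom A) (X.toCompCat.counitLeft A)
    h).1 h'

theorem isIso_unitApp_mate (X : GCwF.{v, max u v}) : IsIso X.unitApp.mate :=
  X.unitApp.isIso_mate_iff_isIso_toCompCat_ζ.2 ((CompCat.Hom.isIso_ζ_iff _).2 isIso_unitApp_dom)

/-- The quasi-inverse of the unit is pseudo, since its composite with the unit is isomorphic to the
identity and the comprehension part of the unit is invertible. -/
theorem isIso_unitInvApp_mate (X : GCwF.{v, max u v}) : IsIso X.unitInvApp.mate := by
  refine X.unitInvApp.isIso_mate_iff_isIso_toCompCat_ζ.2 ((CompCat.Hom.isIso_ζ_iff _).2 fun A => ?_)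
  have h₁ : IsIso (CompCat.Hom.ζ (toCompCatFunctor.map (Hom.id X.toCompCat.toGCwF))) :=
    (Hom.isIso_mate_iff_isIso_toCompCat_ζ _).1 (pseudo.id_mem X.toCompCat.toGCwF)
  have h₂ : IsIso (X.unitInvApp.comp X.unitApp).toCompCat.ζ := CompCat.Hom.isIso_ζ_of_iso
    ((toCompCatFunctor.mapFunctor _ _).mapIso (unitEquivCounitIso X).symm) h₁
  rw [Hom.toCompCat_comp_ζ] at h₂
  exact CompCat.Hom.isIso_ζ_of_comp X.unitInvApp.toCompCat X.unitApp.toCompCat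
    isIso_unitApp_dom h₂ A

theorem restricts_biequivalence :
    (biequivalence.{v, u}).Restricts pseudo CompCat.pseudo where
  left_mem f := (Hom.isIso_mate_iff_isIso_toCompCat_ζ f).1
  right_mem f hf := (Hom.isIso_mate_iff_isIso_toCompCat_ζ (CompCat.Hom.toGCwF f)).2
    (CompCat.Hom.isIso_ζ_of_heq (CompCat.toGCwF_toCompCat _) (CompCat.toGCwF_toCompCat _)
      (CompCat.Hom.toGCwF_toCompCat_heq f) hf)
  unit_mem := isIso_unitApp_mate
  counit_mem := CompCat.isIso_counitApp_ζ
  unit_equiv X := ⟨Wide.Hom.mk X.unitInvApp (isIso_unitInvApp_mate X),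
    ⟨Wide.mkIso X.unitEquivUnitIso⟩, ⟨Wide.mkIso X.unitEquivCounitIso⟩⟩
  counit_equiv X := ⟨Wide.Hom.mk X.counitInvApp (CompCat.isIso_counitInvApp_ζ X),
    ⟨Wide.mkIso (eqToIso X.counitApp_comp_counitInvApp.symm)⟩,
    ⟨Wide.mkIso (eqToIso X.counitInvApp_comp_counitApp)⟩⟩

end GCwF

section Restrict

open Bicategory

universe w₁ w₂ v₁ v₂ u₁ u₂

variable {A : Type u₁} [Bicategory.{w₁, v₁} A]

theorem restrictFunctor_eq_id (W : OneCellClass A) (F : StrictPseudofunctor A A)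
    (h : ∀ {a b : A} (f : a ⟶ b), W.Mem f → W.Mem (F.map f)) (hF : F = StrictPseudofunctor.id A) :
    restrictFunctor W W F h = StrictPseudofunctor.id (Wide W) := by
  subst hF
  exact StrictPseudofunctor.hext (fun _ => rfl) (fun _ => HEq.rfl) fun _ => HEq.rfl

variable {B : Type u₂} [Bicategory.{w₂, v₂} B]

theorem AdjointBiequivalence.restrict_right_comp_left (e : AdjointBiequivalence A B)
    {W : OneCellClass A} {W' : OneCellClass B} (h : e.Restricts W W')
    (he : e.right.comp e.left = StrictPseudofunctor.id B) :
    (e.restrict h).right.comp (e.restrict h).left = StrictPseudofunctor.id (Wide W') := by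
  refine Eq.trans ?_ (restrictFunctor_eq_id W' (e.right.comp e.left)
    (fun f hf => h.left_mem _ (h.right_mem f hf)) he)
  exact StrictPseudofunctor.hext (fun _ => rfl) (fun _ => HEq.rfl) fun _ => HEq.rfl

end Restrict

theorem mainTheorem1 :
    ∃ e : AdjointBiequivalence GCwF.{v, max u v} CompCat.{v, max u v},
      e.right.comp e.left = StrictPseudofunctor.id CompCat.{v, max u v} ∧
      ∃ h : e.Restricts GCwF.pseudo CompCat.pseudo,
        (e.restrict h).right.comp (e.restrict h).left =
          StrictPseudofunctor.id (Wide CompCat.pseudo.{v, max u v}) :=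
  ⟨GCwF.biequivalence.{v, u}, GCwF.biequivalence_right_comp_left, GCwF.restricts_biequivalence,
    GCwF.biequivalence.restrict_right_comp_left _ GCwF.biequivalence_right_comp_left⟩
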